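/- **Setting.** Let $d\in\{2,3\}$, let $\Omega\subset\mathbb R^d$ be a bounded connected open set with $C^2$ boundary, $T>0$, $p\in(d,\infty)$, $\delta>0$, $\rho\in\mathbb R$, $\lambda_1,\lambda_2>0$ and $(\ell_{ij})\in\mathbb R^{d\times d}$. Assume: * $\mathsf c:[0,\infty)\to[0,\infty)$ is continuous and $c_0(1+\theta)^{\sigma-1}\le \mathsf c(\theta)\le c_1(1+\theta)^{\sigma_1-1}$ for all $\theta\ge 0$, for some $\sigma_1\ge\sigma>\frac{2d}{d+2}$ and $c_1\ge c_0>0$; $\mathsf K:[0,\infty)\to(0,\infty)$ is continuous. Put $h(r)=\int_0^r\mathsf c(s)\,ds$, $\Theta(w)=h^{-1}(w)$ for $w\ge0$, $\Theta(w)=0$ for $w<0$, and $K(w)=\mathsf K(\Theta(w))/\mathsf c(\Theta(w))$. * $a\in C^1(\mathbb R)$, $b\in C^2(\mathbb R)$, $a,b\ge0$ on $[0,1]$; $W=I_{[0,\infty)}+\widehat\gamma$ with $\widehat\gamma\in C^2(\mathbb R)$, and $\gamma=\widehat\gamma'$, where $I_C$ is the convex indicator function of $C$ ($0$ on $C$,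 $+\infty$ elsewhere). * $\phi:\Omega\times\mathbb R^d\to[0,\infty)$ is a Carathéodory integrand; for a.e. $x$ the map $\phi(x,\cdot)$ is convex and $C^1$ with $\phi(x,0)=0$, and $\mathbf d=\nabla_\zeta\phi$ satisfies, for a.e. $x$ and all $\zeta$, $\phi(x,\zeta)\ge c_4|\zeta|^p-c_5$ and $|\mathbf d(x,\zeta)|\le c_6(1+|\zeta|^{p-1})$ with constants $c_4,c_5,c_6>0$. Let $\Phi:L^2(\Omega)\to[0,\infty]$, $\Phi(\chi)=\int_\Omega\phi(x,\nabla\chi)\,dx$ if $\phi(\cdot,\nabla\chi)\in L^1(\Omega)$ and $+\infty$ otherwise, and let $\mathcal B=\partial\Phi$ be its subdifferential in $L^2(\Omega)$. * $\mathbf f\in L^2(0,T;L^2(\Omega;\mathbb R^d))$, $g\in L^1(0,T;L^1(\Omega))$; initial data $w_0\in L^1(\Omega)$, $\mathbf u_0,\mathbf v_0\in L^2(\Omega;\mathbb R^d)$, $\chi_0\in L^2(\Omega)$. Write $\varepsilon(\mathbf u)$ for the symmetric gradient, $\varepsilon(\mathbf u)\mathrm R_e\varepsilon(\mathbf v)=\lambda_1\,\mathrm{div}\,\mathbf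 u\,\mathrm{div}\,\mathbf v+2\lambda_2\sum_{ij}\varepsilon_{ij}(\mathbf u)\varepsilon_{ij}(\mathbf v)$, $e(\eta;\mathbf u,\mathbf v)=\int_\Omega\eta\,\varepsilon(\mathbf u)\mathrm R_e\varepsilon(\mathbf v)\,dx$, and $v(\eta;\mathbf u,\mathbf v)=\sum_{ij}\int_\Omega\eta\,\ell_{ij}\varepsilon_{ij}(\mathbf u)\varepsilon_{ij}(\mathbf v)\,dx$. **Regularity (R)** of a triple $(w,\mathbf u,\chi)$: for every $1\le r<\frac{d+2}{d+1}$, with $r'$ the conjugate exponent of $r$, $w\in L^r(0,T;W^{1,r}(\Omega))\cap L^\infty(0,T;L^1(\Omega))\cap BV([0,T];W^{1,r'}(\Omega)^*)$; $\mathbf u\in H^1(0,T;H^2\cap H^1_0)\cap W^{1,\infty}(0,T;H^1_0)\cap H^2(0,T;L^2)$ (spaces of $\mathbb R^d$-valued functions on $\Omega$); $\chi\in L^\infty(0,T;W^{1,p}(\Omega))\cap H^1(0,T;L^2(\Omega))$. We write $\int_\Omega\psi\,w(t)(dx)$ for the value of the functional $w(t)$ at $\psi$. **Conditions on $(w,\mathbf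 u,\chi)$, with $\xi\in L^1(0,T;L^1(\Omega))$:** 1. $\chi_t\le0$ a.e. in $\Omega\times(0,T)$. 2. For all $\varphi\in W^{1,p}(\Omega)$ with $\varphi\le0$ and a.a. $t\in(0,T)$, $$\int_\Omega\Big(\chi_t\varphi+\mathbf d(x,\nabla\chi)\cdot\nabla\varphi+\xi\varphi+\gamma(\chi)\varphi+b'(\chi)\tfrac{\varepsilon(\mathbf u)\mathrm R_e\varepsilon(\mathbf u)}2\varphi-\Theta(w)\varphi\Big)dx\ge0 .$$ 3. For all $\varphi\in W^{1,p}(\Omega)$ with $\varphi\ge0$ and a.a. $t\in(0,T)$, $\int_\Omega\xi(t)(\varphi-\chi(t))\,dx\le0$. 4. For all $t\in(0,T]$, for $s=0$ and for a.a. $0<s\le t$, $$\int_s^t\!\!\int_\Omega|\chi_t|^2+\Phi(\chi(t))+\int_\Omega W(\chi(t))\le\Phi(\chi(s))+\int_\Omega W(\chi(s))+\int_s^t\!\!\int_\Omega\chi_t\Big(-b'(\chi)\tfrac{\varepsilon(\mathbf u)\mathrm R_e\varepsilon(\mathbf u)}2+\Theta(w)\Big).$$ A triple is a **weak solution** (for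 $\mu=1$) if it satisfies (R), the initial conditions $w(0)=w_0$, $\mathbf u(0)=\mathbf u_0$, $\mathbf u_t(0)=\mathbf v_0$, $\chi(0)=\chi_0$, conditions 1 and 4, conditions 2 and 3 for some $\xi\in L^1(0,T;L^1(\Omega))$, the enthalpy equation $$\int_\Omega\varphi(t)\,w(t)(dx)-\int_0^t\!\!\int_\Omega w\varphi_t+\int_0^t\!\!\int_\Omega\chi_t\Theta(w)\varphi+\rho\int_0^t\!\!\int_\Omega\mathrm{div}(\mathbf u_t)\Theta(w)\varphi+\int_0^t\!\!\int_\Omega K(w)\nabla w\cdot\nabla\varphi=\int_0^t\!\!\int_\Omega g\varphi+\int_\Omega w_0\varphi(0)$$ for all $t\in(0,T]$, all $1\le r<\frac{d+2}{d+1}$ and all $\varphi\in C^0([0,T];W^{1,r'}(\Omega))\cap W^{1,r'}(0,T;L^{r'}(\Omega))$ (the term with $K(w)$ being integrable), and for a.a. $t\in(0,T)$ and all $\mathbf v\in H^1_0(\Omega;\mathbb R^d)$ the momentum equation $$\int_\Omega\mathbf u_{tt}\cdot\mathbf v+v(a(\chi)+\delta;\mathbf u_t,\mathbf v)+e(b(\chi);\mathbf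 u,\mathbf v)-\rho\int_\Omega\Theta(w)\,\mathrm{div}\,\mathbf v=\int_\Omega\mathbf f\cdot\mathbf v .$$ **Proposition.** (a) Every weak solution satisfies the total energy inequality: for all $t\in(0,T]$, for $s=0$ and for a.a. $0<s\le t$, $$\begin{aligned}&\int_\Omega w(t)(dx)+\tfrac12\int_\Omega|\mathbf u_t(t)|^2+\int_s^t\!\!\int_\Omega|\chi_t|^2+\int_s^t v(a(\chi)+\delta;\mathbf u_t,\mathbf u_t)\,dr+\tfrac12e(b(\chi(t));\mathbf u(t),\mathbf u(t))+\Phi(\chi(t))+\int_\Omega W(\chi(t))\\&\le\int_\Omega w(s)(dx)+\tfrac12\int_\Omega|\mathbf u_t(s)|^2+\tfrac12e(b(\chi(s));\mathbf u(s),\mathbf u(s))+\Phi(\chi(s))+\int_\Omega W(\chi(s))+\int_s^t\!\!\int_\Omega\mathbf f\cdot\mathbf u_t+\int_s^t\!\!\int_\Omega g .\end{aligned}$$ (b) Let $(w,\mathbf u,\chi)$ satisfy (R). Suppose that $\mathcal B(\chi)\in L^2(0,T;L^2(\Omega))$ and that there is $\xi\in L^2(0,T;L^2(\Omega))$ with $\xi\in\partial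 I_{[0,\infty)}(\chi)$ a.e. in $\Omega\times(0,T)$ such that conditions 1–4 hold. Then there is $\zeta\in L^2(0,T;L^2(\Omega))$ with $\zeta\in\partial I_{(-\infty,0]}(\chi_t)$ a.e. in $\Omega\times(0,T)$ and $$\chi_t+\zeta+\mathcal B(\chi)+\xi+\gamma(\chi)=-b'(\chi)\tfrac{\varepsilon(\mathbf u)\mathrm R_e\varepsilon(\mathbf u)}2+\Theta(w)\qquad\text{a.e. in }\Omega\times(0,T).$$ -/

import Mathlib

open MeasureTheory Set Filter Topology
open scoped ENNReal NNReal ContDiff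

noncomputable section

namespace DamagePDE

/-! ## Function spaces -/

/-- Euclidean space of dimension `d`. -/
abbrev Rd (d : ℕ) := EuclideanSpace ℝ (Fin d)

/-- Values of the gradient of an `F`-valued function: the `d` partial derivatives.
For `F = ℝ` this is `Rd d`. -/
abbrev Grad (d : ℕ) (F : Type) := PiLp 2 (fun _ : Fin d => F)

/-- Classes of measurable `F`-valued functions on `Ω` modulo equality almost everywhere. -/
abbrev L0 {d : ℕ} (Ω : Set (Rd d)) (F : Type) [NormedAddCommGroup F] :=
  Rd d →ₘ[volume.restrict Ω] F

/-- The Lebesgue space `L^q(Ω; F)`. -/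
abbrev LL {d : ℕ} (Ω : Set (Rd d)) (F : Type) [NormedAddCommGroup F] (q : ℝ≥0∞) :=
  Lp F q (volume.restrict Ω)

/-- `G` is the weak gradient of `u` in `Ω`. -/
structure HasWeakGrad {d : ℕ} (Ω : Set (Rd d)) {F : Type} [NormedAddCommGroup F]
    [NormedSpace ℝ F] (u : Rd d → F) (G : Rd d → Grad d F) : Prop where
  locInt : LocallyIntegrableOn u Ω
  locInt_grad : LocallyIntegrableOn G Ω
  parts : ∀ ψ : Rd d → ℝ, ContDiff ℝ ∞ ψ → HasCompactSupport ψ → tsupport ψ ⊆ Ω →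
    ∀ i : Fin d, ∫ x in Ω, fderiv ℝ ψ x (EuclideanSpace.single i 1) • u x
      = - ∫ x in Ω, ψ x • G x i

theorem integrable_test {d : ℕ} {Ω : Set (Rd d)} {F : Type} [NormedAddCommGroup F]
    [NormedSpace ℝ F] {u : Rd d → F} (hu : LocallyIntegrableOn u Ω) {ψ : Rd d → ℝ}
    (hc : Continuous ψ) (hs : HasCompactSupport ψ) (hsub : tsupport ψ ⊆ Ω) :
    Integrable (fun x => ψ x • u x) (volume.restrict Ω) := by
  have h1 : IntegrableOn u (tsupport ψ) := hu.integrableOn_compact_subset hsub hs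
  have h2 : IntegrableOn (fun x => ψ x • u x) (tsupport ψ) :=
    h1.continuousOn_smul hc.continuousOn hs
  have h3 : Integrable (fun x => ψ x • u x) volume := by
    rw [← integrableOn_iff_integrable_of_support_subset (s := tsupport ψ)]
    · exact h2
    · intro x hx
      apply subset_tsupport
      intro h0
      exact hx (by simp [h0])
  exact h3.integrableOn

theorem integrable_test_fderiv {d : ℕ} {Ω : Set (Rd d)} {F : Type} [NormedAddCommGroup F]
    [NormedSpace ℝ F] {u : Rd d → F} (hu : LocallyIntegrableOn u Ω) {ψ : Rd d → ℝ}
    (hc : ContDiff ℝ ∞ ψ) (hs : HasCompactSupport ψ) (hsub : tsupport ψ ⊆ Ω) (v : Rd d) :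
    Integrable (fun x => fderiv ℝ ψ x v • u x) (volume.restrict Ω) := by
  have hcont : Continuous (fun x => fderiv ℝ ψ x v) :=
    (hc.continuous_fderiv (by simp)).clm_apply continuous_const
  have hts : tsupport (fun x => fderiv ℝ ψ x v) ⊆ tsupport ψ := by
    refine closure_minimal ?_ (isClosed_tsupport ψ)
    intro x hx
    by_contra h
    have h0 : fderiv ℝ ψ x = 0 := by
      have := support_fderiv_subset ℝ (f := ψ)
      by_contra h1
      exact h (this h1)
    exact hx (by simp [h0])
  exact integrable_test hu hcont (hs.of_isClosed_subset (isClosed_tsupport _) hts)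
    (hts.trans hsub)

theorem locInt_apply {d : ℕ} {Ω : Set (Rd d)} {F : Type} [NormedAddCommGroup F]
    [NormedSpace ℝ F] {G : Rd d → Grad d F} (h : LocallyIntegrableOn G Ω) (i : Fin d) :
    LocallyIntegrableOn (fun x => G x i) Ω := by
  intro x hx
  obtain ⟨s, hs, hint⟩ := h x hx
  exact ⟨s, hs, (PiLp.proj (𝕜 := ℝ) 2 (fun _ : Fin d => F) i).integrable_comp hint⟩

theorem HasWeakGrad.add {d : ℕ} {Ω : Set (Rd d)} {F : Type} [NormedAddCommGroup F]
    [NormedSpace ℝ F] {u v : Rd d → F} {G H : Rd d → Grad d F}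
    (hu : HasWeakGrad Ω u G) (hv : HasWeakGrad Ω v H) : HasWeakGrad Ω (u + v) (G + H) where
  locInt := hu.locInt.add hv.locInt
  locInt_grad := hu.locInt_grad.add hv.locInt_grad
  parts := by
    intro ψ hψ hs hsub i
    simp only [Pi.add_apply, PiLp.add_apply, smul_add]
    rw [integral_add (integrable_test_fderiv hu.locInt hψ hs hsub _)
        (integrable_test_fderiv hv.locInt hψ hs hsub _),
      integral_add (integrable_test (locInt_apply hu.locInt_grad i) hψ.continuous hs hsub)
        (integrable_test (locInt_apply hv.locInt_grad i) hψ.continuous hs hsub),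
      hu.parts ψ hψ hs hsub i, hv.parts ψ hψ hs hsub i, neg_add]

theorem HasWeakGrad.smul {d : ℕ} {Ω : Set (Rd d)} {F : Type} [NormedAddCommGroup F]
    [NormedSpace ℝ F] {u : Rd d → F} {G : Rd d → Grad d F} (c : ℝ)
    (hu : HasWeakGrad Ω u G) : HasWeakGrad Ω (c • u) (c • G) where
  locInt := hu.locInt.smul c
  locInt_grad := hu.locInt_grad.smul c
  parts := by
    intro ψ hψ hs hsub i
    simp only [Pi.smul_apply, PiLp.smul_apply, smul_comm _ c]
    rw [integral_smul, integral_smul, hu.parts ψ hψ hs hsub i, smul_neg]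

theorem HasWeakGrad.congr {d : ℕ} {Ω : Set (Rd d)} {F : Type} [NormedAddCommGroup F]
    [NormedSpace ℝ F] {u v : Rd d → F} {G H : Rd d → Grad d F}
    (hv : LocallyIntegrableOn v Ω) (hH : LocallyIntegrableOn H Ω)
    (huv : u =ᵐ[volume.restrict Ω] v) (hGH : G =ᵐ[volume.restrict Ω] H)
    (hu : HasWeakGrad Ω u G) : HasWeakGrad Ω v H where
  locInt := hv
  locInt_grad := hH
  parts := by
    intro ψ hψ hs hsub i
    have h1 : ∫ x in Ω, fderiv ℝ ψ x (EuclideanSpace.single i 1) • v x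
        = ∫ x in Ω, fderiv ℝ ψ x (EuclideanSpace.single i 1) • u x :=
      integral_congr_ae (by filter_upwards [huv] with x hx; rw [hx])
    have h2 : ∫ x in Ω, ψ x • H x i = ∫ x in Ω, ψ x • G x i :=
      integral_congr_ae (by filter_upwards [hGH] with x hx; rw [hx])
    rw [h1, h2, hu.parts ψ hψ hs hsub i]

theorem locInt_Lp {d : ℕ} {Ω : Set (Rd d)} {F : Type} [NormedAddCommGroup F]
    {q : ℝ≥0∞} [hq : Fact (1 ≤ q)] (f : LL Ω F q) : LocallyIntegrableOn f Ω :=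
  locallyIntegrableOn_of_locallyIntegrable_restrict ((Lp.memLp f).locallyIntegrable hq.out)

/-- The Sobolev space `W^{1,q}(Ω; F)`, as the space of pairs (function, weak gradient), normed
by the maximum of the two `L^q` norms. -/
def W1sub {d : ℕ} (Ω : Set (Rd d)) (F : Type) [NormedAddCommGroup F] [NormedSpace ℝ F]
    (q : ℝ≥0∞) [Fact (1 ≤ q)] : Submodule ℝ (LL Ω F q × LL Ω (Grad d F) q) where
  carrier := {f | HasWeakGrad Ω f.1 f.2}
  add_mem' := by
    intro f g hf hg
    exact (HasWeakGrad.add hf hg).congr (locInt_Lp _) (locInt_Lp _)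
      (Lp.coeFn_add _ _).symm (Lp.coeFn_add _ _).symm
  zero_mem' := by
    refine HasWeakGrad.congr (u := 0) (G := 0) (locInt_Lp _) (locInt_Lp _)
      (Lp.coeFn_zero _ _ _).symm (Lp.coeFn_zero _ _ _).symm ⟨?_, ?_, ?_⟩
    · exact locallyIntegrableOn_zero
    · exact locallyIntegrableOn_zero
    · intro ψ _ _ _ i
      simp
  smul_mem' := by
    intro c f hf
    exact (HasWeakGrad.smul c hf).congr (locInt_Lp _) (locInt_Lp _)
      (Lp.coeFn_smul _ _).symm (Lp.coeFn_smul _ _).symm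

abbrev W1 {d : ℕ} (Ω : Set (Rd d)) (F : Type) [NormedAddCommGroup F] [NormedSpace ℝ F]
    (q : ℝ≥0∞) [Fact (1 ≤ q)] := ↥(W1sub Ω F q)

/-- The underlying function of an element of `W^{1,q}(Ω; F)`. -/
def W1.fn {d : ℕ} {Ω : Set (Rd d)} {F : Type} [NormedAddCommGroup F] [NormedSpace ℝ F]
    {q : ℝ≥0∞} [Fact (1 ≤ q)] (f : W1 Ω F q) : LL Ω F q := f.1.1

/-- The weak gradient of an element of `W^{1,q}(Ω; F)`. -/
def W1.grad {d : ℕ} {Ω : Set (Rd d)} {F : Type} [NormedAddCommGroup F] [NormedSpace ℝ F]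
    {q : ℝ≥0∞} [Fact (1 ≤ q)] (f : W1 Ω F q) : LL Ω (Grad d F) q := f.1.2

/-- The space `H²(Ω; F)`: pairs consisting of an `H¹` function `f` and an `H¹` field that equals
the weak gradient of `f`. -/
def H2sub {d : ℕ} (Ω : Set (Rd d)) (F : Type) [NormedAddCommGroup F] [NormedSpace ℝ F] :
    Submodule ℝ (W1 Ω F 2 × W1 Ω (Grad d F) 2) where
  carrier := {f | f.1.1.2 = f.2.1.1}
  add_mem' := by
    intro f g hf hg
    simp only [mem_ofPred_eq] at hf hg ⊢
    simp [hf, hg]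
  zero_mem' := by simp
  smul_mem' := by
    intro c f hf
    simp only [mem_ofPred_eq] at hf ⊢
    simp [hf]

abbrev H2 {d : ℕ} (Ω : Set (Rd d)) (F : Type) [NormedAddCommGroup F] [NormedSpace ℝ F] :=
  ↥(H2sub Ω F)

/-- `H¹₀(Ω; F)`: the closure of the smooth compactly supported functions in `H¹(Ω; F)`. -/
def H10 {d : ℕ} (Ω : Set (Rd d)) (F : Type) [NormedAddCommGroup F] [NormedSpace ℝ F] :
    Set (W1 Ω F 2) :=
  closure {f | ∃ ψ : Rd d → F, ContDiff ℝ ∞ ψ ∧ HasCompactSupport ψ ∧ tsupport ψ ⊆ Ω ∧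
    f.fn =ᵐ[volume.restrict Ω] ψ}

open Classical in
/-- The weak gradient of a function, where it exists (it is then unique up to null sets). -/
def weakGrad {d : ℕ} (Ω : Set (Rd d)) {F : Type} [NormedAddCommGroup F] [NormedSpace ℝ F]
    (u : Rd d → F) : Rd d → Grad d F :=
  if h : ∃ G, HasWeakGrad Ω u G then h.choose else 0

/-- A bounded connected open set with boundary of class `C²`: near each boundary point the set
is the sublevel set of a `C²` function with nonvanishing differential. -/
structure IsC2Domain {d : ℕ} (Ω : Set (Rd d)) : Prop where
  isOpen : IsOpen Ω
  bounded : Bornology.IsBounded Ω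
  connected : IsConnected Ω
  boundary : ∀ x ∈ frontier Ω, ∃ θ : Rd d → ℝ, ContDiffAt ℝ 2 θ x ∧ fderiv ℝ θ x ≠ 0 ∧
    ∀ᶠ y in 𝓝 x, (y ∈ Ω ↔ θ y < 0)

/-! ## Spaces of functions of time -/

/-- Lebesgue measure on the time interval `(0,T)`. -/
abbrev timeMeasure (T : ℝ) : Measure ℝ := volume.restrict (Ioc 0 T)

/-- `f ∈ L^q(0,T; L^s(Ω; F))`. -/
def InBochnerL {d : ℕ} {Ω : Set (Rd d)} {F : Type} [NormedAddCommGroup F] (T : ℝ)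
    (q s : ℝ≥0∞) [Fact (1 ≤ s)] (f : ℝ → L0 Ω F) : Prop :=
  ∃ g : ℝ → LL Ω F s, MemLp g q (timeMeasure T) ∧
    ∀ᵐ t ∂(timeMeasure T), (g t : L0 Ω F) = f t

/-- `f ∈ L^q(0,T; W^{1,s}(Ω; F))`. -/
def InBochnerW1 {d : ℕ} {Ω : Set (Rd d)} {F : Type} [NormedAddCommGroup F] [NormedSpace ℝ F]
    (T : ℝ) (q s : ℝ≥0∞) [Fact (1 ≤ s)] (f : ℝ → L0 Ω F) : Prop :=
  ∃ g : ℝ → W1 Ω F s, MemLp g q (timeMeasure T) ∧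
    ∀ᵐ t ∂(timeMeasure T), ((g t).fn : L0 Ω F) = f t

/-- `f ∈ L^q(0,T; H¹₀(Ω; F))`. -/
def InBochnerH10 {d : ℕ} {Ω : Set (Rd d)} {F : Type} [NormedAddCommGroup F] [NormedSpace ℝ F]
    (T : ℝ) (q : ℝ≥0∞) (f : ℝ → L0 Ω F) : Prop :=
  ∃ g : ℝ → W1 Ω F 2, MemLp g q (timeMeasure T) ∧
    ∀ᵐ t ∂(timeMeasure T), g t ∈ H10 Ω F ∧ ((g t).fn : L0 Ω F) = f t

/-- `f ∈ L^q(0,T; H²(Ω; F) ∩ H¹₀(Ω; F))`. -/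
def InBochnerH2 {d : ℕ} {Ω : Set (Rd d)} {F : Type} [NormedAddCommGroup F] [NormedSpace ℝ F]
    (T : ℝ) (q : ℝ≥0∞) (f : ℝ → L0 Ω F) : Prop :=
  ∃ g : ℝ → H2 Ω F, MemLp g q (timeMeasure T) ∧
    ∀ᵐ t ∂(timeMeasure T), (g t).1.1 ∈ H10 Ω F ∧ ((g t).1.1.fn : L0 Ω F) = f t

/-- `f` belongs to `W^{1,1}(0,T; X)` (absolutely continuous representative on `[0,T]`) and has
the time derivative `g`. -/
def HasTimeDeriv {X : Type} [NormedAddCommGroup X] [NormedSpace ℝ X] (T : ℝ) (f g : ℝ → X) :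
    Prop :=
  IntegrableOn g (Ioc 0 T) ∧ ∀ t ∈ Icc 0 T, f t = f 0 + ∫ s in (0 : ℝ)..t, g s

/-- Conjugate exponents `r, q` with `1 ≤ r < (d+2)/(d+1)`. -/
def AdmExp (d : ℕ) (r q : ℝ≥0∞) : Prop :=
  ENNReal.HolderConjugate r q ∧ r < ((d : ℝ≥0∞) + 2) / ((d : ℝ≥0∞) + 1)

/-- `φ ∈ C⁰([0,T]; W^{1,q}(Ω)) ∩ W^{1,q}(0,T; L^q(Ω))`, with time derivative `φt`. -/
structure IsTestCurve {d : ℕ} {Ω : Set (Rd d)} (T : ℝ) {q : ℝ≥0∞} [Fact (1 ≤ q)]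
    (φ : ℝ → W1 Ω ℝ q) (φt : ℝ → LL Ω ℝ q) : Prop where
  cont : ContinuousOn φ (Icc 0 T)
  memLp : MemLp φt q (timeMeasure T)
  deriv : HasTimeDeriv T (fun t => (φ t).fn) φt

/-! ## The system -/

/-- Constitutive functions and constants: heat capacity, heat conductivity, viscosity and
elasticity coefficients `a`, `b`, smooth part `gammaHat` of the potential, gradient energy
density `φ`, Lamé constants, viscosity matrix, thermal expansion coefficient, truncation. -/
structure Model (d : ℕ) where
  heat : ℝ → ℝ
  condu : ℝ → ℝ
  a : ℝ → ℝ
  b : ℝ → ℝ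
  gammaHat : ℝ → ℝ
  φ : Rd d → Rd d → ℝ
  lam1 : ℝ
  lam2 : ℝ
  visc : Matrix (Fin d) (Fin d) ℝ
  ρ : ℝ
  δ : ℝ

/-- Continuity of the heat capacity on `[0,∞)` and its growth conditions. -/
def HypHeat (d : ℕ) (heat : ℝ → ℝ) : Prop :=
  ContinuousOn heat (Ici 0) ∧
  ∃ σ1 σ c1 c0 : ℝ, 2 * (d : ℝ) / ((d : ℝ) + 2) < σ ∧ σ ≤ σ1 ∧ 0 < c0 ∧ c0 ≤ c1 ∧
    ∀ θ : ℝ, 0 ≤ θ → c0 * (1 + θ) ^ (σ - 1) ≤ heat θ ∧ heat θ ≤ c1 * (1 + θ) ^ (σ1 - 1)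

/-- Conditions on the gradient energy density: a nonnegative Carathéodory integrand, convex and
`C¹` in the second variable, vanishing at `0`, with `p`-coercivity and `p`-growth. -/
structure HypPhi {d : ℕ} (Ω : Set (Rd d)) (p : ℝ≥0∞) (φ : Rd d → Rd d → ℝ) : Prop where
  meas : ∀ z, AEStronglyMeasurable (fun x => φ x z) (volume.restrict Ω)
  nonneg : ∀ᵐ x ∂(volume.restrict Ω), ∀ z, 0 ≤ φ x z
  convex : ∀ᵐ x ∂(volume.restrict Ω), ConvexOn ℝ univ (φ x)
  zero : ∀ᵐ x ∂(volume.restrict Ω), φ x 0 = 0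
  smooth : ∀ᵐ x ∂(volume.restrict Ω), ContDiff ℝ 1 (φ x)
  coercive : ∃ c4 c5 : ℝ, 0 < c4 ∧ 0 < c5 ∧ ∀ᵐ x ∂(volume.restrict Ω), ∀ z : Rd d,
    c4 * ‖z‖ ^ p.toReal - c5 ≤ φ x z
  growth : ∃ c6 : ℝ, 0 < c6 ∧ ∀ᵐ x ∂(volume.restrict Ω), ∀ z : Rd d,
    ‖gradient (φ x) z‖ ≤ c6 * (1 + ‖z‖ ^ (p.toReal - 1))

/-- The standing hypotheses on the constitutive functions and constants. -/
structure Model.Standing {d : ℕ} (M : Model d) (Ω : Set (Rd d)) (p : ℝ≥0∞) : Prop where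
  heat : HypHeat d M.heat
  condu_cont : ContinuousOn M.condu (Ici 0)
  condu_pos : ∀ θ, 0 ≤ θ → 0 < M.condu θ
  a_smooth : ContDiff ℝ 1 M.a
  b_smooth : ContDiff ℝ 2 M.b
  ab_nonneg : ∀ x ∈ Icc (0 : ℝ) 1, 0 ≤ M.a x ∧ 0 ≤ M.b x
  gammaHat_smooth : ContDiff ℝ 2 M.gammaHat
  φ_hyp : HypPhi Ω p M.φ
  lame_pos : 0 < M.lam1 ∧ 0 < M.lam2
  δ_pos : 0 < M.δ

/-- The enthalpy `h(r) = ∫₀ʳ c(s) ds`. -/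
def Model.h {d : ℕ} (M : Model d) (r : ℝ) : ℝ := ∫ s in (0 : ℝ)..r, M.heat s

/-- The temperature as a function of the enthalpy. -/
def Model.Θ {d : ℕ} (M : Model d) (w : ℝ) : ℝ :=
  if 0 ≤ w then Function.invFunOn M.h (Ici 0) w else 0

def Model.K {d : ℕ} (M : Model d) (w : ℝ) : ℝ := M.condu (M.Θ w) / M.heat (M.Θ w)

/-- The field `d(x,ζ) = ∇_ζ φ(x,ζ)`. -/
def Model.flux {d : ℕ} (M : Model d) (x z : Rd d) : Rd d := gradient (M.φ x) z

/-- Entries of the symmetric part of a displacement gradient `A`, where `A i j = ∂ᵢ uⱼ`. -/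
def strain {d : ℕ} (A : Grad d (Rd d)) (i j : Fin d) : ℝ := (A i j + A j i) / 2

/-- The divergence read off from a displacement gradient. -/
def divg {d : ℕ} (A : Grad d (Rd d)) : ℝ := ∑ i, A i i

/-- `ε(u) R_e ε(v)`, from the displacement gradients of `u` and `v`. -/
def Model.elast {d : ℕ} (M : Model d) (A B : Grad d (Rd d)) : ℝ :=
  M.lam1 * divg A * divg B + 2 * M.lam2 * ∑ i, ∑ j, strain A i j * strain B i j

/-- `ε(u) R_v ε(v)`, from the displacement gradients of `u` and `v`. -/
def Model.viscous {d : ℕ} (M : Model d) (A B : Grad d (Rd d)) : ℝ :=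
  ∑ i, ∑ j, M.visc i j * strain A i j * strain B i j

/-- The elasticity form with weight `η`, as a function of the displacement gradients. -/
def Model.bilE {d : ℕ} (M : Model d) (Ω : Set (Rd d)) (η : Rd d → ℝ)
    (Du Dv : Rd d → Grad d (Rd d)) : ℝ := ∫ x in Ω, η x * M.elast (Du x) (Dv x)

/-- The viscosity form with weight `η`, as a function of the displacement gradients. -/
def Model.bilV {d : ℕ} (M : Model d) (Ω : Set (Rd d)) (η : Rd d → ℝ)
    (Du Dv : Rd d → Grad d (Rd d)) : ℝ := ∫ x in Ω, η x * M.viscous (Du x) (Dv x)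

open Classical in
/-- The convex indicator function of a set of reals. -/
def indic (C : Set ℝ) (x : ℝ) : ℝ≥0∞ := if x ∈ C then 0 else ⊤

/-- `z ∈ ∂I_C(x)`, for the convex subdifferential of the indicator function of `C`. -/
def SubdiffIndic (C : Set ℝ) (x z : ℝ) : Prop := x ∈ C ∧ ∀ y ∈ C, z * (y - x) ≤ 0

/-- `Φ(χ) = ∫_Ω φ(x, ∇χ) dx` if the weak gradient exists and the integral is finite, `+∞`
otherwise. (The infimum is over the weak gradients of `χ`: all are equal almost everywhere.) -/
def Model.Φ {d : ℕ} (M : Model d) (Ω : Set (Rd d)) (χ : LL Ω ℝ 2) : ℝ≥0∞ :=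
  ⨅ (G : Rd d → Grad d ℝ) (_ : HasWeakGrad Ω χ G), ∫⁻ x in Ω, ENNReal.ofReal (M.φ x (G x))

/-- `η ∈ ∂Φ(χ)`, for the subdifferential of the convex functional `Φ` on `L²(Ω)`. -/
def Model.SubdiffΦ {d : ℕ} (M : Model d) (Ω : Set (Rd d)) (χ η : LL Ω ℝ 2) : Prop :=
  M.Φ Ω χ ≠ ⊤ ∧ ∀ v : LL Ω ℝ 2,
    (M.Φ Ω χ : EReal) + ((inner ℝ η (v - χ) : ℝ) : EReal) ≤ (M.Φ Ω v : EReal)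

/-- `Φ(χ) + ∫_Ω W(χ)` with `W = I_{[0,∞)} + gammaHat`. -/
def Model.energy {d : ℕ} (M : Model d) (Ω : Set (Rd d)) (χ : LL Ω ℝ 2) : EReal :=
  (M.Φ Ω χ : EReal) + ((∫⁻ x in Ω, indic (Ici 0) (χ x) : ℝ≥0∞) : EReal)
    + ((∫ x in Ω, M.gammaHat (χ x) : ℝ) : EReal)

/-- Body force, heat source and initial data. -/
structure Data {d : ℕ} (Ω : Set (Rd d)) where
  f : ℝ → LL Ω (Rd d) 2
  g : ℝ → LL Ω ℝ 1
  w0 : LL Ω ℝ 1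
  u0 : LL Ω (Rd d) 2
  v0 : LL Ω (Rd d) 2
  chi0 : LL Ω ℝ 2

/-- `f ∈ L²(0,T; L²(Ω; ℝᵈ))` and `g ∈ L¹(0,T; L¹(Ω))`. -/
def Data.Admissible {d : ℕ} {Ω : Set (Rd d)} (D : Data Ω) (T : ℝ) : Prop :=
  MemLp D.f 2 (timeMeasure T) ∧ MemLp D.g 1 (timeMeasure T)

/-- A triple (enthalpy `w`, displacement `u`, phase or damage parameter `chi`), together with
the time derivatives `ut`, `utt`, `chit`. The enthalpy is a function for almost every time, and
`wDual t` is its value at every time `t`, a linear functional (`ψ ↦ ∫_Ω ψ w(t)(dx)`). -/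
structure Triple {d : ℕ} (Ω : Set (Rd d)) where
  w : ℝ → LL Ω ℝ 1
  wDual : ℝ → L0 Ω ℝ → ℝ
  u : ℝ → LL Ω (Rd d) 2
  ut : ℝ → LL Ω (Rd d) 2
  utt : ℝ → LL Ω (Rd d) 2
  chi : ℝ → LL Ω ℝ 2
  chit : ℝ → LL Ω ℝ 2

/-- `w ∈ L^r(0,T; W^{1,r}(Ω)) ∩ L^∞(0,T; L¹(Ω)) ∩ BV([0,T]; W^{1,r'}(Ω)^*)` for every
`1 ≤ r < (d+2)/(d+1)`. -/
structure Triple.RegW {d : ℕ} {Ω : Set (Rd d)} (S : Triple Ω) (T : ℝ) : Prop where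
  sobolev : ∀ (r q : ℝ≥0∞) [Fact (1 ≤ r)], AdmExp d r q →
    InBochnerW1 T r r (fun t => (S.w t : L0 Ω ℝ))
  bounded : MemLp S.w ⊤ (timeMeasure T)
  bv : ∀ (r q : ℝ≥0∞) [Fact (1 ≤ q)], AdmExp d r q →
    ∃ L : ℝ → StrongDual ℝ (W1 Ω ℝ q), BoundedVariationOn L (Icc 0 T) ∧
      (∀ t ∈ Icc 0 T, ∀ ψ : W1 Ω ℝ q, S.wDual t (ψ.fn : L0 Ω ℝ) = L t ψ) ∧
      ∀ᵐ t ∂(timeMeasure T), ∀ ψ : W1 Ω ℝ q, L t ψ = ∫ x in Ω, S.w t x * ψ.fn x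

/-- `u ∈ H¹(0,T; H² ∩ H¹₀) ∩ W^{1,∞}(0,T; H¹₀) ∩ H²(0,T; L²)`. -/
structure Triple.RegU {d : ℕ} {Ω : Set (Rd d)} (S : Triple Ω) (T : ℝ) : Prop where
  deriv : HasTimeDeriv T S.u S.ut
  deriv2 : HasTimeDeriv T S.ut S.utt
  utt_L2 : MemLp S.utt 2 (timeMeasure T)
  u_H2 : InBochnerH2 T 2 (fun t => (S.u t : L0 Ω (Rd d)))
  ut_H2 : InBochnerH2 T 2 (fun t => (S.ut t : L0 Ω (Rd d)))
  u_H1 : InBochnerH10 T ⊤ (fun t => (S.u t : L0 Ω (Rd d)))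
  ut_H1 : InBochnerH10 T ⊤ (fun t => (S.ut t : L0 Ω (Rd d)))

/-- `χ ∈ L^∞(0,T; W^{1,p}(Ω)) ∩ H¹(0,T; L²(Ω))`. -/
structure Triple.RegChi {d : ℕ} {Ω : Set (Rd d)} (S : Triple Ω) (T : ℝ) (p : ℝ≥0∞)
    [Fact (1 ≤ p)] : Prop where
  deriv : HasTimeDeriv T S.chi S.chit
  chit_L2 : MemLp S.chit 2 (timeMeasure T)
  sobolev : InBochnerW1 T ⊤ p (fun t => (S.chi t : L0 Ω ℝ))

/-- The regularity required of a triple. -/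
structure Triple.Regular {d : ℕ} {Ω : Set (Rd d)} (S : Triple Ω) (T : ℝ) (p : ℝ≥0∞)
    [Fact (1 ≤ p)] : Prop where
  regW : S.RegW T
  regU : S.RegU T
  regChi : S.RegChi T p

/-- `ε(u(t)) R_e ε(u(t)) / 2` at the point `x`. -/
def Triple.elastEnergy {d : ℕ} {Ω : Set (Rd d)} (S : Triple Ω) (M : Model d) (t : ℝ)
    (x : Rd d) : ℝ := M.elast (weakGrad Ω (S.u t) x) (weakGrad Ω (S.u t) x) / 2

/-- The initial conditions. -/
structure Triple.Initial {d : ℕ} {Ω : Set (Rd d)} (S : Triple Ω) (D : Data Ω) : Prop where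
  w : ∀ (r q : ℝ≥0∞) [Fact (1 ≤ q)], AdmExp d r q → ∀ ψ : W1 Ω ℝ q,
    S.wDual 0 (ψ.fn : L0 Ω ℝ) = ∫ x in Ω, D.w0 x * ψ.fn x
  u : S.u 0 = D.u0
  ut : S.ut 0 = D.v0
  chi : S.chi 0 = D.chi0

/-- `K(w) ∇w · ∇φ` at time `t` and at the point `x`. -/
def Triple.heatFlux {d : ℕ} {Ω : Set (Rd d)} (S : Triple Ω) (M : Model d) {q : ℝ≥0∞}
    [Fact (1 ≤ q)] (φ : ℝ → W1 Ω ℝ q) (t : ℝ) (x : Rd d) : ℝ :=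
  M.K (S.w t x) * inner ℝ (weakGrad Ω (S.w t) x) ((φ t).grad x)

/-- The weak enthalpy equation, including that the heat flux term is well defined. -/
def Triple.Enthalpy {d : ℕ} {Ω : Set (Rd d)} (S : Triple Ω) (M : Model d) (D : Data Ω)
    (T : ℝ) : Prop :=
  ∀ (r q : ℝ≥0∞) [Fact (1 ≤ q)], AdmExp d r q →
    ∀ (φ : ℝ → W1 Ω ℝ q) (φt : ℝ → LL Ω ℝ q), IsTestCurve T φ φt →
      (∀ᵐ s ∂(timeMeasure T), IntegrableOn (S.heatFlux M φ s) Ω) ∧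
      IntegrableOn (fun s => ∫ x in Ω, S.heatFlux M φ s x) (Ioc 0 T) ∧
      ∀ t ∈ Ioc 0 T,
        S.wDual t ((φ t).fn : L0 Ω ℝ)
          - (∫ s in (0 : ℝ)..t, ∫ x in Ω, S.w s x * φt s x)
          + (∫ s in (0 : ℝ)..t, ∫ x in Ω, S.chit s x * M.Θ (S.w s x) * (φ s).fn x)
          + M.ρ * (∫ s in (0 : ℝ)..t, ∫ x in Ω,
              divg (weakGrad Ω (S.ut s) x) * M.Θ (S.w s x) * (φ s).fn x)
          + (∫ s in (0 : ℝ)..t, ∫ x in Ω, S.heatFlux M φ s x)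
        = (∫ s in (0 : ℝ)..t, ∫ x in Ω, D.g s x * (φ s).fn x)
          + ∫ x in Ω, D.w0 x * (φ 0).fn x

/-- The momentum equation in `H^{-1}(Ω; ℝᵈ)`, almost everywhere in `(0,T)`. -/
def Triple.Momentum {d : ℕ} {Ω : Set (Rd d)} (S : Triple Ω) (M : Model d) (D : Data Ω)
    (T : ℝ) : Prop :=
  ∀ᵐ t ∂(timeMeasure T), ∀ v ∈ H10 Ω (Rd d),
    (∫ x in Ω, inner ℝ (S.utt t x) (v.fn x))
      + M.bilV Ω (fun x => M.a (S.chi t x) + M.δ) (weakGrad Ω (S.ut t)) v.grad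
      + M.bilE Ω (fun x => M.b (S.chi t x)) (weakGrad Ω (S.u t)) v.grad
      - M.ρ * (∫ x in Ω, M.Θ (S.w t x) * divg (v.grad x))
    = ∫ x in Ω, inner ℝ (D.f t x) (v.fn x)

/-- `χ_t ≤ 0` almost everywhere in `Ω × (0,T)`. -/
def Triple.Irreversible {d : ℕ} {Ω : Set (Rd d)} (S : Triple Ω) (T : ℝ) : Prop :=
  ∀ᵐ t ∂(timeMeasure T), ∀ᵐ x ∂(volume.restrict Ω), S.chit t x ≤ 0

/-- The one-sided variational inequality, for test functions `φ ∈ W^{1,p}(Ω)`, `φ ≤ 0`. -/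
def Triple.OneSidedVI {d : ℕ} {Ω : Set (Rd d)} (S : Triple Ω) (M : Model d) (T : ℝ)
    (p : ℝ≥0∞) [Fact (1 ≤ p)] (ξ : ℝ → L0 Ω ℝ) : Prop :=
  ∀ φ : W1 Ω ℝ p, (∀ᵐ x ∂(volume.restrict Ω), φ.fn x ≤ 0) → ∀ᵐ t ∂(timeMeasure T),
    0 ≤ ∫ x in Ω, (S.chit t x * φ.fn x
      + inner ℝ (M.flux x (weakGrad Ω (S.chi t) x)) (φ.grad x)
      + ξ t x * φ.fn x
      + deriv M.gammaHat (S.chi t x) * φ.fn x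
      + deriv M.b (S.chi t x) * S.elastEnergy M t x * φ.fn x
      - M.Θ (S.w t x) * φ.fn x)

/-- `ξ ∈ L¹(0,T; L¹(Ω))` with `⟨ξ(t), φ - χ(t)⟩ ≤ 0` for all `φ ∈ W^{1,p}(Ω)`, `φ ≥ 0`. -/
def Triple.WeakSelection {d : ℕ} {Ω : Set (Rd d)} (S : Triple Ω) (T : ℝ)
    (p : ℝ≥0∞) [Fact (1 ≤ p)] (ξ : ℝ → L0 Ω ℝ) : Prop :=
  InBochnerL T 1 1 ξ ∧
  ∀ φ : W1 Ω ℝ p, (∀ᵐ x ∂(volume.restrict Ω), 0 ≤ φ.fn x) → ∀ᵐ t ∂(timeMeasure T),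
    ∫ x in Ω, ξ t x * (φ.fn x - S.chi t x) ≤ 0

/-- The energy inequality for `χ` between the times `s` and `t`. -/
def Triple.EnergyIneqAt {d : ℕ} {Ω : Set (Rd d)} (S : Triple Ω) (M : Model d) (s t : ℝ) :
    Prop :=
  ((∫ r in s..t, ∫ x in Ω, S.chit r x ^ 2 : ℝ) : EReal) + M.energy Ω (S.chi t)
    ≤ M.energy Ω (S.chi s)
      + ((∫ r in s..t, ∫ x in Ω, S.chit r x *
          (-(deriv M.b (S.chi r x) * S.elastEnergy M r x) + M.Θ (S.w r x)) : ℝ) : EReal)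

/-- The property `P s t` holds for all `t ∈ (0,T]`, for `s = 0` and for almost all
`0 < s ≤ t`. -/
def ForTimes (T : ℝ) (P : ℝ → ℝ → Prop) : Prop :=
  ∀ t ∈ Ioc 0 T, P 0 t ∧ ∀ᵐ s ∂(volume.restrict (Ioc 0 t)), P s t

/-- Weak solutions of the irreversible system. -/
structure IsWeakSolution {d : ℕ} (Ω : Set (Rd d)) (T : ℝ) (p : ℝ≥0∞) [Fact (1 ≤ p)]
    (M : Model d) (D : Data Ω) (S : Triple Ω) : Prop where
  regular : S.Regular T p
  initial : S.Initial D
  enthalpy : S.Enthalpy M D T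
  momentum : S.Momentum M D T
  irreversible : S.Irreversible T
  variational : ∃ ξ : ℝ → L0 Ω ℝ, S.WeakSelection T p ξ ∧ S.OneSidedVI M T p ξ
  energy : ForTimes T (S.EnergyIneqAt M)

/-- The sum of the total energy at time `t` without the energy of `χ`: thermal, kinetic and
elastic energy. -/
def Triple.mechEnergy {d : ℕ} {Ω : Set (Rd d)} (S : Triple Ω) (M : Model d) (t : ℝ) : ℝ :=
  S.wDual t 1 + 1 / 2 * (∫ x in Ω, ‖S.ut t x‖ ^ 2)
    + 1 / 2 * M.bilE Ω (fun x => M.b (S.chi t x)) (weakGrad Ω (S.u t)) (weakGrad Ω (S.u t))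

/-- The total energy inequality between the times `s` and `t`. -/
def Triple.TotalEnergyIneqAt {d : ℕ} {Ω : Set (Rd d)} (S : Triple Ω) (M : Model d)
    (D : Data Ω) (s t : ℝ) : Prop :=
  ((S.mechEnergy M t + (∫ r in s..t, ∫ x in Ω, S.chit r x ^ 2)
      + (∫ r in s..t, M.bilV Ω (fun x => M.a (S.chi r x) + M.δ)
          (weakGrad Ω (S.ut r)) (weakGrad Ω (S.ut r))) : ℝ) : EReal)
      + M.energy Ω (S.chi t)
    ≤ ((S.mechEnergy M s + (∫ r in s..t, ∫ x in Ω, inner ℝ (D.f r x) (S.ut r x))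
      + (∫ r in s..t, ∫ x in Ω, D.g r x) : ℝ) : EReal)
      + M.energy Ω (S.chi s)

end DamagePDE

end

open MeasureTheory Set Filter Topology
open scoped ENNReal NNReal ContDiff

namespace DamagePDE

/-! ## Lebesgue spaces over a finite measure -/

section LpTools

variable {X : Type*} [MeasurableSpace X] {μ : Measure X}

/-! Part (a) is a sum of three balances. Testing the enthalpy equation with the constant `1` removes
the heat flux and leaves the exchange terms `∫∫ χ_t Θ(w)` and `ρ ∫∫ div(u_t) Θ(w)`. Testing the
momentum equation with `u_t` produces the kinetic energy, the viscous dissipation, the same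
divergence term with opposite sign, and `∫ e(b(χ); u, u_t)`. The energy inequality for `χ` contains
`χ_t Θ(w)` and `-b'(χ) χ_t ε(u)R_eε(u)/2`. The temperature terms cancel, and the two elastic terms
together are the time derivative of `e(b(χ); u, u)/2`. The first two balances form an identity
(`IsWeakSolution.mech_balance`), so the only inequality in the result is the one assumed for `χ`.

Part (b) defines `ζ` as minus the sum of `χ_t`, the subgradient `η = B(χ)`, `ξ` and the lower order
terms, so that the equation holds by construction and only `ζ ∈ ∂I_{(-∞,0]}(χ_t)` has to be shown.
The one-sided variational inequality gives `ζ ≥ 0`, because a subgradient of `Φ` paired with a test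
function is at most the corresponding flux integral. Conversely, the energy inequality together with
the chain inequality `∫⟨η + ξ, χ_t⟩ ≤ Φ(χ(t)) - Φ(χ(s))` gives `∫∫ ζ χ_t ≥ 0`. Since `ζ ≥ 0 ≥ χ_t`,
the product vanishes almost everywhere, and this complementarity is the inclusion.

The analysis makes these pairings legitimate. The displacement is absolutely continuous into `H²`,
hence its gradient into `L⁴` (here `d ≤ 3` enters) and the elastic density into `L²`. The phase
parameter is bounded because `p > d`, so `b(χ)` is absolutely continuous into `L²`; its derivative
is computed in `L¹`, where superposition operators are differentiable on `L²`. The temperature lies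
in `L²(0,T; L²)` by interpolating `L^∞(0,T; L¹)` with `L^r(0,T; W^{1,r})`, using `σ > 2d/(d+2)`.

The Sobolev and Morrey bounds rest on the interior cone condition: mollifying along the cone and
differentiating in the scale bounds `|u|` by the `L¹` norm plus a Riesz potential of the gradient
(`IsC2Domain.exists_riesz_bound`). Young's and Hölder's inequalities then finish. The chain
inequality for `Φ` uses no differentiability of `Φ ∘ χ`: the subgradient inequality between the
times `r` and `r + h` is integrated in `r`, divided by `h`, and passed to the limit at Lebesgue
points. -/

/-- The inclusion `L^q ⊆ L^p` for `p ≤ q` over a finite measure space. -/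
noncomputable def LpIncl (F : Type*) [NormedAddCommGroup F] [NormedSpace ℝ F] (μ : Measure X)
    [IsFiniteMeasure μ] {p q : ℝ≥0∞} [Fact (1 ≤ p)] [Fact (1 ≤ q)] (hpq : p ≤ q) :
    Lp F q μ →L[ℝ] Lp F p μ :=
  LinearMap.mkContinuous
    { toFun := fun f => ((Lp.memLp f).mono_exponent hpq).toLp f
      map_add' := fun f g => by
        ext1
        filter_upwards [MemLp.coeFn_toLp ((Lp.memLp (f + g)).mono_exponent hpq),
          MemLp.coeFn_toLp ((Lp.memLp f).mono_exponent hpq),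
          MemLp.coeFn_toLp ((Lp.memLp g).mono_exponent hpq), Lp.coeFn_add f g,
          Lp.coeFn_add (((Lp.memLp f).mono_exponent hpq).toLp f)
            (((Lp.memLp g).mono_exponent hpq).toLp g)] with x h1 h2 h3 h4 h5
        rw [h1, h5, h4, Pi.add_apply, Pi.add_apply, h2, h3]
      map_smul' := fun c f => by
        ext1
        filter_upwards [MemLp.coeFn_toLp ((Lp.memLp (c • f)).mono_exponent hpq),
          MemLp.coeFn_toLp ((Lp.memLp f).mono_exponent hpq), Lp.coeFn_smul c f,
          Lp.coeFn_smul c (((Lp.memLp f).mono_exponent hpq).toLp f)] with x h1 h2 h4 h5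
        rw [h1, RingHom.id_apply, h5, h4, Pi.smul_apply, Pi.smul_apply, h2] }
    (μ univ ^ (1 / p.toReal - 1 / q.toReal)).toReal
    (fun f => by
      have hexp : 0 ≤ 1 / p.toReal - 1 / q.toReal := by
        have hp1 : (1 : ℝ≥0∞) ≤ p := Fact.out
        -- For `q = ⊤` the convention `1 / 0 = 0` gives the correct Hölder exponent `1 / p`.
        by_cases hq : q = ⊤
        · simp [hq]
        · have hp : p ≠ ⊤ := ne_top_of_le_ne_top hq hpq
          have h1 : 0 < p.toReal := ENNReal.toReal_pos (by positivity) hp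
          have := one_div_le_one_div_of_le h1 (ENNReal.toReal_mono hq hpq)
          linarith
      have hne : μ univ ^ (1 / p.toReal - 1 / q.toReal) ≠ ⊤ :=
        ENNReal.rpow_ne_top_of_nonneg hexp (measure_ne_top _ _)
      simp only [LinearMap.coe_mk, AddHom.coe_mk, Lp.norm_def]
      rw [← ENNReal.toReal_mul]
      refine ENNReal.toReal_mono (ENNReal.mul_ne_top hne (Lp.eLpNorm_ne_top _)) ?_
      rw [eLpNorm_congr_ae (MemLp.coeFn_toLp _), mul_comm]
      exact eLpNorm_le_eLpNorm_mul_rpow_measure_univ hpq (Lp.aestronglyMeasurable f))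

variable {F : Type*} [NormedAddCommGroup F] [NormedSpace ℝ F] [IsFiniteMeasure μ]
  {p q : ℝ≥0∞} [Fact (1 ≤ p)] [Fact (1 ≤ q)]

theorem coeFn_LpIncl (hpq : p ≤ q) (f : Lp F q μ) : LpIncl F μ hpq f =ᵐ[μ] f :=
  MemLp.coeFn_toLp ((Lp.memLp f).mono_exponent hpq)

theorem LpIncl_injective (hpq : p ≤ q) : Function.Injective (LpIncl F μ hpq) := by
  intro f g hfg
  ext1
  filter_upwards [coeFn_LpIncl hpq f, coeFn_LpIncl hpq g] with x h1 h2
  rw [← h1, ← h2, hfg]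

theorem LpIncl_eq (hpq : p ≤ q) {f : Lp F q μ} {g : Lp F p μ} (h : f =ᵐ[μ] g) :
    LpIncl F μ hpq f = g := by
  ext1
  exact (coeFn_LpIncl hpq f).trans h

/-- By the Lusin–Souslin theorem a continuous injection of a Polish space is a measurable embedding,
so measurability in a coarser topology can be pulled back. -/
theorem aestronglyMeasurable_of_comp_injective {α Y Z : Type*} [MeasurableSpace α]
    {ν : Measure α} [TopologicalSpace Y] [PolishSpace Y] [TopologicalSpace Z]
    [TopologicalSpace.PseudoMetrizableSpace Z] [T2Space Z] {j : Y → Z} (hj : Continuous j)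
    (hinj : Function.Injective j) {f : α → Y} (h : AEStronglyMeasurable (j ∘ f) ν) :
    AEStronglyMeasurable f ν := by
  borelize Y
  borelize Z
  have he : MeasurableEmbedding j := hj.measurableEmbedding hinj
  exact ((he.aemeasurable_comp_iff).1 h.aemeasurable).aestronglyMeasurable

/-- A strongly measurable curve in `L¹` with values in `L^q` is strongly measurable in `L^q`. -/
theorem exists_Lp_lift {α : Type*} [MeasurableSpace α] {ν : Measure α}
    [MeasurableSpace.CountablyGenerated X] [TopologicalSpace.SeparableSpace F] [CompleteSpace F]
    (hq : q ≠ ⊤) {f : α → Lp F 1 μ} (hf : AEStronglyMeasurable f ν)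
    (h : ∀ᵐ t ∂ν, MemLp (f t) q μ) :
    ∃ g : α → Lp F q μ, AEStronglyMeasurable g ν ∧ ∀ᵐ t ∂ν, g t =ᵐ[μ] f t := by
  classical
  -- Finiteness of `q` makes `L^q` separable, hence Polish, as the lifting argument requires.
  have : Fact (q ≠ ⊤) := ⟨hq⟩
  have hq1 : (1 : ℝ≥0∞) ≤ q := Fact.out
  let g : α → Lp F q μ := fun t => if h : MemLp (f t) q μ then h.toLp (f t) else 0
  have hg : ∀ᵐ t ∂ν, g t =ᵐ[μ] f t := by
    filter_upwards [h] with t ht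
    simp only [g, ht, dite_true]
    exact MemLp.coeFn_toLp ht
  refine ⟨g, ?_, hg⟩
  refine aestronglyMeasurable_of_comp_injective (LpIncl F μ hq1).continuous
    (LpIncl_injective hq1) (hf.congr ?_)
  filter_upwards [hg] with t ht
  exact (LpIncl_eq hq1 ht).symm

theorem lipschitzWith_sub_const {Y E : Type*} [PseudoEMetricSpace Y] [SeminormedAddCommGroup E]
    {K : ℝ≥0} {b : Y → E} (hb : LipschitzWith K b) (c : E) :
    LipschitzWith K (fun x => b x - c) := fun x y => by
  simpa using hb x y

/-- Composition with a Lipschitz function on `L^p`. -/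
noncomputable def nemytskii (μ : Measure X) [IsFiniteMeasure μ] (p : ℝ≥0∞) {K : ℝ≥0} {b : ℝ → ℝ}
    (hb : LipschitzWith K b) (f : Lp ℝ p μ) : Lp ℝ p μ :=
  -- Composition on `L^p` is defined for functions vanishing at `0`; the constant `b 0` is split off
  -- and restored, which is possible over a finite measure.
  LipschitzWith.compLp (g := fun x => b x - b 0) (c := K)
    (lipschitzWith_sub_const hb _) (by simp) f
    + Lp.const p μ (b 0)

theorem coeFn_nemytskii {s : ℝ≥0∞} {K : ℝ≥0} {b : ℝ → ℝ} (hb : LipschitzWith K b)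
    (f : Lp ℝ s μ) : nemytskii μ s hb f =ᵐ[μ] fun x => b (f x) := by
  unfold nemytskii
  filter_upwards [Lp.coeFn_add (LipschitzWith.compLp (g := fun x => b x - b 0) (c := K)
    (lipschitzWith_sub_const hb _) (by simp) f) (Lp.const s μ (b 0)),
    LipschitzWith.coeFn_compLp (g := fun x => b x - b 0) (c := K)
    (lipschitzWith_sub_const hb _) (by simp) f,
    Lp.coeFn_const (p := s) (μ := μ) (b 0)] with x h1 h2 h3
  rw [h1, Pi.add_apply, h2, h3]
  simp

theorem lipschitzWith_nemytskii {K : ℝ≥0} {b : ℝ → ℝ} (hb : LipschitzWith K b) :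
    LipschitzWith K (nemytskii μ p hb) := by
  unfold nemytskii
  have h := LipschitzWith.lipschitzWith_compLp (p := p) (μ := μ) (lipschitzWith_sub_const hb (b 0))
    (by simp)
  intro f g
  simpa using h f g

end LpTools


/-! ## Absolutely continuous curves -/

section TimeDeriv

variable {X Y Z : Type} [NormedAddCommGroup X] [NormedSpace ℝ X] [NormedAddCommGroup Y]
  [NormedSpace ℝ Y] [NormedAddCommGroup Z] [NormedSpace ℝ Z] {T : ℝ}

theorem intervalIntegrable_of_integrableOn_Ioc {E : Type*} [NormedAddCommGroup E] {g : ℝ → E}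
    (hg : IntegrableOn g (Ioc 0 T)) {s t : ℝ} (hs : s ∈ Icc 0 T) (ht : t ∈ Icc 0 T) :
    IntervalIntegrable g volume s t := by
  rw [intervalIntegrable_iff]
  refine hg.mono_set ?_
  intro x hx
  rw [uIoc, mem_Ioc] at hx
  exact ⟨(le_min hs.1 ht.1).trans_lt hx.1, hx.2.trans (max_le hs.2 ht.2)⟩

theorem HasTimeDeriv.sub_eq {f g : ℝ → X} (h : HasTimeDeriv T f g) {s t : ℝ} (hs : s ∈ Icc 0 T)
    (ht : t ∈ Icc 0 T) : f t - f s = ∫ r in s..t, g r := by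
  have h0 : (0 : ℝ) ∈ Icc 0 T := ⟨le_rfl, hs.1.trans hs.2⟩
  rw [h.2 t ht, h.2 s hs, add_sub_add_left_eq_sub]
  exact intervalIntegral.integral_interval_sub_left
    (intervalIntegrable_of_integrableOn_Ioc h.1 h0 ht)
    (intervalIntegrable_of_integrableOn_Ioc h.1 h0 hs)

theorem HasTimeDeriv.norm_sub_le {f g : ℝ → X} (h : HasTimeDeriv T f g) {s t : ℝ} (hs : 0 ≤ s)
    (hst : s ≤ t) (ht : t ≤ T) : ‖f t - f s‖ ≤ ∫ r in s..t, ‖g r‖ := by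
  rw [h.sub_eq ⟨hs, hst.trans ht⟩ ⟨hs.trans hst, ht⟩]
  exact intervalIntegral.norm_integral_le_integral_norm hst

theorem HasTimeDeriv.ae_hasDerivAt [CompleteSpace X] {f g : ℝ → X} (h : HasTimeDeriv T f g) :
    ∀ᵐ t ∂(timeMeasure T), HasDerivAt f (g t) t := by
  rcases le_or_gt T 0 with hT | hT
  · simp [timeMeasure, Ioc_eq_empty_of_le hT]
  have h0 : (0 : ℝ) ∈ Icc 0 T := ⟨le_rfl, hT.le⟩
  have hi := intervalIntegrable_of_integrableOn_Ioc h.1 h0 ⟨hT.le, le_rfl⟩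
  -- Outside `[0,T]` the curve is arbitrary, so a two-sided derivative makes sense only at interior
  -- times.
  have hne : ∀ᵐ t : ℝ, t ≠ T := by simp [ae_iff, measure_singleton]
  rw [timeMeasure, ae_restrict_iff' measurableSet_Ioc]
  filter_upwards [hi.ae_hasDerivAt_integral, hne] with t ht htT hmem
  have h1 := (ht (by rw [uIcc_of_le hT.le]; exact ⟨hmem.1.le, hmem.2⟩) 0
    (by rw [uIcc_of_le hT.le]; exact h0)).const_add (f 0)
  refine h1.congr_of_eventuallyEq ?_
  filter_upwards [Ioo_mem_nhds hmem.1 (lt_of_le_of_ne hmem.2 htT)] with r hr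
  exact h.2 r ⟨hr.1.le, hr.2.le⟩

/-- A curve whose increments are controlled by the integral of an integrable function and that
is differentiable almost everywhere is the integral of its derivative. -/
theorem hasTimeDeriv_of_ae_hasDerivAt [CompleteSpace X] {f g : ℝ → X} {m : ℝ → ℝ}
    (hm : IntegrableOn m (Ioc 0 T))
    (hle : ∀ s t, 0 ≤ s → s ≤ t → t ≤ T → ‖f t - f s‖ ≤ ∫ r in s..t, m r)
    (hg : IntegrableOn g (Ioc 0 T)) (hd : ∀ᵐ t ∂(timeMeasure T), HasDerivAt f (g t) t) :
    HasTimeDeriv T f g := by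
  refine ⟨hg, ?_⟩
  rcases lt_or_ge T 0 with hT | hT
  · intro t ht
    exact absurd (ht.1.trans ht.2) hT.not_ge
  have h0 : (0 : ℝ) ∈ Icc 0 T := ⟨le_rfl, hT⟩
  have hTm : T ∈ Icc 0 T := ⟨hT, le_rfl⟩
  -- The difference `D = f - I` has increments dominated by those of the primitive `H` of `m + ‖g‖`.
  -- Hence `D` is absolutely continuous with derivative zero almost everywhere, and so constant. As
  -- the derivative is supplied, `X` needs no Radon–Nikodym property.
  let I : ℝ → X := fun t => ∫ s in (0 : ℝ)..t, g s
  let n : ℝ → ℝ := fun r => m r + ‖g r‖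
  have hn : IntegrableOn n (Ioc 0 T) := hm.add hg.norm
  let H : ℝ → ℝ := fun t => ∫ s in (0 : ℝ)..t, n s
  have hH : AbsolutelyContinuousOnInterval H 0 T :=
    (intervalIntegrable_of_integrableOn_Ioc hn h0 hTm).absolutelyContinuousOnInterval_intervalIntegral
      left_mem_uIcc
  have hII : HasTimeDeriv T I g := ⟨hg, fun t _ => by simp [I]⟩
  let D : ℝ → X := fun t => f t - I t
  have hDle : ∀ s t, 0 ≤ s → s ≤ t → t ≤ T → dist (D s) (D t) ≤ dist (H s) (H t) := by
    intro s t hs hst ht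
    have e1 : H t - H s = ∫ r in s..t, n r := intervalIntegral.integral_interval_sub_left
      (intervalIntegrable_of_integrableOn_Ioc hn h0 ⟨hs.trans hst, ht⟩)
      (intervalIntegrable_of_integrableOn_Ioc hn h0 ⟨hs, hst.trans ht⟩)
    have e2 : ∫ r in s..t, n r = (∫ r in s..t, m r) + ∫ r in s..t, ‖g r‖ :=
      intervalIntegral.integral_add
        (intervalIntegrable_of_integrableOn_Ioc hm ⟨hs, hst.trans ht⟩ ⟨hs.trans hst, ht⟩)
        (intervalIntegrable_of_integrableOn_Ioc hg.norm ⟨hs, hst.trans ht⟩ ⟨hs.trans hst, ht⟩)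
    rw [dist_comm, dist_comm (H s), dist_eq_norm, dist_eq_norm]
    calc ‖D t - D s‖ = ‖(f t - f s) - (I t - I s)‖ := by simp only [D]; congr 1; abel
      _ ≤ ‖f t - f s‖ + ‖I t - I s‖ := norm_sub_le _ _
      _ ≤ (∫ r in s..t, m r) + ∫ r in s..t, ‖g r‖ :=
        add_le_add (hle s t hs hst ht) (hII.norm_sub_le hs hst ht)
      _ = H t - H s := by rw [e1, e2]
      _ ≤ ‖H t - H s‖ := le_abs_self _
  have hDle' : ∀ s ∈ Icc 0 T, ∀ t ∈ Icc 0 T, dist (D s) (D t) ≤ dist (H s) (H t) := by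
    intro s hs t ht
    rcases le_total s t with h | h
    · exact hDle s t hs.1 h ht.2
    · rw [dist_comm, dist_comm (H s)]
      exact hDle t s ht.1 h hs.2
  have hD : AbsolutelyContinuousOnInterval D 0 T := by
    unfold AbsolutelyContinuousOnInterval at hH ⊢
    refine squeeze_zero' (Eventually.of_forall fun _ => Finset.sum_nonneg fun i hi => dist_nonneg)
      ?_ hH
    rw [eventually_inf_principal]
    refine Eventually.of_forall fun E hE => Finset.sum_le_sum fun i hi => ?_
    have := hE.1 i hi
    rw [uIcc_of_le hT] at this
    exact hDle' _ this.1 _ this.2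
  have hD0 : ∀ᵐ x, x ∈ uIcc 0 T → HasDerivAt D 0 x := by
    have h1 := hII.ae_hasDerivAt
    rw [timeMeasure, ae_restrict_iff' measurableSet_Ioc] at h1 hd
    have hne : ∀ᵐ t : ℝ, t ≠ 0 := by simp [ae_iff, measure_singleton]
    filter_upwards [h1, hd, hne] with t h1 h2 h3 h4
    rw [uIcc_of_le hT] at h4
    have hmem : t ∈ Ioc 0 T := ⟨lt_of_le_of_ne h4.1 h3.symm, h4.2⟩
    have h5 := (h2 hmem).sub (h1 hmem)
    rw [sub_self] at h5
    exact h5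
  obtain ⟨c, hc⟩ := hD.const_of_ae_hasDerivAt_zero hD0
  rw [uIcc_of_le hT] at hc
  intro t ht
  have h1 := hc t ht
  rw [← hc 0 h0] at h1
  simp only [D, I, intervalIntegral.integral_same, sub_zero] at h1
  rw [← h1]
  abel

theorem HasTimeDeriv.continuousOn {f g : ℝ → X} (h : HasTimeDeriv T f g) :
    ContinuousOn f (Icc 0 T) := by
  rcases lt_or_ge T 0 with hT | hT
  · simp [Icc_eq_empty_of_lt hT]
  have h1 : ContinuousOn (fun t => f 0 + ∫ s in (0 : ℝ)..t, g s) (Icc 0 T) := by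
    refine continuousOn_const.add ?_
    have := intervalIntegral.continuousOn_primitive_interval (μ := volume) (f := g) (a := 0)
      (b := T) (by rw [uIcc_of_le hT, integrableOn_Icc_iff_integrableOn_Ioc]; exact h.1)
    rwa [uIcc_of_le hT] at this
  exact h1.congr h.2

theorem HasTimeDeriv.aestronglyMeasurable {f g : ℝ → X} (h : HasTimeDeriv T f g) :
    AEStronglyMeasurable f (timeMeasure T) :=
  (h.continuousOn.aestronglyMeasurable_of_isCompact isCompact_Icc measurableSet_Icc).mono_measure
    (Measure.restrict_mono Ioc_subset_Icc_self le_rfl)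

theorem HasTimeDeriv.exists_bound {f g : ℝ → X} (h : HasTimeDeriv T f g) :
    ∃ C, 0 ≤ C ∧ ∀ t ∈ Icc 0 T, ‖f t‖ ≤ C := by
  obtain ⟨C, hC⟩ := isCompact_Icc.exists_bound_of_continuousOn h.continuousOn
  exact ⟨max C 0, le_max_right _ _, fun t ht => (hC t ht).trans (le_max_left _ _)⟩

theorem HasTimeDeriv.congr_deriv {f g g' : ℝ → X} (h : HasTimeDeriv T f g)
    (hg : ∀ᵐ t ∂(timeMeasure T), g t = g' t) : HasTimeDeriv T f g' := by
  refine ⟨h.1.congr hg, fun t ht => ?_⟩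
  rw [h.2 t ht]
  congr 1
  refine intervalIntegral.integral_congr_ae ?_
  rw [timeMeasure, ae_restrict_iff' measurableSet_Ioc] at hg
  filter_upwards [hg] with r hr hmem
  rw [uIoc_of_le ht.1] at hmem
  exact hr ⟨hmem.1, hmem.2.trans ht.2⟩

theorem HasTimeDeriv.clm_comp [CompleteSpace X] [CompleteSpace Y] {f g : ℝ → X}
    (h : HasTimeDeriv T f g) (L : X →L[ℝ] Y) :
    HasTimeDeriv T (fun t => L (f t)) (fun t => L (g t)) := by
  refine ⟨L.integrable_comp h.1, fun t ht => ?_⟩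
  beta_reduce
  rw [h.2 t ht, map_add, L.intervalIntegral_comp_comm]
  exact intervalIntegrable_of_integrableOn_Ioc h.1 ⟨le_rfl, ht.1.trans ht.2⟩ ht

/-- The product rule for a bounded bilinear map and two absolutely continuous curves. -/
theorem HasTimeDeriv.bilin [CompleteSpace X] [CompleteSpace Y] [CompleteSpace Z]
    {f f' : ℝ → X} {g g' : ℝ → Y} (hf : HasTimeDeriv T f f') (hg : HasTimeDeriv T g g')
    (B : X →L[ℝ] Y →L[ℝ] Z) :
    HasTimeDeriv T (fun t => B (f t) (g t)) (fun t => B (f' t) (g t) + B (f t) (g' t)) := by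
  obtain ⟨C, hC0, hC⟩ := hf.exists_bound
  obtain ⟨D, hD0, hD⟩ := hg.exists_bound
  have hm1 : Integrable (fun r => ‖B‖ * D * ‖f' r‖) (timeMeasure T) := hf.1.norm.const_mul _
  have hm2 : Integrable (fun r => ‖B‖ * C * ‖g' r‖) (timeMeasure T) := hg.1.norm.const_mul _
  refine hasTimeDeriv_of_ae_hasDerivAt (m := fun r => ‖B‖ * D * ‖f' r‖ + ‖B‖ * C * ‖g' r‖)
    (hm1.add hm2) ?_ ?_ ?_
  · intro s t hs hst ht
    have hsm : s ∈ Icc 0 T := ⟨hs, hst.trans ht⟩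
    have htm : t ∈ Icc 0 T := ⟨hs.trans hst, ht⟩
    rw [intervalIntegral.integral_add (intervalIntegrable_of_integrableOn_Ioc hm1 hsm htm)
      (intervalIntegrable_of_integrableOn_Ioc hm2 hsm htm), intervalIntegral.integral_const_mul,
      intervalIntegral.integral_const_mul]
    have e : B (f t) (g t) - B (f s) (g s) = B (f t - f s) (g t) + B (f s) (g t - g s) := by
      simp
    rw [e]
    refine (norm_add_le _ _).trans (add_le_add ?_ ?_)
    · refine (B.le_opNorm₂ _ _).trans ?_
      have h1 := hf.norm_sub_le hs hst ht
      have h2 := hD t htm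
      have h3 := norm_nonneg B
      have h4 := norm_nonneg (f t - f s)
      have h5 := norm_nonneg (g t)
      calc ‖B‖ * ‖f t - f s‖ * ‖g t‖ ≤ ‖B‖ * (∫ r in s..t, ‖f' r‖) * D := by
            gcongr
            exact mul_nonneg h3 (h4.trans h1)
        _ = _ := by ring
    · refine (B.le_opNorm₂ _ _).trans ?_
      have h1 := hg.norm_sub_le hs hst ht
      have h2 := hC s hsm
      gcongr
  · have hfb : ∀ᵐ t ∂(timeMeasure T), ‖f t‖ ≤ C := by
      filter_upwards [ae_restrict_mem measurableSet_Ioc] with t ht using hC t ⟨ht.1.le, ht.2⟩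
    have hgb : ∀ᵐ t ∂(timeMeasure T), ‖g t‖ ≤ D := by
      filter_upwards [ae_restrict_mem measurableSet_Ioc] with t ht using hD t ⟨ht.1.le, ht.2⟩
    exact (B.integrable_of_bilin_of_bdd_right D hf.1 hg.aestronglyMeasurable hgb).add
      (B.integrable_of_bilin_of_bdd_left C hf.aestronglyMeasurable hfb hg.1)
  · filter_upwards [hf.ae_hasDerivAt, hg.ae_hasDerivAt] with t h1 h2
    have := B.hasFDerivAt_of_bilinear h1.hasFDerivAt h2.hasFDerivAt
    have h3 := this.hasDerivAt
    rw [add_comm]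
    simpa using h3

end TimeDeriv


/-! ### Superposition operators on `L²` and their chain rule in time. -/

section ChainRule

/-- Mean value inequality for `z ↦ b z - b' x * z` on the segment, whose derivative is at most `L *
|y - x|` there; the sharp constant `L / 2` is not needed. -/
theorem abs_sub_sub_deriv_le {b b' : ℝ → ℝ} (hb : ∀ x, HasDerivAt b (b' x) x) {L : ℝ≥0}
    (hL : LipschitzWith L b') (x y : ℝ) : |b y - b x - b' x * (y - x)| ≤ L * (y - x) ^ 2 := by
  have h1 : ∀ z ∈ uIcc x y, HasDerivWithinAt (fun z => b z - b' x * z) (b' z - b' x) (uIcc x y) z :=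
    fun z _ => by
      have h := ((hb z).sub ((hasDerivAt_id z).const_mul (b' x))).hasDerivWithinAt (s := uIcc x y)
      rw [mul_one] at h
      exact h
  have h2 : ∀ z ∈ uIcc x y, ‖b' z - b' x‖ ≤ L * |y - x| := fun z hz => by
    refine (by simpa [Real.dist_eq] using hL.dist_le_mul z x : ‖b' z - b' x‖ ≤ L * |z - x|).trans ?_
    gcongr ?_ * ?_
    exact abs_sub_left_of_mem_uIcc hz
  have h3 := Convex.norm_image_sub_le_of_norm_hasDerivWithin_le h1 h2 (convex_uIcc x y)
    left_mem_uIcc right_mem_uIcc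
  rw [Real.norm_eq_abs, Real.norm_eq_abs] at h3
  calc _ = |b y - b' x * y - (b x - b' x * x)| := by congr 1; ring
    _ ≤ _ := h3
    _ = L * (y - x) ^ 2 := by rw [mul_assoc, ← sq, sq_abs]

theorem lipschitzWith_of_abs_deriv_le {b b' : ℝ → ℝ} (hb : ∀ x, HasDerivAt b (b' x) x) {K : ℝ≥0}
    (hK : ∀ x, |b' x| ≤ K) : LipschitzWith K b :=
  lipschitzWith_of_nnnorm_deriv_le (fun x => (hb x).differentiableAt) fun x => by
    rw [(hb x).deriv, ← NNReal.coe_le_coe]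
    exact hK x

variable {X : Type} [MeasurableSpace X] {μ : Measure X}

/-- Multiplication of two functions in `L²`, as a bounded bilinear map into `L¹`. -/
noncomputable def mulL2 (μ : Measure X) : Lp ℝ 2 μ →L[ℝ] Lp ℝ 2 μ →L[ℝ] Lp ℝ 1 μ :=
  (ContinuousLinearMap.mul ℝ ℝ).holderL μ 2 2 1

theorem coeFn_mulL2 (f g : Lp ℝ 2 μ) : mulL2 μ f g =ᵐ[μ] fun x => f x * g x :=
  (ContinuousLinearMap.mul ℝ ℝ).coeFn_holder (r := 1) f g

variable [IsFiniteMeasure μ]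

/-- The pointwise Taylor remainder is quadratic, and the square of an `L²` function is controlled
only in `L¹`. This is why differentiability is stated from `L²` to `L¹`. -/
theorem norm_nemytskii_sub_sub_le {b b' : ℝ → ℝ} (hb : ∀ x, HasDerivAt b (b' x) x) {K L : ℝ≥0}
    (hK : LipschitzWith K b) (hL : LipschitzWith L b') (u v : Lp ℝ 2 μ) :
    ‖LpIncl ℝ μ (p := 1) (q := 2) one_le_two (nemytskii μ 2 hK v)
      - LpIncl ℝ μ one_le_two (nemytskii μ 2 hK u)
      - mulL2 μ (nemytskii μ 2 hL u) (v - u)‖ ≤ L * ‖mulL2 μ‖ * ‖v - u‖ ^ 2 := by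
  have h : ‖LpIncl ℝ μ (p := 1) (q := 2) one_le_two (nemytskii μ 2 hK v)
      - LpIncl ℝ μ one_le_two (nemytskii μ 2 hK u)
      - mulL2 μ (nemytskii μ 2 hL u) (v - u)‖ ≤ L * ‖mulL2 μ (v - u) (v - u)‖ := by
    apply Lp.norm_le_mul_norm_of_ae_le_mul
    filter_upwards [coeFn_LpIncl (p := 1) (q := 2) one_le_two (nemytskii μ 2 hK v),
      coeFn_LpIncl (p := 1) (q := 2) one_le_two (nemytskii μ 2 hK u), coeFn_nemytskii hK v,
      coeFn_nemytskii hK u, coeFn_mulL2 (nemytskii μ 2 hL u) (v - u), coeFn_mulL2 (v - u) (v - u),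
      coeFn_nemytskii hL u, Lp.coeFn_sub v u,
      Lp.coeFn_sub (LpIncl ℝ μ (p := 1) (q := 2) one_le_two (nemytskii μ 2 hK v)
        - LpIncl ℝ μ one_le_two (nemytskii μ 2 hK u)) (mulL2 μ (nemytskii μ 2 hL u) (v - u)),
      Lp.coeFn_sub (LpIncl ℝ μ (p := 1) (q := 2) one_le_two (nemytskii μ 2 hK v))
        (LpIncl ℝ μ one_le_two (nemytskii μ 2 hK u))]
      with x h1 h2 h3 h4 h5 h6 h7 h8 h9 h10
    rw [h9, Pi.sub_apply, h10, Pi.sub_apply, h1, h2, h3, h4, h5, h6, h7, h8, Pi.sub_apply,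
      Real.norm_eq_abs, Real.norm_eq_abs, ← sq, abs_of_nonneg (sq_nonneg (v x - u x))]
    exact abs_sub_sub_deriv_le hb hL _ _
  refine h.trans ?_
  rw [mul_assoc]
  gcongr
  rw [sq, ← mul_assoc]
  exact (mulL2 μ).le_opNorm₂ _ _

/-- The Nemytskii operator of a function with Lipschitz derivative is differentiable from `L²`
to `L¹`. -/
theorem hasFDerivAt_nemytskii {b b' : ℝ → ℝ} (hb : ∀ x, HasDerivAt b (b' x) x) {K L : ℝ≥0}
    (hK : LipschitzWith K b) (hL : LipschitzWith L b') (u : Lp ℝ 2 μ) :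
    HasFDerivAt (fun v => LpIncl ℝ μ (p := 1) (q := 2) one_le_two (nemytskii μ 2 hK v))
      (mulL2 μ (nemytskii μ 2 hL u)) u := by
  rw [hasFDerivAt_iff_isLittleO]
  refine Asymptotics.IsBigO.trans_isLittleO (g := fun v => ‖v - u‖ ^ 2) ?_ ?_
  · refine Asymptotics.IsBigO.of_bound (L * ‖mulL2 μ‖) (Eventually.of_forall fun v => ?_)
    rw [Real.norm_eq_abs, abs_of_nonneg (by positivity)]
    exact norm_nemytskii_sub_sub_le hb hK hL u v
  · have := Asymptotics.isLittleO_norm_pow_id (E' := Lp ℝ 2 μ) one_lt_two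
    exact (this.comp_tendsto (k := fun v => v - u) (l' := 𝓝 u)
      (tendsto_sub_nhds_zero_iff.2 tendsto_id))

variable [MeasurableSpace.CountablyGenerated X] {T : ℝ}

/-- Products `β(f) f'` with bounded Lipschitz `β`. -/
theorem exists_bounded_mul {f g : ℝ → Lp ℝ 2 μ} {ν : Measure ℝ} (hf : AEStronglyMeasurable f ν)
    (hg : AEStronglyMeasurable g ν) {c : ℝ → ℝ} {K L : ℝ≥0} (hK : ∀ x, |c x| ≤ K)
    (hL : LipschitzWith L c) :
    ∃ β : ℝ → Lp ℝ 2 μ, AEStronglyMeasurable β ν ∧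
      (∀ᵐ t ∂ν, β t =ᵐ[μ] fun x => c (f t x) * g t x) ∧ ∀ᵐ t ∂ν, ‖β t‖ ≤ K * ‖g t‖ := by
  -- The product map is continuous into `L¹` only, so measurability is obtained there. Boundedness
  -- of `c` keeps the values in `L²`, and the curve is then lifted.
  have hm : AEStronglyMeasurable (fun t => mulL2 μ (nemytskii μ 2 hL (f t)) (g t)) ν :=
    (mulL2 μ).aestronglyMeasurable_comp₂
      ((lipschitzWith_nemytskii hL).continuous.comp_aestronglyMeasurable hf) hg
  have hae : ∀ t, mulL2 μ (nemytskii μ 2 hL (f t)) (g t) =ᵐ[μ] fun x => c (f t x) * g t x := by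
    intro t
    filter_upwards [coeFn_mulL2 (nemytskii μ 2 hL (f t)) (g t), coeFn_nemytskii hL (f t)]
      with x h1 h2
    rw [h1, h2]
  have hbd : ∀ t, ∀ᵐ x ∂μ, ‖c (f t x) * g t x‖ ≤ K * ‖g t x‖ := fun t =>
    Eventually.of_forall fun x => by
      rw [norm_mul]
      gcongr
      exact hK _
  obtain ⟨β, hβ, hβe⟩ := exists_Lp_lift (q := 2) (by simp) hm (Eventually.of_forall fun t => by
    refine MemLp.of_le_mul (c := K) (Lp.memLp (g t)) (Lp.aestronglyMeasurable _) ?_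
    filter_upwards [hae t, hbd t] with x h1 h2
    rwa [h1])
  have hβe' : ∀ᵐ t ∂ν, β t =ᵐ[μ] fun x => c (f t x) * g t x := by
    filter_upwards [hβe] with t ht using ht.trans (hae t)
  refine ⟨β, hβ, hβe', ?_⟩
  filter_upwards [hβe'] with t ht
  apply Lp.norm_le_mul_norm_of_ae_le_mul
  filter_upwards [ht, hbd t] with x h1 h2
  rwa [h1]

/-- The chain rule for the composition of an absolutely continuous `L²`-valued curve with a
function having bounded and Lipschitz derivative. -/
theorem HasTimeDeriv.nemytskii_comp {f f' : ℝ → Lp ℝ 2 μ} (h : HasTimeDeriv T f f')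
    {b b' : ℝ → ℝ} (hb : ∀ x, HasDerivAt b (b' x) x) {K L : ℝ≥0} (hK : ∀ x, |b' x| ≤ K)
    (hL : LipschitzWith L b') :
    ∃ β : ℝ → Lp ℝ 2 μ, (∀ᵐ t ∂(timeMeasure T), β t =ᵐ[μ] fun x => b' (f t x) * f' t x) ∧
      (∀ᵐ t ∂(timeMeasure T), ‖β t‖ ≤ K * ‖f' t‖) ∧
      HasTimeDeriv T (fun t => nemytskii μ 2 (lipschitzWith_of_abs_deriv_le hb hK) (f t)) β := by
  have hbK := lipschitzWith_of_abs_deriv_le hb hK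
  obtain ⟨β, hβm, hβ, hβn⟩ := exists_bounded_mul h.aestronglyMeasurable h.1.aestronglyMeasurable
    hK hL
  refine ⟨β, hβ, hβn, ?_⟩
  have hβi : IntegrableOn β (Ioc 0 T) :=
    Integrable.mono' (h.1.norm.const_mul (K : ℝ)) hβm hβn
  let J := LpIncl ℝ μ (p := 1) (q := 2) one_le_two
  -- The identity is proved after embedding into `L¹`, where the superposition operator is
  -- differentiable. Since `β` is already integrable in `L²`, injectivity of `J` brings the identity
  -- back.
  have key : HasTimeDeriv T (fun t => J (nemytskii μ 2 hbK (f t))) (fun t => J (β t)) := by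
    refine hasTimeDeriv_of_ae_hasDerivAt (m := fun r => ‖J‖ * K * ‖f' r‖)
      (h.1.norm.const_mul _) ?_ (J.integrable_comp hβi) ?_
    · intro s t hs hst ht
      rw [intervalIntegral.integral_const_mul, ← map_sub, mul_assoc]
      refine (J.le_opNorm _).trans ?_
      gcongr
      refine ((lipschitzWith_nemytskii hbK).norm_sub_le _ _).trans ?_
      gcongr
      exact h.norm_sub_le hs hst ht
    · filter_upwards [h.ae_hasDerivAt, hβ] with t h1 h2
      have h3 := (hasFDerivAt_nemytskii hb hbK hL (f t)).comp_hasDerivAt t h1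
      have h4 : mulL2 μ (nemytskii μ 2 hL (f t)) (f' t) = J (β t) := by
        ext1
        filter_upwards [coeFn_mulL2 (nemytskii μ 2 hL (f t)) (f' t), coeFn_nemytskii hL (f t),
          coeFn_LpIncl (p := 1) (q := 2) one_le_two (β t), h2] with x e1 e2 e3 e4
        rw [e1, e2, e3, e4]
      rw [h4] at h3
      exact h3
  refine ⟨hβi, fun t ht => LpIncl_injective (p := 1) (q := 2) one_le_two ?_⟩
  have h1 := key.2 t ht
  have h2 := J.intervalIntegral_comp_comm
    (intervalIntegrable_of_integrableOn_Ioc hβi ⟨le_rfl, ht.1.trans ht.2⟩ ht)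
  change J _ = J _
  rw [map_add, ← h2]
  exact h1

end ChainRule


/-! ### Chain inequality for convex functionals along absolutely continuous curves. -/

section ConvexChain

variable {H : Type} [NormedAddCommGroup H] [InnerProductSpace ℝ H]

/-- Averaged form of continuity of translations: for `A, B ∈ L²(ℝ; H)` of bounded support, the
function `h ↦ ∫ ⟨A(r), ∫_r^{r+h} B⟩ dr` has at `h = 0` the right derivative `∫ ⟨A, B⟩`. -/
theorem tendsto_integral_inner_average [CompleteSpace H] {A B : ℝ → H} (hA : MemLp A 2 volume)
    (hB : MemLp B 2 volume) (hA1 : Integrable A) (hB1 : Integrable B) :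
    Tendsto (fun h : ℝ => h⁻¹ * ∫ r, inner ℝ (A r) (∫ y in r..(r + h), B y)) (𝓝[>] 0)
      (𝓝 (∫ r, inner ℝ (A r) (B r))) := by
  let a : Lp H 2 (volume : Measure ℝ) := hA.toLp A
  let b : Lp H 2 (volume : Measure ℝ) := hB.toLp B
  have hAa : a =ᵐ[volume] A := hA.coeFn_toLp
  have hBb : b =ᵐ[volume] B := hB.coeFn_toLp
  -- The correlation `c τ = ∫ ⟨A(r), B(r + τ)⟩ dr` is continuous since translations act continuously
  -- on `L²`. By Fubini the integral in question is `∫₀ʰ c`, so its right derivative at `0` is `c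
  -- 0`.
  let c : ℝ → ℝ := fun τ => inner ℝ a (DomAddAct.mk τ +ᵥ b)
  have : Fact ((2 : ℝ≥0∞) ≠ ⊤) := ⟨by simp⟩
  have hc : Continuous c := by
    refine Continuous.inner continuous_const ?_
    exact (DomAddAct.continuous_mk.comp continuous_id).vadd continuous_const
  have hcτ : ∀ τ, c τ = ∫ r, inner ℝ (A r) (B (r + τ)) := by
    intro τ
    simp only [c]
    rw [L2.inner_def]
    refine integral_congr_ae ?_
    have h1 := DomAddAct.vadd_Lp_ae_eq (DomAddAct.mk τ) b
    have h2 := (quasiMeasurePreserving_add_right (volume : Measure ℝ) τ).ae hBb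
    filter_upwards [hAa, h1, h2] with r e1 e2 e3
    rw [e1, e2]
    simp only [DomAddAct.mk, vadd_eq_add] at *
    rw [← e3, add_comm r τ]
    rfl
  have hprod : Integrable (fun z : ℝ × ℝ => inner ℝ (A z.1) (B (z.1 + z.2)))
      (volume.prod volume) := by
    have h1 : Integrable (fun z : ℝ × ℝ => inner ℝ (A z.1) (B z.2)) (volume.prod volume) := by
      refine (hA1.norm.mul_prod hB1.norm).mono ?_ ?_
      · exact hA1.aestronglyMeasurable.comp_fst.inner hB1.aestronglyMeasurable.comp_snd
      · refine Eventually.of_forall fun z => ?_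
        rw [norm_mul, norm_norm, norm_norm]
        exact norm_inner_le_norm _ _
    exact ((measurePreserving_prod_add (volume : Measure ℝ) (volume : Measure ℝ)).integrable_comp
      h1.aestronglyMeasurable).2 h1
  have hswap : ∀ h : ℝ, 0 < h →
      ∫ r, inner ℝ (A r) (∫ y in r..(r + h), B y) = ∫ τ in (0 : ℝ)..h, c τ := by
    intro h hh
    have e1 : ∀ r, inner ℝ (A r) (∫ y in r..(r + h), B y)
        = ∫ τ in Ioc 0 h, inner ℝ (A r) (B (r + τ)) := by
      intro r
      have e2 : ∫ y in r..(r + h), B y = ∫ τ in Ioc 0 h, B (r + τ) := by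
        rw [← intervalIntegral.integral_of_le hh.le, intervalIntegral.integral_comp_add_left]
        simp
      rw [e2]
      exact ((innerSL ℝ (A r)).integral_comp_comm (hB1.comp_add_left r).integrableOn).symm
    simp_rw [e1]
    rw [integral_integral_swap, intervalIntegral.integral_of_le hh.le]
    · simp_rw [hcτ]
    · have : (volume : Measure ℝ).prod (volume.restrict (Ioc 0 h))
          = (volume.prod volume).restrict (univ ×ˢ Ioc 0 h) := by
        rw [← Measure.prod_restrict, Measure.restrict_univ]
      rw [this]
      exact hprod.integrableOn
  have hd : HasDerivAt (fun h => ∫ τ in (0 : ℝ)..h, c τ) (c 0) 0 :=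
    intervalIntegral.integral_hasDerivAt_right (hc.intervalIntegrable _ _)
      (hc.stronglyMeasurableAtFilter _ _) hc.continuousAt
  have h3 := hd.tendsto_slope_zero_right
  have h0 : c 0 = ∫ r, inner ℝ (A r) (B r) := by simp [hcτ]
  rw [h0] at h3
  refine h3.congr' ?_
  filter_upwards [self_mem_nhdsWithin] with h hh
  simp [hswap h hh]

/-- A function that is recovered from its affine minorants along an absolutely continuous curve is
measurable. -/
theorem aemeasurable_of_subgradient [SecondCountableTopology H] {T : ℝ} {f η : ℝ → H}
    (hf : ContinuousOn f (Icc 0 T)) {ψ : ℝ → ℝ} {G : Set ℝ}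
    (hG : ∀ᵐ t ∂(timeMeasure T), t ∈ G)
    (hle : ∀ s ∈ G, ∀ t ∈ G, inner ℝ (η s) (f t - f s) ≤ ψ t - ψ s) :
    AEMeasurable ψ (timeMeasure T) := by
  let e : G → H × H := fun t => (η t, f t)
  -- `ψ` is the supremum of its affine minorants over countably many base points. These are dense in
  -- the set of pairs `(η, f)`, not in time: the minorant based at `z` misses `ψ t` by at most `⟨η t
  -- - η z, f t - f z⟩`, which is small once both components are close. No semicontinuity of `ψ` is
  -- assumed.
  obtain ⟨D, hDc, hDd⟩ := TopologicalSpace.exists_countable_dense (range e)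
  choose sel hsel using fun x : range e => x.2
  have key : ∀ t ∈ G, ((ψ t : ℝ) : EReal)
      = ⨆ x ∈ D, ((ψ (sel x) + inner ℝ (η (sel x)) (f t - f (sel x)) : ℝ) : EReal) := by
    intro t ht
    apply le_antisymm
    · by_contra hlt
      rw [not_le] at hlt
      obtain ⟨c, hc1, hc2⟩ := EReal.lt_iff_exists_real_btwn.1 hlt
      have hc2' : c < ψ t := EReal.coe_lt_coe_iff.1 hc2
      have hcont : Continuous fun z : range e => (inner ℝ (η t - z.1.1) (f t - z.1.2) : ℝ) := by
        fun_prop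
      have hopen : IsOpen {z : range e | (inner ℝ (η t - z.1.1) (f t - z.1.2) : ℝ) < ψ t - c} :=
        isOpen_lt hcont continuous_const
      obtain ⟨z, hzD, hz⟩ := hDd.exists_mem_open hopen
        ⟨⟨e ⟨t, ht⟩, mem_range_self _⟩, by simp [e, hc2']⟩
      have hz1 : inner ℝ (η t - η (sel z)) (f t - f (sel z)) < ψ t - c := by
        have := hsel z
        simp only [e] at this
        rw [mem_ofPred_eq, ← this] at hz
        exact hz
      have h1 := hle t ht (sel z) (sel z).2
      rw [inner_sub_left] at hz1
      rw [← neg_sub (f t) (f _), inner_neg_right] at h1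
      have h2 : c < ψ (sel z) + inner ℝ (η (sel z)) (f t - f (sel z)) := by linarith
      refine absurd hc1 (not_lt.2 ?_)
      exact (EReal.coe_le_coe_iff.2 h2.le).trans
        (le_iSup₂ (f := fun x (_ : x ∈ D) =>
          ((ψ (sel x) + inner ℝ (η (sel x)) (f t - f (sel x)) : ℝ) : EReal)) z hzD)
    · refine iSup₂_le fun x hx => ?_
      rw [EReal.coe_le_coe_iff]
      linarith [hle (sel x) (sel x).2 t ht]
  have hfm : AEStronglyMeasurable f (timeMeasure T) :=
    (hf.aestronglyMeasurable_of_isCompact isCompact_Icc measurableSet_Icc).mono_measure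
      (Measure.restrict_mono Ioc_subset_Icc_self le_rfl)
  have hm : AEMeasurable (fun t => ⨆ x ∈ D,
      ((ψ (sel x) + inner ℝ (η (sel x)) (f t - f (sel x)) : ℝ) : EReal)) (timeMeasure T) := by
    refine AEMeasurable.biSup D hDc fun x _ => ?_
    refine measurable_coe_real_ereal.comp_aemeasurable ?_
    exact aemeasurable_const.add
      (aestronglyMeasurable_const.inner (hfm.sub aestronglyMeasurable_const)).aemeasurable
  refine hm.ereal_toReal.congr ?_
  filter_upwards [hG] with t ht
  rw [← key t ht, EReal.toReal_coe]

/-- Chain inequality for a convex functional along an absolutely continuous curve. -/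
theorem exists_integral_inner_le_sub [CompleteSpace H] [SecondCountableTopology H] {T : ℝ}
    {f f' η : ℝ → H} (hf : HasTimeDeriv T f f') (hf' : MemLp f' 2 (timeMeasure T))
    (hη : MemLp η 2 (timeMeasure T)) {ψ : ℝ → ℝ} {C : ℝ} {G : Set ℝ}
    (hG : ∀ᵐ t ∂(timeMeasure T), t ∈ G) (hb : ∀ t ∈ G, |ψ t| ≤ C)
    (hle : ∀ s ∈ G, ∀ t ∈ G, inner ℝ (η s) (f t - f s) ≤ ψ t - ψ s) :
    ∃ N : Set ℝ, (∀ᵐ t ∂(timeMeasure T), t ∈ N) ∧ ∀ s ∈ N, ∀ t ∈ N, s ≤ t →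
      ∫ r in s..t, inner ℝ (η r) (f' r) ≤ ψ t - ψ s := by
  have hψm : AEMeasurable ψ (timeMeasure T) :=
    aemeasurable_of_subgradient hf.continuousOn hG hle
  have hψi : IntegrableOn ψ (Ioc 0 T) := by
    refine Integrable.mono' (integrable_const C) hψm.aestronglyMeasurable ?_
    filter_upwards [hG] with t ht using hb t ht
  let P : ℝ → ℝ := fun x => ∫ r in (0 : ℝ)..x, ψ r
  have hPd : HasTimeDeriv T P ψ := ⟨hψi, fun t _ => by simp [P]⟩
  -- The good times are interior times at which the primitive `P` of `ψ` has derivative `ψ t`.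
  refine ⟨{t | t ∈ Ioo 0 T ∧ HasDerivAt P (ψ t) t}, ?_, ?_⟩
  · have hne : ∀ᵐ t ∂(timeMeasure T), t ≠ T :=
      ae_restrict_of_ae (by simp [ae_iff, measure_singleton])
    filter_upwards [hPd.ae_hasDerivAt, hne, ae_restrict_mem measurableSet_Ioc] with t h1 h2 h3
      using ⟨⟨h3.1, lt_of_le_of_ne h3.2 h2⟩, h1⟩
  rintro s ⟨hs, hsd⟩ t ⟨ht, htd⟩ hst
  let A : ℝ → H := (Ioc s t).indicator η
  let B : ℝ → H := (Ioc 0 T).indicator f'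
  have hsub : Ioc s t ⊆ Ioc 0 T := Ioc_subset_Ioc hs.1.le ht.2.le
  have hA : MemLp A 2 volume :=
    (memLp_indicator_iff_restrict measurableSet_Ioc).2
      (hη.mono_measure (Measure.restrict_mono hsub le_rfl))
  have hB : MemLp B 2 volume := (memLp_indicator_iff_restrict measurableSet_Ioc).2 hf'
  have hA1 : Integrable A := (integrable_indicator_iff measurableSet_Ioc).2
    ((hη.integrable one_le_two).mono_measure (Measure.restrict_mono hsub le_rfl))
  have hB1 : Integrable B := (integrable_indicator_iff measurableSet_Ioc).2
    (hf'.integrable one_le_two)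
  have hlim := tendsto_integral_inner_average hA hB hA1 hB1
  have e0 : ∫ r, inner ℝ (A r) (B r) = ∫ r in s..t, inner ℝ (η r) (f' r) := by
    rw [intervalIntegral.integral_of_le hst, ← integral_indicator measurableSet_Ioc]
    refine integral_congr_ae (Eventually.of_forall fun r => ?_)
    by_cases hr : r ∈ Ioc s t
    · simp [A, B, hr, indicator_of_mem (hsub hr)]
    · simp [A, hr]
  rw [e0] at hlim
  have hlim2 := htd.tendsto_slope_zero_right.sub hsd.tendsto_slope_zero_right
  -- Both limits are of quotients with step `h`: the integral over `(s,t)` of `⟨η(r), f(r+h) -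
  -- f(r)⟩` is compared with that of `ψ(r+h) - ψ(r)`. The latter telescopes to increments of `P` at
  -- `t` and `s`, with limit `ψ t - ψ s`.
  refine le_of_tendsto_of_tendsto hlim hlim2 ?_
  filter_upwards [Ioo_mem_nhdsGT (show (0 : ℝ) < T - t by linarith [ht.2])] with h hh
  rw [← smul_sub, smul_eq_mul]
  refine mul_le_mul_of_nonneg_left ?_ (inv_nonneg.2 hh.1.le)
  have hm : ∀ x ∈ Icc 0 T, ∀ y ∈ Icc 0 T, IntervalIntegrable ψ volume x y := fun x hx y hy =>
    intervalIntegrable_of_integrableOn_Ioc hψi hx hy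
  have ms : s ∈ Icc 0 T := ⟨hs.1.le, hs.2.le⟩
  have mt : t ∈ Icc 0 T := ⟨ht.1.le, ht.2.le⟩
  have msh : s + h ∈ Icc 0 T := ⟨by linarith [hs.1, hh.1], by linarith [hh.2]⟩
  have mth : t + h ∈ Icc 0 T := ⟨by linarith [ht.1, hh.1], by linarith [hh.2]⟩
  have e1 : P (t + h) - P t - (P (s + h) - P s) = ∫ r in s..t, (ψ (r + h) - ψ r) := by
    have h1 : IntervalIntegrable (fun r => ψ (r + h)) volume s t := by
      simpa using (hm _ msh _ mth).comp_add_right h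
    rw [intervalIntegral.integral_sub h1 (hm _ ms _ mt), intervalIntegral.integral_comp_add_right]
    have h2 := hPd.sub_eq msh mth
    have h3 := hPd.sub_eq ms mt
    rw [← h2, ← h3]
    ring
  have e2 : ∫ r, inner ℝ (A r) (∫ y in r..(r + h), B y)
      = ∫ r in s..t, inner ℝ (η r) (f (r + h) - f r) := by
    rw [intervalIntegral.integral_of_le hst, ← integral_indicator measurableSet_Ioc]
    refine integral_congr_ae (Eventually.of_forall fun r => ?_)
    by_cases hr : r ∈ Ioc s t
    · have mr : r ∈ Icc 0 T := ⟨by linarith [hs.1, hr.1], by linarith [ht.2, hr.2]⟩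
      have mrh : r + h ∈ Icc 0 T := ⟨by linarith [mr.1, hh.1], by linarith [hh.2, hr.2]⟩
      have h1 : ∫ y in r..(r + h), B y = f (r + h) - f r := by
        rw [hf.sub_eq mr mrh]
        refine intervalIntegral.integral_congr_ae (Eventually.of_forall fun y hy => ?_)
        rw [uIoc_of_le (by linarith [hh.1])] at hy
        have hyT : y ∈ Ioc 0 T := ⟨by linarith [mr.1, hy.1], hy.2.trans mrh.2⟩
        exact indicator_of_mem hyT _
      simp [A, hr, h1]
    · simp [A, hr]
  rw [e1, e2, intervalIntegral.integral_of_le hst, intervalIntegral.integral_of_le hst]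
  have hGr : ∀ᵐ r ∂(volume.restrict (Ioc s t)), r ∈ G ∧ r + h ∈ G := by
    have hG' := hG
    rw [timeMeasure, ae_restrict_iff' measurableSet_Ioc] at hG'
    have h2 := (quasiMeasurePreserving_add_right (volume : Measure ℝ) h).ae hG'
    rw [ae_restrict_iff' measurableSet_Ioc]
    filter_upwards [hG', h2] with r h3 h4 hr
    exact ⟨h3 (hsub hr), h4 ⟨by linarith [hr.1, hs.1, hh.1], by linarith [hr.2, hh.2]⟩⟩
  refine integral_mono_ae ?_ ?_ ?_
  · have hshift : ContinuousOn (fun r => f (r + h) - f r) (Icc s t) := by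
      refine ContinuousOn.sub ?_ (hf.continuousOn.mono (Icc_subset_Icc ms.1 mt.2))
      exact hf.continuousOn.comp (by fun_prop) fun r hr =>
        ⟨by linarith [ms.1, hr.1, hh.1], by linarith [hr.2, hh.2]⟩
    obtain ⟨C', hC'⟩ := isCompact_Icc.exists_bound_of_continuousOn hshift
    refine (innerSL ℝ).integrable_of_bilin_of_bdd_right C'
      ((hη.integrable one_le_two).mono_measure (Measure.restrict_mono hsub le_rfl))
      ((hshift.aestronglyMeasurable_of_isCompact isCompact_Icc measurableSet_Icc).mono_measure
      (Measure.restrict_mono Ioc_subset_Icc_self le_rfl)) ?_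
    filter_upwards [ae_restrict_mem measurableSet_Ioc] with r hr
      using hC' r (Ioc_subset_Icc_self hr)
  · have h1 : IntervalIntegrable (fun r => ψ (r + h)) volume s t := by
      simpa using (hm _ msh _ mth).comp_add_right h
    exact ((h1.sub (hm _ ms _ mt)).1)
  · filter_upwards [hGr] with r hr using hle r hr.1 (r + h) hr.2

end ConvexChain


/-! ## Sobolev inequalities on domains with the cone property -/

section Cone

variable {d : ℕ} {Ω : Set (Rd d)}

/-- Near each point of the closure, a `C²` domain satisfies the interior cone condition. -/
theorem IsC2Domain.exists_cone (hΩ : IsC2Domain Ω) {x₀ : Rd d} (hx₀ : x₀ ∈ closure Ω) :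
    ∃ (e : Rd d) (ε h₀ : ℝ), 0 < ε ∧ 0 < h₀ ∧ ∀ᶠ x in 𝓝 x₀, x ∈ Ω →
      ∀ y ∈ Metric.closedBall e ε, ∀ s ∈ Ioc 0 h₀, x + s • y ∈ Ω := by
  have hsmall : ∀ (e : Rd d) (U : Set (Rd d)), U ∈ 𝓝 x₀ → ∃ h₀ : ℝ, 0 < h₀ ∧ ∀ᶠ x in 𝓝 x₀,
      ∀ y ∈ Metric.closedBall e 1, ∀ s ∈ Ioc 0 h₀, x + s • y ∈ U := by
    intro e U hU
    obtain ⟨r, hr, hrU⟩ := Metric.mem_nhds_iff.1 hU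
    have he : 0 < ‖e‖ + 1 := by positivity
    refine ⟨r / 2 / (‖e‖ + 1), by positivity, ?_⟩
    filter_upwards [Metric.ball_mem_nhds x₀ (half_pos hr)] with x hx y hy s hs
    apply hrU
    rw [Metric.mem_ball, dist_eq_norm] at hx ⊢
    have hy' : ‖y‖ ≤ ‖e‖ + 1 := by
      rw [Metric.mem_closedBall, dist_eq_norm] at hy
      linarith [norm_le_norm_add_norm_sub e y, norm_sub_rev e y]
    have h1 : ‖s • y‖ ≤ r / 2 := by
      rw [norm_smul, Real.norm_of_nonneg hs.1.le]
      calc s * ‖y‖ ≤ r / 2 / (‖e‖ + 1) * (‖e‖ + 1) := by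
            gcongr
            exact hs.2
        _ = r / 2 := by field_simp
    calc ‖x + s • y - x₀‖ = ‖(x - x₀) + s • y‖ := by congr 1; abel
      _ ≤ ‖x - x₀‖ + ‖s • y‖ := norm_add_le _ _
      _ < r := by linarith
  by_cases hin : x₀ ∈ Ω
  · obtain ⟨h₀, hh₀, h⟩ := hsmall 0 Ω (hΩ.isOpen.mem_nhds hin)
    exact ⟨0, 1, h₀, one_pos, hh₀, h.mono fun x hx _ => hx⟩
  have hfr : x₀ ∈ frontier Ω := by
    rw [hΩ.isOpen.frontier_eq]
    exact ⟨hx₀, hin⟩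
  obtain ⟨θ, hθ, hθ', hnear⟩ := hΩ.boundary x₀ hfr
  obtain ⟨v, hv⟩ : ∃ v, fderiv ℝ θ x₀ v ≠ 0 := by
    by_contra! h
    exact hθ' (by ext v; simp [h v])
  set L := fderiv ℝ θ x₀ with hL
  -- Along `e` the linear part of `θ` decreases at unit rate; `ε` is so small that every direction
  -- in the ball around `e` keeps at least half of this rate.
  let e : Rd d := (-(L v)⁻¹) • v
  have hLe : L e = -1 := by simp [e, hv]
  let ε : ℝ := min 1 (1 / (2 * (‖L‖ + 1)))
  have hε : 0 < ε := lt_min one_pos (by positivity)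
  have hLy : ∀ y ∈ Metric.closedBall e ε, L y ≤ -(1 / 2) := by
    intro y hy
    rw [Metric.mem_closedBall, dist_eq_norm] at hy
    have h1 : L y = -1 + L (y - e) := by rw [map_sub, hLe]; ring
    have h2 : L (y - e) ≤ ‖L‖ * ε := (le_abs_self _).trans
      ((L.le_opNorm _).trans (by gcongr))
    have h3 : ‖L‖ * ε ≤ 1 / 2 := by
      calc ‖L‖ * ε ≤ (‖L‖ + 1) * (1 / (2 * (‖L‖ + 1))) := by
            gcongr
            · linarith
            · exact min_le_right _ _
        _ = 1 / 2 := by field_simp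
    linarith
  have hstrict : HasStrictFDerivAt θ L x₀ := hθ.hasStrictFDerivAt (by simp)
  -- With this tolerance the linearisation error at distance `s` is at most `s / 4`, less than the
  -- linear decrease `s / 2`. Strict differentiability makes the estimate uniform in the base point
  -- `x` near `x₀`.
  let c : ℝ := 1 / (4 * (‖e‖ + 1))
  have hc : 0 < c := by positivity
  have hlo := hstrict.isLittleO.def hc
  rw [nhds_prod_eq] at hlo
  obtain ⟨U, hU, V, hV, hUV⟩ := mem_prod_iff.1 hlo
  obtain ⟨h₀, hh₀, h⟩ := hsmall e (U ∩ {y | y ∈ Ω ↔ θ y < 0}) (inter_mem hU hnear)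
  refine ⟨e, ε, h₀, hε, hh₀, ?_⟩
  filter_upwards [h, hV, hnear] with x hx hxV hxn hxΩ y hy s hs
  have hy1 : y ∈ Metric.closedBall e 1 :=
    Metric.closedBall_subset_closedBall (min_le_left _ _) hy
  obtain ⟨hxU, hxs⟩ := hx y hy1 s hs
  have hxs' : x + s • y ∈ Ω ↔ θ (x + s • y) < 0 := hxs
  rw [hxs']
  have h1 : ‖θ (x + s • y) - θ x - L (x + s • y - x)‖ ≤ c * ‖x + s • y - x‖ :=
    hUV (mk_mem_prod hxU hxV)
  rw [add_sub_cancel_left, map_smul, norm_smul, Real.norm_of_nonneg hs.1.le, smul_eq_mul] at h1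
  have h2 := (abs_le.1 h1).2
  have hy' : ‖y‖ ≤ ‖e‖ + 1 := by
    rw [Metric.mem_closedBall, dist_eq_norm] at hy1
    linarith [norm_le_norm_add_norm_sub e y, norm_sub_rev e y]
  have h3 : c * (s * ‖y‖) ≤ s * (1 / 4) := by
    calc c * (s * ‖y‖) ≤ c * (s * (‖e‖ + 1)) := by
          have := hs.1.le
          gcongr
      _ = s * (1 / 4) := by simp only [c]; field_simp
  have h4 : s * L y ≤ s * (-(1 / 2)) := mul_le_mul_of_nonneg_left (hLy y hy) hs.1.le
  have h5 := hxn.1 hxΩ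
  have h6 := hs.1
  linarith

end Cone


/-! ### Off-centred mollification and its derivative in the scale. -/

section Representation

variable {d : ℕ} {Ω : Set (Rd d)}

/-- The kernel `z ↦ s^{-d} k((z-x)/s)`. -/
noncomputable def scaledKernel (k : Rd d → ℝ) (x : Rd d) (s : ℝ) (z : Rd d) : ℝ :=
  (s ^ d)⁻¹ * k (s⁻¹ • (z - x))

/-- The function `d k + ∇k · ζ`, the divergence of `k(ζ) ζ`. -/
noncomputable def radialDiv (k : Rd d → ℝ) (ζ : Rd d) : ℝ := d * k ζ + fderiv ℝ k ζ ζ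

/-- The normalisation contributes `-d k` and the argument `-∇k · ζ`. Together they form minus a
divergence, which lets the scale derivative of a mollification fall on the weak gradient. -/
theorem hasDerivAt_scaledKernel {k : Rd d → ℝ} (hk : ContDiff ℝ ∞ k) (x z : Rd d) {s : ℝ}
    (hs : s ≠ 0) : HasDerivAt (fun s => scaledKernel k x s z)
      (-(s ^ (d + 1))⁻¹ * radialDiv k (s⁻¹ • (z - x))) s := by
  have h1 : HasDerivAt (fun s : ℝ => (s ^ d)⁻¹) (-(d * s ^ (d - 1)) / (s ^ d) ^ 2) s :=
    (hasDerivAt_pow d s).inv (pow_ne_zero _ hs)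
  have h2 : HasDerivAt (fun s : ℝ => s⁻¹ • (z - x)) (-(s ^ 2)⁻¹ • (z - x)) s :=
    (hasDerivAt_inv hs).smul_const _
  have h3 : HasDerivAt (fun s : ℝ => k (s⁻¹ • (z - x)))
      (fderiv ℝ k (s⁻¹ • (z - x)) (-(s ^ 2)⁻¹ • (z - x))) s :=
    ((hk.differentiable (by simp)).differentiableAt.hasFDerivAt).comp_hasDerivAt s h2
  refine (h1.mul h3).congr_deriv ?_
  have h4 : -(s ^ 2)⁻¹ • (z - x) = -s⁻¹ • (s⁻¹ • (z - x)) := by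
    rw [smul_smul]; congr 1; field_simp
  rw [h4, map_smul, radialDiv, smul_eq_mul]
  set K := k (s⁻¹ • (z - x))
  set F := fderiv ℝ k (s⁻¹ • (z - x)) (s⁻¹ • (z - x))
  rcases d with _ | n
  · simp [pow_succ]
  · simp only [Nat.add_sub_cancel]
    field_simp
    ring

/-- The components of `z ↦ s^{-d} k(ζ) ζ` with `ζ = (z-x)/s`. -/
noncomputable def fieldKernel (k : Rd d → ℝ) (x : Rd d) (s : ℝ) (i : Fin d) (z : Rd d) : ℝ :=
  scaledKernel k x s z * (s⁻¹ • (z - x)) i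

theorem contDiff_scaledKernel {k : Rd d → ℝ} (hk : ContDiff ℝ ∞ k) (x : Rd d) (s : ℝ) :
    ContDiff ℝ ∞ (scaledKernel k x s) :=
  contDiff_const.mul (hk.comp (g := k) (f := fun z : Rd d => s⁻¹ • (z - x)) (by fun_prop))

theorem contDiff_fieldKernel {k : Rd d → ℝ} (hk : ContDiff ℝ ∞ k) (x : Rd d) (s : ℝ) (i : Fin d) :
    ContDiff ℝ ∞ (fieldKernel k x s i) := by
  refine (contDiff_scaledKernel hk x s).mul ?_
  have h := (EuclideanSpace.proj (𝕜 := ℝ) i).contDiff (n := ∞)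
  exact h.comp (f := fun z : Rd d => s⁻¹ • (z - x)) (by fun_prop)

/-- The product rule for `k(ζ) ζ` with `ζ = (z - x)/s`; up to sign this is the scale derivative of
`scaledKernel`. -/
theorem sum_fderiv_fieldKernel {k : Rd d → ℝ} (hk : ContDiff ℝ ∞ k) (x z : Rd d) {s : ℝ}
    (hs : s ≠ 0) : ∑ i, fderiv ℝ (fieldKernel k x s i) z (EuclideanSpace.single i 1)
      = (s ^ (d + 1))⁻¹ * radialDiv k (s⁻¹ • (z - x)) := by
  have h2 : HasFDerivAt (fun z : Rd d => s⁻¹ • (z - x))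
      (s⁻¹ • ContinuousLinearMap.id ℝ (Rd d)) z := ((hasFDerivAt_id z).sub_const x).const_smul s⁻¹
  have h3 : HasFDerivAt (fun z : Rd d => k (s⁻¹ • (z - x)))
      ((fderiv ℝ k (s⁻¹ • (z - x))).comp (s⁻¹ • ContinuousLinearMap.id ℝ (Rd d))) z :=
    ((hk.differentiable (by simp)).differentiableAt.hasFDerivAt).comp z h2
  have h4 := h3.const_mul (s ^ d)⁻¹
  have h5 : ∀ i : Fin d, fderiv ℝ (fieldKernel k x s i) z (EuclideanSpace.single i 1)
      = (s ^ (d + 1))⁻¹ * (k (s⁻¹ • (z - x))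
        + fderiv ℝ k (s⁻¹ • (z - x)) ((s⁻¹ • (z - x)) i • EuclideanSpace.single i 1)) := by
    intro i
    have h6 : HasFDerivAt (fun z : Rd d => (s⁻¹ • (z - x)) i)
        ((EuclideanSpace.proj (𝕜 := ℝ) i).comp (s⁻¹ • ContinuousLinearMap.id ℝ (Rd d))) z :=
      ((EuclideanSpace.proj (𝕜 := ℝ) i).hasFDerivAt).comp z h2
    have h7 : HasFDerivAt (fieldKernel k x s i) _ z := h4.mul h6
    rw [h7.fderiv]
    simp [pow_succ]
    field_simp
  simp_rw [h5]
  rw [← Finset.mul_sum, Finset.sum_add_distrib, ← map_sum, radialDiv]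
  congr 2
  · simp
  · congr 1
    ext j
    simp [Finset.sum_apply, Pi.single_apply]

/-- Under the cone condition this image lies in `Ω`, so the kernels are admissible test functions
even for `x` close to the boundary. -/
theorem tsupport_scaledKernel_subset {k : Rd d → ℝ} {e : Rd d} {ε : ℝ}
    (hk : Function.support k ⊆ Metric.closedBall e ε) {x : Rd d} {s : ℝ} (hs : 0 < s) :
    tsupport (scaledKernel k x s) ⊆ (fun y => x + s • y) '' Metric.closedBall e ε := by
  refine closure_minimal ?_ ?_
  · intro z hz
    refine ⟨s⁻¹ • (z - x), hk ?_, ?_⟩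
    · intro h
      exact hz (by simp [scaledKernel, h])
    · beta_reduce
      rw [smul_smul, mul_inv_cancel₀ hs.ne', one_smul, add_sub_cancel]
  · exact ((isCompact_closedBall e ε).image (by fun_prop)).isClosed

theorem tsupport_fieldKernel_subset (k : Rd d → ℝ) (x : Rd d) (s : ℝ) (i : Fin d) :
    tsupport (fieldKernel k x s i) ⊆ tsupport (scaledKernel k x s) := by
  refine closure_mono ?_
  intro z hz h
  exact hz (by simp [fieldKernel, h])

theorem continuous_radialDiv {k : Rd d → ℝ} (hk : ContDiff ℝ ∞ k) : Continuous (radialDiv k) :=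
  (continuous_const.mul hk.continuous).add ((hk.continuous_fderiv (by simp)).clm_apply continuous_id)

theorem exists_bound_radialDiv {k : Rd d → ℝ} (hk : ContDiff ℝ ∞ k) (hc : HasCompactSupport k) :
    ∃ M, ∀ ζ, |radialDiv k ζ| ≤ M := by
  have h : HasCompactSupport (radialDiv k) := by
    refine hc.of_isClosed_subset (isClosed_tsupport _) (closure_minimal ?_ (isClosed_tsupport _))
    intro ζ hζ
    by_contra h0
    refine hζ ?_
    have h1 : fderiv ℝ k ζ = 0 := by
      by_contra h2
      exact h0 (support_fderiv_subset ℝ h2)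
    simp [radialDiv, image_eq_zero_of_notMem_tsupport h0, h1]
  exact h.exists_bound_of_continuous (continuous_radialDiv hk)

variable {F : Type} [NormedAddCommGroup F] [NormedSpace ℝ F]

theorem hasDerivAt_integral_scaledKernel [CompleteSpace F] {k : Rd d → ℝ} (hk : ContDiff ℝ ∞ k)
    (hc : HasCompactSupport k) {u : Rd d → F} (hu : IntegrableOn u Ω) (x : Rd d) {s : ℝ}
    (hs : 0 < s) :
    HasDerivAt (fun s => ∫ z in Ω, scaledKernel k x s z • u z)
      (∫ z in Ω, (-(s ^ (d + 1))⁻¹ * radialDiv k (s⁻¹ • (z - x))) • u z) s := by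
  obtain ⟨M, hM⟩ := exists_bound_radialDiv hk hc
  obtain ⟨M', hM'⟩ := hc.exists_bound_of_continuous hk.continuous
  have hcont : ∀ r, Continuous (scaledKernel k x r) := fun r => (contDiff_scaledKernel hk x r).continuous
  -- Scales above `s / 2` stay away from the singularity at `0`, which gives one dominating
  -- function.
  refine (hasDerivAt_integral_of_dominated_loc_of_deriv_le (μ := volume.restrict Ω)
    (F' := fun s z => (-(s ^ (d + 1))⁻¹ * radialDiv k (s⁻¹ • (z - x))) • u z)
    (s := Ioi (s / 2)) (bound := fun z => ((s / 2) ^ (d + 1))⁻¹ * M * ‖u z‖)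
    (Ioi_mem_nhds (half_lt_self hs)) ?_ ?_ ?_ ?_ ?_ ?_).2
  · exact Eventually.of_forall fun r => (hcont r).aestronglyMeasurable.smul hu.aestronglyMeasurable
  · refine Integrable.bdd_smul hu ((s ^ d)⁻¹ * M') (hcont s).aestronglyMeasurable
      (Eventually.of_forall fun z => ?_)
    rw [scaledKernel, norm_mul, Real.norm_of_nonneg (by positivity)]
    gcongr
    exact hM' _
  · refine AEStronglyMeasurable.smul (Continuous.aestronglyMeasurable ?_) hu.aestronglyMeasurable
    exact continuous_const.mul ((continuous_radialDiv hk).comp (by fun_prop))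
  · refine Eventually.of_forall fun z r hr => ?_
    have hr' : s / 2 < r := hr
    have h0 : 0 < s / 2 := half_pos hs
    have hr0 : 0 < r := h0.trans hr'
    rw [norm_smul, norm_mul, norm_neg, Real.norm_of_nonneg (by positivity)]
    gcongr
    exact hM _
  · exact hu.norm.const_mul _
  · refine Eventually.of_forall fun z r hr => ?_
    have hr0 : r ≠ 0 := ((half_pos hs).trans hr).ne'
    exact (hasDerivAt_scaledKernel hk x z hr0).smul_const (u z)

/-- The scale derivative of the kernel is minus the divergence of a smooth field compactly supported
in `Ω`, so the definition of the weak gradient applies componentwise. -/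
theorem integral_radialDiv_eq {k : Rd d → ℝ} (hk : ContDiff ℝ ∞ k)
    {e : Rd d} {ε : ℝ} (hsupp : Function.support k ⊆ Metric.closedBall e ε) {u : Rd d → F}
    {G : Rd d → Grad d F} (hG : HasWeakGrad Ω u G) {x : Rd d} {s : ℝ} (hs : 0 < s)
    (hcone : ∀ y ∈ Metric.closedBall e ε, x + s • y ∈ Ω) :
    ∫ z in Ω, (-(s ^ (d + 1))⁻¹ * radialDiv k (s⁻¹ • (z - x))) • u z
      = ∑ i, ∫ z in Ω, fieldKernel k x s i z • G z i := by
  have hsub : tsupport (scaledKernel k x s) ⊆ Ω :=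
    (tsupport_scaledKernel_subset hsupp hs).trans (by rintro _ ⟨y, hy, rfl⟩; exact hcone y hy)
  have hcs : HasCompactSupport (scaledKernel k x s) :=
    (((isCompact_closedBall e ε).image (by fun_prop))).of_isClosed_subset (isClosed_tsupport _)
      (tsupport_scaledKernel_subset hsupp hs)
  have hfs : ∀ i, tsupport (fieldKernel k x s i) ⊆ tsupport (scaledKernel k x s) :=
    tsupport_fieldKernel_subset k x s
  have hfc : ∀ i, HasCompactSupport (fieldKernel k x s i) := fun i =>
    hcs.of_isClosed_subset (isClosed_tsupport _) (hfs i)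
  have h1 : ∀ z, (-(s ^ (d + 1))⁻¹ * radialDiv k (s⁻¹ • (z - x))) • u z
      = - ∑ i, fderiv ℝ (fieldKernel k x s i) z (EuclideanSpace.single i 1) • u z := by
    intro z
    rw [← Finset.sum_smul, sum_fderiv_fieldKernel hk x z hs.ne', neg_mul, neg_smul]
  simp_rw [h1]
  rw [integral_neg, integral_finsetSum _ fun i _ => integrable_test_fderiv hG.locInt
    (contDiff_fieldKernel hk x s i) (hfc i) ((hfs i).trans hsub) _, ← Finset.sum_neg_distrib]
  refine Finset.sum_congr rfl fun i _ => ?_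
  rw [hG.parts _ (contDiff_fieldKernel hk x s i) (hfc i) ((hfs i).trans hsub) i, neg_neg]

end Representation


/-! ### Bounds for the mollifications, uniform in the scale. -/

section Representation

variable {d : ℕ} {Ω : Set (Rd d)}

/-- Origin of the Riesz kernel: the integral of `s^{-d}` over `s ≥ |y|/R` is a multiple of
`|y|^{1-d}`. At `y = 0` the right-hand side is infinite. -/
theorem lintegral_indicator_pow_inv_le (hd : 2 ≤ d) {R : ℝ} (hR : 0 < R) (h₀ : ℝ) (y : Rd d) :
    ∫⁻ s in Ioc 0 h₀, {s : ℝ | ‖y‖ ≤ R * s}.indicator (fun s => ENNReal.ofReal (s ^ d)⁻¹) s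
      ≤ ENNReal.ofReal (R ^ ((d : ℝ) - 1) / ((d : ℝ) - 1)) * ‖y‖ₑ ^ (1 - (d : ℝ)) := by
  have hd' : (2 : ℝ) ≤ d := by exact_mod_cast hd
  have hd1 : 0 < (d : ℝ) - 1 := by linarith
  rcases eq_or_ne y 0 with rfl | hy
  · rw [enorm_zero, ENNReal.zero_rpow_of_neg (by linarith), ENNReal.mul_top]
    · exact le_top
    · rw [Ne, ENNReal.ofReal_eq_zero, not_le]
      positivity
  have hy' : 0 < ‖y‖ := norm_pos_iff.2 hy
  let a := ‖y‖ / R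
  have ha : 0 < a := by positivity
  have hset : MeasurableSet {s : ℝ | ‖y‖ ≤ R * s} :=
    measurableSet_le measurable_const (measurable_const.mul measurable_id)
  calc _ ≤ ∫⁻ s in Ici a, ENNReal.ofReal (s ^ d)⁻¹ := by
        rw [lintegral_indicator hset, Measure.restrict_restrict hset]
        refine lintegral_mono_set fun s hs => ?_
        have : ‖y‖ ≤ R * s := hs.1
        simp only [a, mem_Ici]
        rwa [div_le_iff₀ hR, mul_comm]
    _ = ∫⁻ s in Ioi a, ENNReal.ofReal (s ^ (-(d : ℝ))) := by
        rw [setLIntegral_congr Ioi_ae_eq_Ici.symm]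
        refine setLIntegral_congr_fun measurableSet_Ioi fun s hs => ?_
        have hs0 : 0 < s := ha.trans hs
        simp only [Real.rpow_neg hs0.le, Real.rpow_natCast]
    _ = ENNReal.ofReal (∫ s in Ioi a, s ^ (-(d : ℝ))) := by
        rw [ofReal_integral_eq_lintegral_ofReal (integrableOn_Ioi_rpow_of_lt (by linarith) ha)]
        filter_upwards [ae_restrict_mem measurableSet_Ioi] with s hs
        exact Real.rpow_nonneg (ha.trans hs).le _
    _ ≤ _ := by
        rw [integral_Ioi_rpow_of_lt (by linarith) ha, ← ofReal_norm,
          ENNReal.ofReal_rpow_of_pos hy', ← ENNReal.ofReal_mul (by positivity)]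
        apply le_of_eq
        congr 1
        simp only [a]
        rw [Real.div_rpow hy'.le hR.le, show -(d : ℝ) + 1 = -((d : ℝ) - 1) by ring,
          Real.rpow_neg hR.le, show 1 - (d : ℝ) = -((d : ℝ) - 1) by ring]
        have := (Real.rpow_pos_of_pos hR ((d : ℝ) - 1)).ne'
        field_simp

variable {F : Type} [NormedAddCommGroup F] [NormedSpace ℝ F]

theorem enorm_integral_scaledKernel_le_mul {k : Rd d → ℝ} {M : ℝ} (hM : ∀ ζ, |k ζ| ≤ M)
    (u : Rd d → F) (x : Rd d) {s : ℝ} (hs : 0 < s) :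
    ‖∫ z in Ω, scaledKernel k x s z • u z‖ₑ
      ≤ ENNReal.ofReal ((s ^ d)⁻¹ * M) * ∫⁻ z in Ω, ‖u z‖ₑ := by
  refine (enorm_integral_le_lintegral_enorm _).trans ?_
  rw [← lintegral_const_mul' _ _ ENNReal.ofReal_ne_top]
  refine lintegral_mono fun z => ?_
  rw [enorm_smul]
  gcongr
  rw [Real.enorm_eq_ofReal_abs]
  apply ENNReal.ofReal_le_ofReal
  rw [scaledKernel, abs_mul, abs_of_pos (by positivity)]
  gcongr
  exact hM _

/-- On the support of `k` each component of `ζ` is at most `R`; the indicator records that `z` must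
lie within `R * s` of `x`. The factor `d` counts the components. -/
theorem enorm_sum_integral_fieldKernel_le {k : Rd d → ℝ} {M : ℝ} (hM : ∀ ζ, |k ζ| ≤ M)
    {R : ℝ} (hsupp : ∀ ζ, k ζ ≠ 0 → ‖ζ‖ ≤ R) (G : Rd d → Grad d F) (x : Rd d) {s : ℝ}
    (hs : 0 < s) :
    ‖∑ i, ∫ z in Ω, fieldKernel k x s i z • G z i‖ₑ ≤ (d : ℝ≥0∞) * ENNReal.ofReal (M * R) *
      ∫⁻ z in Ω, {s : ℝ | ‖z - x‖ ≤ R * s}.indicator (fun s => ENNReal.ofReal (s ^ d)⁻¹) s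
        * ‖G z‖ₑ := by
  have h1 : ∀ i, ‖∫ z in Ω, fieldKernel k x s i z • G z i‖ₑ ≤ ENNReal.ofReal (M * R) *
      ∫⁻ z in Ω, {s : ℝ | ‖z - x‖ ≤ R * s}.indicator (fun s => ENNReal.ofReal (s ^ d)⁻¹) s
        * ‖G z‖ₑ := by
    intro i
    refine (enorm_integral_le_lintegral_enorm _).trans ?_
    rw [← lintegral_const_mul' _ _ ENNReal.ofReal_ne_top]
    refine lintegral_mono fun z => ?_
    rw [enorm_smul, ← mul_assoc]
    by_cases hz : k (s⁻¹ • (z - x)) = 0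
    · simp [fieldKernel, scaledKernel, hz]
    have hζ := hsupp _ hz
    have hzR : ‖z - x‖ ≤ R * s := by
      rw [norm_smul, norm_inv, Real.norm_of_nonneg hs.le, inv_mul_le_iff₀ hs] at hζ
      linarith
    rw [indicator_of_mem (show s ∈ {s : ℝ | ‖z - x‖ ≤ R * s} from hzR)]
    have hR : 0 ≤ R := (norm_nonneg _).trans hζ
    have hM0 : 0 ≤ M := (abs_nonneg _).trans (hM 0)
    gcongr
    · rw [Real.enorm_eq_ofReal_abs, ← ENNReal.ofReal_mul (by positivity)]
      apply ENNReal.ofReal_le_ofReal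
      rw [fieldKernel, scaledKernel, abs_mul, abs_mul, abs_of_pos (by positivity : 0 < (s ^ d)⁻¹)]
      have h2 : |(s⁻¹ • (z - x)) i| ≤ R := (PiLp.norm_apply_le _ i).trans hζ
      calc (s ^ d)⁻¹ * |k (s⁻¹ • (z - x))| * |(s⁻¹ • (z - x)) i| ≤ (s ^ d)⁻¹ * M * R := by
            gcongr
            exact hM _
        _ = M * R * (s ^ d)⁻¹ := by ring
    · rw [← ofReal_norm, ← ofReal_norm]
      exact ENNReal.ofReal_le_ofReal (PiLp.norm_apply_le _ i)
  refine (enorm_sum_le _ _).trans ((Finset.sum_le_sum fun i _ => h1 i).trans ?_)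
  simp [mul_assoc]

/-- The mollification at scale `h` is the one at the fixed scale `h₀` minus the integral of its
scale derivative. The first term is controlled by the `L¹` norm; in the second, Tonelli's theorem
turns the integral over scales into the Riesz kernel. The bound is independent of `h`, which permits
`h → 0`. -/
theorem enorm_integral_scaledKernel_le [CompleteSpace F] (hd : 2 ≤ d) {k : Rd d → ℝ}
    (hk : ContDiff ℝ ∞ k) {e : Rd d} {ε : ℝ} (hε : 0 < ε)
    (hsupp : Function.support k ⊆ Metric.closedBall e ε)
    {M : ℝ} (hM : ∀ ζ, |k ζ| ≤ M) {h₀ : ℝ} (hh₀ : 0 < h₀) {u : Rd d → F} {G : Rd d → Grad d F}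
    (hG : HasWeakGrad Ω u G) (hu : IntegrableOn u Ω) (hGi : IntegrableOn G Ω) {x : Rd d}
    (hcone : ∀ y ∈ Metric.closedBall e ε, ∀ s ∈ Ioc 0 h₀, x + s • y ∈ Ω) {h : ℝ}
    (hh : h ∈ Ioc 0 h₀) :
    ‖∫ z in Ω, scaledKernel k x h z • u z‖ₑ
      ≤ ENNReal.ofReal ((h₀ ^ d)⁻¹ * M) * (∫⁻ z in Ω, ‖u z‖ₑ) +
        (d : ℝ≥0∞) * ENNReal.ofReal (M * (‖e‖ + ε)) *
          ENNReal.ofReal ((‖e‖ + ε) ^ ((d : ℝ) - 1) / ((d : ℝ) - 1)) *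
          ∫⁻ z in Ω, ‖G z‖ₑ * ‖z - x‖ₑ ^ (1 - (d : ℝ)) := by
  set R := ‖e‖ + ε with hR
  have hRpos : 0 < R := by positivity
  have hsupp' : ∀ ζ, k ζ ≠ 0 → ‖ζ‖ ≤ R := by
    intro ζ hζ
    have := hsupp hζ
    rw [Metric.mem_closedBall, dist_eq_norm] at this
    linarith [norm_le_norm_add_norm_sub e ζ, norm_sub_rev e ζ]
  have hc : HasCompactSupport k :=
    HasCompactSupport.intro (isCompact_closedBall e ε) fun z hz => by
      by_contra h0
      exact hz (hsupp h0)
  let A : ℝ → F := fun s => ∫ z in Ω, scaledKernel k x s z • u z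
  let A' : ℝ → F := fun s => ∫ z in Ω, (-(s ^ (d + 1))⁻¹ * radialDiv k (s⁻¹ • (z - x))) • u z
  have hderiv : ∀ s, 0 < s → HasDerivAt A (A' s) s := fun s hs =>
    hasDerivAt_integral_scaledKernel hk hc hu x hs
  obtain ⟨M', hM'⟩ := exists_bound_radialDiv hk hc
  have hcont : ContinuousOn A' (Icc h h₀) := by
    refine continuousOn_of_dominated (bound := fun z => (h ^ (d + 1))⁻¹ * M' * ‖u z‖) ?_ ?_ ?_ ?_
    · intro s hs
      refine AEStronglyMeasurable.smul (Continuous.aestronglyMeasurable ?_) hu.aestronglyMeasurable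
      exact continuous_const.mul ((continuous_radialDiv hk).comp (by fun_prop))
    · intro s hs
      refine Eventually.of_forall fun z => ?_
      have h1 : 0 < h := hh.1
      have h2 : 0 < s := h1.trans_le hs.1
      rw [norm_smul, norm_mul, norm_neg, Real.norm_of_nonneg (by positivity)]
      gcongr
      · exact hs.1
      · exact hM' _
    · exact hu.norm.const_mul _
    · refine Eventually.of_forall fun z => ?_
      have hne : ∀ s ∈ Icc h h₀, s ≠ 0 := fun s hs => (hh.1.trans_le hs.1).ne'
      refine ContinuousOn.smul (ContinuousOn.mul ?_ ?_) continuousOn_const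
      · exact (((continuousOn_id.pow _).inv₀ fun s hs => pow_ne_zero _ (hne s hs))).neg
      · exact (continuous_radialDiv hk).comp_continuousOn
          ((continuousOn_id.inv₀ hne).smul continuousOn_const)
  have hFTC : ∫ s in h..h₀, A' s = A h₀ - A h := by
    refine intervalIntegral.integral_eq_sub_of_hasDerivAt (fun s hs => hderiv s ?_) ?_
    · rw [uIcc_of_le hh.2] at hs
      exact hh.1.trans_le hs.1
    · exact hcont.intervalIntegrable_of_Icc hh.2
  have hA'le : ∀ s ∈ Ioc 0 h₀, ‖A' s‖ₑ ≤ (d : ℝ≥0∞) * ENNReal.ofReal (M * R) *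
      ∫⁻ z in Ω, {s : ℝ | ‖z - x‖ ≤ R * s}.indicator (fun s => ENNReal.ofReal (s ^ d)⁻¹) s
        * ‖G z‖ₑ := by
    intro s hs
    have h1 : A' s = _ := integral_radialDiv_eq hk hsupp hG hs.1 fun y hy => hcone y hy s hs
    rw [h1]
    exact enorm_sum_integral_fieldKernel_le hM hsupp' G x hs.1
  have hmeas : Measurable (Function.uncurry fun (s : ℝ) (z : Rd d) =>
      {s : ℝ | ‖z - x‖ ≤ R * s}.indicator (fun s => ENNReal.ofReal (s ^ d)⁻¹) s) := by
    have hs : MeasurableSet {q : ℝ × Rd d | ‖q.2 - x‖ ≤ R * q.1} :=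
      measurableSet_le (by fun_prop) (by fun_prop)
    have h1 : Measurable fun q : ℝ × Rd d => ENNReal.ofReal (q.1 ^ d)⁻¹ := by fun_prop
    exact h1.indicator hs
  have hswap : ∫⁻ s in Ioc 0 h₀, ∫⁻ z in Ω,
      {s : ℝ | ‖z - x‖ ≤ R * s}.indicator (fun s => ENNReal.ofReal (s ^ d)⁻¹) s * ‖G z‖ₑ
      ≤ ENNReal.ofReal (R ^ ((d : ℝ) - 1) / ((d : ℝ) - 1)) *
          ∫⁻ z in Ω, ‖G z‖ₑ * ‖z - x‖ₑ ^ (1 - (d : ℝ)) := by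
    rw [lintegral_lintegral_swap, ← lintegral_const_mul' _ _ ENNReal.ofReal_ne_top]
    · refine lintegral_mono fun z => ?_
      rw [lintegral_mul_const' _ _ enorm_ne_top]
      calc _ ≤ ENNReal.ofReal (R ^ ((d : ℝ) - 1) / ((d : ℝ) - 1)) * ‖z - x‖ₑ ^ (1 - (d : ℝ))
            * ‖G z‖ₑ := by
            gcongr
            exact lintegral_indicator_pow_inv_le hd hRpos h₀ (z - x)
        _ = _ := by ring
    · exact hmeas.aemeasurable.mul hGi.aestronglyMeasurable.enorm.comp_snd
  calc ‖A h‖ₑ = ‖A h₀ - ∫ s in h..h₀, A' s‖ₑ := by rw [hFTC, sub_sub_cancel]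
    _ ≤ ‖A h₀‖ₑ + ‖∫ s in h..h₀, A' s‖ₑ := enorm_sub_le
    _ ≤ _ := by
      gcongr
      · exact enorm_integral_scaledKernel_le_mul hM u x hh₀
      · rw [intervalIntegral.integral_of_le hh.2]
        refine (enorm_integral_le_lintegral_enorm _).trans ?_
        calc ∫⁻ s in Ioc h h₀, ‖A' s‖ₑ ≤ ∫⁻ s in Ioc 0 h₀, ‖A' s‖ₑ :=
              lintegral_mono_set (Ioc_subset_Ioc_left hh.1.le)
          _ ≤ ∫⁻ s in Ioc 0 h₀, (d : ℝ≥0∞) * ENNReal.ofReal (M * R) * ∫⁻ z in Ω,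
              {s : ℝ | ‖z - x‖ ≤ R * s}.indicator (fun s => ENNReal.ofReal (s ^ d)⁻¹) s
                * ‖G z‖ₑ := setLIntegral_mono' measurableSet_Ioc hA'le
          _ ≤ _ := by
            rw [lintegral_const_mul' _ _
              (ENNReal.mul_ne_top (ENNReal.natCast_ne_top d) ENNReal.ofReal_ne_top)]
            rw [mul_assoc ((d : ℝ≥0∞) * ENNReal.ofReal (M * R))]
            gcongr

end Representation


/-! ### Pointwise bound by a Riesz potential. -/

section Pointwise

variable {d : ℕ} {Ω : Set (Rd d)}

theorem integral_scaledKernel (k : Rd d → ℝ) (x : Rd d) {s : ℝ} (hs : 0 < s) :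
    ∫ z, scaledKernel k x s z = ∫ z, k z := by
  simp only [scaledKernel]
  rw [integral_const_mul, integral_sub_right_eq_self (fun z => k (s⁻¹ • z)) x,
    Measure.integral_comp_inv_smul, finrank_euclideanSpace, Fintype.card_fin,
    abs_of_pos (pow_pos hs d), smul_eq_mul, ← mul_assoc, inv_mul_cancel₀ (pow_pos hs d).ne', one_mul]

/-- Off-centred mollification converges almost everywhere. -/
theorem ae_tendsto_integral_scaledKernel {F : Type} [NormedAddCommGroup F] [NormedSpace ℝ F]
    [CompleteSpace F] {k : Rd d → ℝ} (hint : ∫ z, k z = 1) {e : Rd d} {ε : ℝ} (hε : 0 < ε)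
    (hsupp : Function.support k ⊆ Metric.closedBall e ε) {M : ℝ} (hM : ∀ ζ, |k ζ| ≤ M)
    {u : Rd d → F} (hu : LocallyIntegrable u) :
    ∀ᵐ x, Tendsto (fun h => ∫ z, scaledKernel k x h z • u z) (𝓝[>] (0 : ℝ)) (𝓝 (u x)) := by
  -- The kernel at scale `h` lives on the ball of radius `h * ε` around `x + h • e`, which need not
  -- contain `x`. Differentiation along such balls is allowed since `x` stays within `‖e‖ / ε` radii
  -- of the centre.
  filter_upwards [IsUnifLocDoublingMeasure.ae_tendsto_average_norm_sub volume hu (‖e‖ / ε)]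
    with x hx
  have hδ : Tendsto (fun h : ℝ => h * ε) (𝓝[>] 0) (𝓝[>] 0) := by
    refine tendsto_nhdsWithin_iff.2 ⟨?_, ?_⟩
    · have : Tendsto (fun h : ℝ => h * ε) (𝓝 0) (𝓝 (0 * ε)) := tendsto_id.mul_const ε
      rw [zero_mul] at this
      exact this.mono_left nhdsWithin_le_nhds
    · filter_upwards [self_mem_nhdsWithin] with h hh
      exact mul_pos hh hε
  have hlim := hx (fun h : ℝ => x + h • e) (fun h => h * ε) hδ (by
    filter_upwards [self_mem_nhdsWithin] with h hh
    have hh' : 0 < h := hh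
    rw [Metric.mem_closedBall, dist_eq_norm, sub_add_cancel_left, norm_neg, norm_smul,
      Real.norm_of_nonneg hh'.le]
    apply le_of_eq
    field_simp)
  refine tendsto_integral_smul_of_tendsto_average_norm_sub
    (M * (volume.real (Metric.closedBall (0 : Rd d) ε))) hlim ?_ ?_ ?_ ?_
  · exact Eventually.of_forall fun h => hu.integrableOn_isCompact (isCompact_closedBall _ _)
  · refine tendsto_const_nhds.congr' ?_
    filter_upwards [self_mem_nhdsWithin] with h hh
    rw [integral_scaledKernel k x hh, hint]
  · filter_upwards [self_mem_nhdsWithin] with h hh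
    have hh' : 0 < h := hh
    refine (subset_tsupport _).trans ((tsupport_scaledKernel_subset hsupp hh').trans ?_)
    rintro _ ⟨y, hy, rfl⟩
    rw [Metric.mem_closedBall, dist_eq_norm] at hy ⊢
    rw [add_sub_add_left_eq_sub, ← smul_sub, norm_smul, Real.norm_of_nonneg hh'.le]
    gcongr
  · filter_upwards [self_mem_nhdsWithin] with h hh z
    have hh' : 0 < h := hh
    have hM0 : 0 ≤ M := (abs_nonneg _).trans (hM 0)
    have hvol : volume.real (Metric.closedBall (x + h • e) (h * ε))
        = h ^ d * volume.real (Metric.closedBall (0 : Rd d) ε) := by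
      rw [measureReal_def, measureReal_def, Measure.addHaar_closedBall_mul _ _ hh'.le hε.le,
        Measure.addHaar_closedBall_center volume (0 : Rd d) ε,
        finrank_euclideanSpace, Fintype.card_fin, ENNReal.toReal_mul,
        ENNReal.toReal_ofReal (by positivity)]
    have hpos : 0 < volume.real (Metric.closedBall (0 : Rd d) ε) :=
      ENNReal.toReal_pos (Metric.measure_closedBall_pos volume _ hε).ne' measure_closedBall_lt_top.ne
    rw [hvol, scaledKernel, abs_mul, abs_of_pos (by positivity)]
    calc (h ^ d)⁻¹ * |k (h⁻¹ • (z - x))| ≤ (h ^ d)⁻¹ * M := by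
          gcongr
          exact hM _
      _ = _ := by field_simp

/-- On a `C²` domain, an integrable function with integrable weak gradient is bounded pointwise by
its `L¹` norm and the Riesz potential of its gradient. -/
theorem IsC2Domain.exists_riesz_bound (hd : 2 ≤ d) (hΩ : IsC2Domain Ω) :
    ∃ C : ℝ≥0∞, C ≠ ⊤ ∧ ∀ (F : Type) [NormedAddCommGroup F] [NormedSpace ℝ F] [CompleteSpace F]
      (u : Rd d → F) (G : Rd d → Grad d F), HasWeakGrad Ω u G → IntegrableOn u Ω →
      IntegrableOn G Ω → ∀ᵐ x ∂(volume.restrict Ω),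
        ‖u x‖ₑ ≤ C * ((∫⁻ z in Ω, ‖u z‖ₑ) + ∫⁻ z in Ω, ‖G z‖ₑ * ‖z - x‖ₑ ^ (1 - (d : ℝ))) := by
  have hcomp : IsCompact (closure Ω) := hΩ.bounded.isCompact_closure
  suffices h : ∃ C : ℝ≥0∞, C ≠ ⊤ ∧ ∀ (F : Type) [NormedAddCommGroup F] [NormedSpace ℝ F]
      [CompleteSpace F] (u : Rd d → F) (G : Rd d → Grad d F), HasWeakGrad Ω u G →
      IntegrableOn u Ω → IntegrableOn G Ω → ∀ᵐ x ∂(volume.restrict Ω), x ∈ closure Ω →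
        ‖u x‖ₑ ≤ C * ((∫⁻ z in Ω, ‖u z‖ₑ) + ∫⁻ z in Ω, ‖G z‖ₑ * ‖z - x‖ₑ ^ (1 - (d : ℝ))) by
    obtain ⟨C, hC, h⟩ := h
    refine ⟨C, hC, fun F _ _ _ u G hG hu hGi => ?_⟩
    filter_upwards [h F u G hG hu hGi, ae_restrict_mem hΩ.isOpen.measurableSet] with x hx hxΩ
      using hx (subset_closure hxΩ)
  -- The cone depends on the boundary point. Compactness of the closure reduces to finitely many
  -- local cones, and their constants add up.
  refine hcomp.induction_on (p := fun S => ∃ C : ℝ≥0∞, C ≠ ⊤ ∧ ∀ (F : Type) [NormedAddCommGroup F]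
      [NormedSpace ℝ F] [CompleteSpace F] (u : Rd d → F) (G : Rd d → Grad d F), HasWeakGrad Ω u G →
      IntegrableOn u Ω → IntegrableOn G Ω → ∀ᵐ x ∂(volume.restrict Ω), x ∈ S →
        ‖u x‖ₑ ≤ C * ((∫⁻ z in Ω, ‖u z‖ₑ) + ∫⁻ z in Ω, ‖G z‖ₑ * ‖z - x‖ₑ ^ (1 - (d : ℝ))))
      ?_ ?_ ?_ ?_
  · exact ⟨0, by simp, fun F _ _ _ u G _ _ _ => Eventually.of_forall fun x hx => absurd hx (by simp)⟩
  · rintro S S' hSS' ⟨C, hC, h⟩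
    refine ⟨C, hC, fun F _ _ _ u G hG hu hGi => ?_⟩
    filter_upwards [h F u G hG hu hGi] with x hx hxS using hx (hSS' hxS)
  · rintro S S' ⟨C, hC, h⟩ ⟨C', hC', h'⟩
    refine ⟨C + C', by simp [hC, hC'], fun F _ _ _ u G hG hu hGi => ?_⟩
    filter_upwards [h F u G hG hu hGi, h' F u G hG hu hGi] with x hx hx' hxS
    rcases hxS with hxS | hxS
    · exact (hx hxS).trans (by gcongr; exact le_self_add)
    · exact (hx' hxS).trans (by gcongr; exact le_add_self)
  · intro x₀ hx₀
    obtain ⟨e, ε, h₀, hε, hh₀, hcone⟩ := hΩ.exists_cone hx₀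
    -- The mollifier is supported in the ball of admissible cone directions, so mollifying at `x`
    -- uses only values of `u` inside `Ω`.
    let φ : ContDiffBump e := ⟨ε / 2, ε, half_pos hε, half_lt_self hε⟩
    let k : Rd d → ℝ := φ.normed volume
    have hk : ContDiff ℝ ∞ k := φ.contDiff_normed
    have hsupp : Function.support k ⊆ Metric.closedBall e ε := by
      rw [φ.support_normed_eq]
      exact Metric.ball_subset_closedBall
    obtain ⟨M, hM⟩ := (φ.hasCompactSupport_normed (μ := volume)).exists_bound_of_continuous
      φ.continuous_normed
    refine ⟨_, mem_nhdsWithin_of_mem_nhds hcone,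
      ENNReal.ofReal ((h₀ ^ d)⁻¹ * M) + (d : ℝ≥0∞) * ENNReal.ofReal (M * (‖e‖ + ε)) *
          ENNReal.ofReal ((‖e‖ + ε) ^ ((d : ℝ) - 1) / ((d : ℝ) - 1)), ?_, ?_⟩
    · exact ENNReal.add_ne_top.2 ⟨ENNReal.ofReal_ne_top, ENNReal.mul_ne_top
        (ENNReal.mul_ne_top (ENNReal.natCast_ne_top d) ENNReal.ofReal_ne_top)
        ENNReal.ofReal_ne_top⟩
    intro F _ _ _ u G hG hu hGi
    have hu0 : Integrable (Ω.indicator u) :=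
      (integrable_indicator_iff hΩ.isOpen.measurableSet).2 hu
    filter_upwards [ae_restrict_of_ae (ae_tendsto_integral_scaledKernel φ.integral_normed hε hsupp
      hM hu0.locallyIntegrable), ae_restrict_mem hΩ.isOpen.measurableSet] with x hlim hxΩ hx
    rw [indicator_of_mem hxΩ] at hlim
    refine le_of_tendsto hlim.enorm ?_
    filter_upwards [Ioc_mem_nhdsGT hh₀] with h hh
    have h1 : ∫ z, scaledKernel k x h z • Ω.indicator u z
        = ∫ z in Ω, scaledKernel k x h z • u z := by
      rw [← integral_indicator hΩ.isOpen.measurableSet]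
      refine integral_congr_ae (Eventually.of_forall fun z => ?_)
      by_cases hz : z ∈ Ω <;> simp [hz]
    rw [h1]
    refine (enorm_integral_scaledKernel_le hd hk hε hsupp hM hh₀ hG hu hGi (hx hxΩ) hh).trans ?_
    refine le_trans ?_ (mul_add _ _ _).ge
    exact add_le_add (mul_le_mul' le_self_add le_rfl) (mul_le_mul' le_add_self le_rfl)

end Pointwise


/-! ### Young's inequality and the subcritical Sobolev inequality. -/

section Sobolev

/-- Young's inequality for integral operators. -/
theorem lintegral_rpow_lintegral_mul_le {X : Type*} [MeasurableSpace X] {μ : Measure X}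
    [SFinite μ] {κ : X → X → ℝ≥0∞} (hκ : Measurable (Function.uncurry κ)) {g : X → ℝ≥0∞}
    (hg : AEMeasurable g μ) {r q s : ℝ} (hr : 1 ≤ r) (hrq : r ≤ q) (hs : 0 < s)
    (hrqs : 1 / r + 1 / s = 1 + 1 / q) {B : ℝ≥0∞} (hB1 : ∀ᵐ x ∂μ, ∫⁻ z, κ z x ^ s ∂μ ≤ B)
    (hB2 : ∀ᵐ z ∂μ, ∫⁻ x, κ z x ^ s ∂μ ≤ B) :
    ∫⁻ x, (∫⁻ z, g z * κ z x ∂μ) ^ q ∂μ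
      ≤ B ^ (1 + q * (1 - 1 / r)) * (∫⁻ z, g z ^ r ∂μ) ^ (1 + q * (1 / r - 1 / q)) := by
  have hr0 : 0 < r := by linarith
  have hq0 : 0 < q := by linarith
  have h1q : 0 ≤ 1 / q := by positivity
  have hrq' : 0 ≤ 1 / r - 1 / q := sub_nonneg.2 (one_div_le_one_div_of_le hr0 hrq)
  have hr1 : 0 ≤ 1 - 1 / r := by
    rw [sub_nonneg, div_le_one hr0]
    exact hr
  have hs' : 1 / s - 1 / q = 1 - 1 / r := by linarith
  have hκx : ∀ x, Measurable fun z => κ z x := fun x =>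
    hκ.comp (measurable_id.prodMk measurable_const)
  -- Factorisation adapted to Hölder's inequality with weights `1/q`, `1/r - 1/q` and `1 - 1/r`,
  -- which sum to one.
  have hpt : ∀ a b : ℝ≥0∞, a * b
      = (a ^ r * b ^ s) ^ (1 / q) * (a ^ r) ^ (1 / r - 1 / q) * (b ^ s) ^ (1 - 1 / r) := by
    intro a b
    have e1 : a = (a ^ r) ^ (1 / q) * (a ^ r) ^ (1 / r - 1 / q) := by
      rw [← ENNReal.rpow_add_of_nonneg _ _ h1q hrq', ← ENNReal.rpow_mul]
      rw [show r * (1 / q + (1 / r - 1 / q)) = 1 by field_simp; ring, ENNReal.rpow_one]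
    have e2 : b = (b ^ s) ^ (1 / q) * (b ^ s) ^ (1 - 1 / r) := by
      rw [← ENNReal.rpow_add_of_nonneg _ _ h1q hr1, ← ENNReal.rpow_mul, ← hs']
      rw [show s * (1 / q + (1 / s - 1 / q)) = 1 by field_simp; ring, ENNReal.rpow_one]
    calc a * b = ((a ^ r) ^ (1 / q) * (a ^ r) ^ (1 / r - 1 / q))
          * ((b ^ s) ^ (1 / q) * (b ^ s) ^ (1 - 1 / r)) := by rw [← e1, ← e2]
      _ = _ := by rw [ENNReal.mul_rpow_of_nonneg _ _ h1q]; ring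
  set N := ∫⁻ z, g z ^ r ∂μ with hN
  have hx : ∀ᵐ x ∂μ, (∫⁻ z, g z * κ z x ∂μ) ^ q
      ≤ (∫⁻ z, g z ^ r * κ z x ^ s ∂μ) * (N ^ (q * (1 / r - 1 / q)) * B ^ (q * (1 - 1 / r))) := by
    filter_upwards [hB1] with x hx
    have hol := ENNReal.lintegral_prod_norm_pow_le (μ := μ) Finset.univ
      (f := ![fun z => g z ^ r * κ z x ^ s, fun z => g z ^ r, fun z => κ z x ^ s])
      (p := ![1 / q, 1 / r - 1 / q, 1 - 1 / r])
      (by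
        intro i _
        fin_cases i
        · exact (hg.pow_const r).mul ((hκx x).pow_const s).aemeasurable
        · exact hg.pow_const r
        · exact ((hκx x).pow_const s).aemeasurable)
      (by simp [Fin.sum_univ_three])
      (by
        intro i _
        fin_cases i
        · exact h1q
        · exact hrq'
        · exact hr1)
    simp only [Fin.prod_univ_three, Matrix.cons_val_zero, Matrix.cons_val_one,
      Matrix.cons_val] at hol
    have h1 : ∫⁻ z, g z * κ z x ∂μ ≤ (∫⁻ z, g z ^ r * κ z x ^ s ∂μ) ^ (1 / q)
        * N ^ (1 / r - 1 / q) * B ^ (1 - 1 / r) := by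
      refine (lintegral_congr fun z => hpt (g z) (κ z x)).le.trans (hol.trans ?_)
      gcongr
    refine (ENNReal.rpow_le_rpow h1 hq0.le).trans ?_
    rw [ENNReal.mul_rpow_of_nonneg _ _ hq0.le, ENNReal.mul_rpow_of_nonneg _ _ hq0.le,
      ← ENNReal.rpow_mul, ← ENNReal.rpow_mul, ← ENNReal.rpow_mul, one_div_mul_cancel hq0.ne',
      ENNReal.rpow_one, mul_assoc, mul_comm q, mul_comm q]
  have hjoint : AEMeasurable (Function.uncurry fun x z => g z ^ r * κ z x ^ s) (μ.prod μ) := by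
    refine AEMeasurable.mul (f := fun p : X × X => g p.2 ^ r) ?_ ?_
    · exact (hg.comp_snd).pow_const r
    · exact ((hκ.comp measurable_swap).pow_const s).aemeasurable
  calc _ ≤ ∫⁻ x, (∫⁻ z, g z ^ r * κ z x ^ s ∂μ)
        * (N ^ (q * (1 / r - 1 / q)) * B ^ (q * (1 - 1 / r))) ∂μ := lintegral_mono_ae hx
    _ = (∫⁻ x, ∫⁻ z, g z ^ r * κ z x ^ s ∂μ ∂μ)
        * (N ^ (q * (1 / r - 1 / q)) * B ^ (q * (1 - 1 / r))) :=
      lintegral_mul_const'' _ hjoint.lintegral_prod_right'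
    _ ≤ (N * B) * (N ^ (q * (1 / r - 1 / q)) * B ^ (q * (1 - 1 / r))) := by
      gcongr
      rw [lintegral_lintegral_swap hjoint, hN]
      rw [← lintegral_mul_const'' _ (hg.pow_const r)]
      refine lintegral_mono_ae ?_
      filter_upwards [hB2] with z hz
      have hm : Measurable fun x => κ z x := hκ.comp (measurable_const.prodMk measurable_id)
      rw [lintegral_const_mul _ (hm.pow_const s)]
      gcongr
    _ = _ := by
      rw [ENNReal.rpow_add_of_nonneg _ _ zero_le_one (by positivity),
        ENNReal.rpow_add_of_nonneg _ _ zero_le_one (by positivity), ENNReal.rpow_one,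
        ENNReal.rpow_one]
      ring

variable {d : ℕ} {Ω : Set (Rd d)}

/-- The power `|y|^{-(d-1)s}` is integrable near the origin because `(d-1)s < d`. If `Ω` lies in a
ball of radius `D`, every translate `Ω - x` with `x ∈ Ω` lies in the ball of radius `2 * D + 1`, so
the bound is uniform. -/
theorem exists_lintegral_riesz_le (hd : 2 ≤ d) (hΩ : Bornology.IsBounded Ω) {s : ℝ}
    (hsd : ((d : ℝ) - 1) * s < d) :
    ∃ B : ℝ≥0∞, B ≠ ⊤ ∧ ∀ x ∈ Ω, ∫⁻ z in Ω, (‖z - x‖ₑ ^ (1 - (d : ℝ))) ^ s ≤ B := by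
  have hd' : (2 : ℝ) ≤ d := by exact_mod_cast hd
  obtain ⟨D, hD⟩ := hΩ.subset_closedBall 0
  let f : Rd d → ℝ := fun y => ‖y‖ ^ (-(((d : ℝ) - 1) * s))
  have hf : IntegrableOn f (Metric.ball 0 (2 * D + 1)) := by
    refine integrableOn_ball_of_norm_le_rpow (C := 1) (α := ((d : ℝ) - 1) * s) ?_ ?_ ?_ ?_
    · rw [finrank_euclideanSpace, Fintype.card_fin]; omega
    · rw [finrank_euclideanSpace, Fintype.card_fin]; exact hsd
    · refine Eventually.of_forall fun x => ?_
      rw [one_mul, Real.norm_of_nonneg (by positivity)]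
    · exact (measurable_norm.pow_const _).aestronglyMeasurable
  refine ⟨∫⁻ y in Metric.ball 0 (2 * D + 1), ‖f y‖ₑ, hf.2.ne, fun x hx => ?_⟩
  have hne : ∀ᵐ y : Rd d, y ≠ 0 := by
    have : Nonempty (Fin d) := ⟨⟨0, by omega⟩⟩
    simp [ae_iff, measure_singleton]
  calc _ ≤ ∫⁻ z in Metric.ball x (2 * D + 1), (‖z - x‖ₑ ^ (1 - (d : ℝ))) ^ s := by
        refine lintegral_mono_set fun z hz => ?_
        have h1 := hD hz
        have h2 := hD hx
        rw [Metric.mem_closedBall, dist_eq_norm, sub_zero] at h1 h2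
        rw [Metric.mem_ball, dist_eq_norm]
        linarith [norm_sub_le z x]
    _ = ∫⁻ y in Metric.ball (0 : Rd d) (2 * D + 1), (‖y‖ₑ ^ (1 - (d : ℝ))) ^ s := by
        rw [← lintegral_indicator Metric.isOpen_ball.measurableSet,
          ← lintegral_indicator Metric.isOpen_ball.measurableSet,
          ← lintegral_sub_right_eq_self ((Metric.ball (0 : Rd d) (2 * D + 1)).indicator
            fun y => (‖y‖ₑ ^ (1 - (d : ℝ))) ^ s) x]
        refine lintegral_congr fun z => ?_
        by_cases hz : z ∈ Metric.ball x (2 * D + 1)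
        · rw [indicator_of_mem hz, indicator_of_mem]
          rwa [Metric.mem_ball, dist_eq_norm, sub_zero, ← dist_eq_norm]
        · rw [indicator_of_notMem hz, indicator_of_notMem]
          rwa [Metric.mem_ball, dist_eq_norm, sub_zero, ← dist_eq_norm]
    _ ≤ _ := by
        refine lintegral_mono_ae ?_
        filter_upwards [ae_restrict_of_ae hne] with y hy
        have hy' : 0 < ‖y‖ := norm_pos_iff.2 hy
        rw [← ENNReal.rpow_mul, Real.enorm_of_nonneg (by positivity), ← ofReal_norm y,
          ENNReal.ofReal_rpow_of_pos hy']
        apply le_of_eq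
        congr 2
        ring

theorem measurable_riesz : Measurable (Function.uncurry fun (z x : Rd d) =>
    ‖z - x‖ₑ ^ (1 - (d : ℝ))) := by
  exact (measurable_enorm.comp (measurable_fst.sub measurable_snd)).pow_const _

/-- Sobolev's inequality with a subcritical exponent on a `C²` domain. -/
theorem IsC2Domain.exists_sobolev_bound (hd : 2 ≤ d) (hΩ : IsC2Domain Ω) {r q : ℝ≥0∞}
    (hr : 1 ≤ r) (hrq : r ≤ q) (hq : q ≠ ⊤) (hrqd : 1 / r.toReal - 1 / q.toReal < 1 / d) :
    ∃ C : ℝ≥0∞, C ≠ ⊤ ∧ ∀ (F : Type) [NormedAddCommGroup F] [NormedSpace ℝ F] [CompleteSpace F]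
      (u : Rd d → F) (G : Rd d → Grad d F), HasWeakGrad Ω u G → MemLp u r (volume.restrict Ω) →
      MemLp G r (volume.restrict Ω) →
      eLpNorm u q (volume.restrict Ω)
        ≤ C * (eLpNorm u r (volume.restrict Ω) + eLpNorm G r (volume.restrict Ω)) := by
  have hd' : (2 : ℝ) ≤ d := by exact_mod_cast hd
  have hrt : r ≠ ⊤ := ne_top_of_le_ne_top hq hrq
  have hr0 : r ≠ 0 := (zero_lt_one.trans_le hr).ne'
  have hq0 : q ≠ 0 := (zero_lt_one.trans_le (hr.trans hrq)).ne'
  set r' := r.toReal with hr'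
  set q' := q.toReal with hq'
  have hr1 : 1 ≤ r' := by
    simpa using ENNReal.toReal_mono hrt hr
  have hrq1 : r' ≤ q' := ENNReal.toReal_mono hq hrq
  have hrpos : 0 < r' := by linarith
  have hqpos : 0 < q' := by linarith
  have hrqn : 0 ≤ 1 / r' - 1 / q' := sub_nonneg.2 (one_div_le_one_div_of_le hrpos hrq1)
  have hdinv : 1 / (d : ℝ) ≤ 1 / 2 := one_div_le_one_div_of_le (by norm_num) hd'
  -- Exponent dictated by Young's relation `1/r + 1/s = 1 + 1/q`; then `(d-1)s < d` is exactly the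
  -- subcriticality condition `1/r - 1/q < 1/d`.
  let s : ℝ := 1 / (1 - (1 / r' - 1 / q'))
  have hden : 0 < 1 - (1 / r' - 1 / q') := by linarith
  have hs : 0 < s := by positivity
  have hsd : ((d : ℝ) - 1) * s < d := by
    simp only [s]
    rw [mul_one_div, div_lt_iff₀ hden]
    have : (d : ℝ) * (1 / r' - 1 / q') < 1 := by
      calc (d : ℝ) * (1 / r' - 1 / q') < d * (1 / d) := by
            apply mul_lt_mul_of_pos_left hrqd (by linarith)
        _ = 1 := by field_simp
    linarith
  have hrqs : 1 / r' + 1 / s = 1 + 1 / q' := by simp only [s, one_div_one_div]; ring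
  obtain ⟨B, hB, hBx⟩ := exists_lintegral_riesz_le hd hΩ.bounded hsd
  obtain ⟨C, hC, hCu⟩ := hΩ.exists_riesz_bound hd
  have : IsFiniteMeasure (volume.restrict Ω) :=
    ⟨by rw [Measure.restrict_apply_univ]; exact hΩ.bounded.measure_lt_top⟩
  set μ : Measure (Rd d) := volume.restrict Ω with hμ
  let m : ℝ≥0∞ := μ univ
  have hmt : m ≠ ⊤ := measure_ne_top _ _
  let C1 : ℝ≥0∞ := m ^ (1 - 1 / r') * m ^ (1 / q')
  let C2 : ℝ≥0∞ := (B ^ (1 + q' * (1 - 1 / r'))) ^ (1 / q')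
  have hr1' : 0 ≤ 1 - 1 / r' := by
    rw [sub_nonneg, div_le_one hrpos]
    exact hr1
  have hC1 : C1 ≠ ⊤ := ENNReal.mul_ne_top (ENNReal.rpow_ne_top_of_nonneg hr1' hmt)
    (ENNReal.rpow_ne_top_of_nonneg (by positivity) hmt)
  have hC2 : C2 ≠ ⊤ := ENNReal.rpow_ne_top_of_nonneg (by positivity)
    (ENNReal.rpow_ne_top_of_nonneg (by positivity) hB)
  refine ⟨C * (C1 + C2), ENNReal.mul_ne_top hC (ENNReal.add_ne_top.2 ⟨hC1, hC2⟩), ?_⟩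
  intro F _ _ _ u G hG hu hGr
  have hui := (hu.mono_exponent hr).integrable le_rfl
  have hGi := (hGr.mono_exponent hr).integrable le_rfl
  have hpt := hCu F u G hG hui hGi
  let I : Rd d → ℝ≥0∞ := fun x => ∫⁻ z, ‖G z‖ₑ * ‖z - x‖ₑ ^ (1 - (d : ℝ)) ∂μ
  let N : ℝ≥0∞ := ∫⁻ z, ‖u z‖ₑ ∂μ
  have hIm : AEMeasurable I μ := by
    have h1 : AEMeasurable (Function.uncurry fun x z : Rd d => ‖G z‖ₑ * ‖z - x‖ₑ ^ (1 - (d : ℝ)))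
        (μ.prod μ) := by
      refine AEMeasurable.mul (f := fun p : Rd d × Rd d => ‖G p.2‖ₑ) ?_ ?_
      · exact hGr.aestronglyMeasurable.enorm.comp_snd
      · exact (measurable_riesz.comp measurable_swap).aemeasurable
    exact h1.lintegral_prod_right'
  have hIq : (∫⁻ x, I x ^ q' ∂μ) ^ (1 / q') ≤ C2 * eLpNorm G r μ := by
    have hΩae : ∀ᵐ x ∂μ, x ∈ Ω := ae_restrict_mem hΩ.isOpen.measurableSet
    have h1 := lintegral_rpow_lintegral_mul_le (μ := μ) measurable_riesz
      (hGr.aestronglyMeasurable.enorm) hr1 hrq1 hs hrqs (B := B)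
      (by filter_upwards [hΩae] with x hx using hBx x hx)
      (by
        filter_upwards [hΩae] with z hz
        refine le_trans (le_of_eq (lintegral_congr fun x => ?_)) (hBx z hz)
        rw [← enorm_neg, neg_sub])
    refine (ENNReal.rpow_le_rpow h1 (by positivity)).trans (le_of_eq ?_)
    rw [ENNReal.mul_rpow_of_nonneg _ _ (by positivity), 
      ← ENNReal.rpow_mul (∫⁻ z, _ ∂μ) _ (1 / q'), eLpNorm_eq_lintegral_rpow_enorm_toReal hr0 hrt]
    rw [← hr']
    have hexp : (1 + q' * (1 / r' - 1 / q')) * (1 / q') = 1 / r' := by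
      field_simp
      ring
    rw [hexp]
  have hN : N ≤ eLpNorm u r μ * m ^ (1 - 1 / r') := by
    have := eLpNorm_le_eLpNorm_mul_rpow_measure_univ hr hu.aestronglyMeasurable
    rw [eLpNorm_one_eq_lintegral_enorm] at this
    simpa using this
  rw [eLpNorm_eq_lintegral_rpow_enorm_toReal hq0 hq]
  calc (∫⁻ x, ‖u x‖ₑ ^ q' ∂μ) ^ (1 / q') ≤ (∫⁻ x, (C * (N + I x)) ^ q' ∂μ) ^ (1 / q') := by
        gcongr ?_ ^ (1 / q')
        refine lintegral_mono_ae ?_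
        filter_upwards [hpt] with x hx
        gcongr
    _ = C * (∫⁻ x, (N + I x) ^ q' ∂μ) ^ (1 / q') := by
        simp_rw [ENNReal.mul_rpow_of_nonneg _ _ hqpos.le]
        rw [lintegral_const_mul' _ _ (ENNReal.rpow_ne_top_of_nonneg hqpos.le hC),
          ENNReal.mul_rpow_of_nonneg _ _ (by positivity), ← ENNReal.rpow_mul,
          mul_one_div_cancel hqpos.ne', ENNReal.rpow_one]
    _ ≤ C * ((∫⁻ x, N ^ q' ∂μ) ^ (1 / q') + (∫⁻ x, I x ^ q' ∂μ) ^ (1 / q')) := by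
        gcongr
        exact ENNReal.lintegral_Lp_add_le aemeasurable_const hIm (hr1.trans hrq1)
    _ ≤ C * (C1 * eLpNorm u r μ + C2 * eLpNorm G r μ) := by
        gcongr
        rw [lintegral_const, ENNReal.mul_rpow_of_nonneg _ _ (by positivity), ← ENNReal.rpow_mul,
          mul_one_div_cancel hqpos.ne', ENNReal.rpow_one]
        calc N * m ^ (1 / q') ≤ eLpNorm u r μ * m ^ (1 - 1 / r') * m ^ (1 / q') := by gcongr
          _ = _ := by simp only [C1]; ring
    _ ≤ _ := by
        rw [mul_assoc C (C1 + C2)]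
        gcongr
        refine le_trans ?_ (mul_add _ _ _).ge
        exact add_le_add (mul_le_mul' le_self_add le_rfl) (mul_le_mul' le_add_self le_rfl)

end Sobolev


/-! ### Morrey's bound, embeddings, uniqueness of weak gradients and completeness. -/

section Embeddings

variable {d : ℕ} {Ω : Set (Rd d)}

theorem IsC2Domain.isFiniteMeasure (hΩ : IsC2Domain Ω) :
    IsFiniteMeasure (volume.restrict Ω) :=
  ⟨by rw [Measure.restrict_apply_univ]; exact hΩ.bounded.measure_lt_top⟩

/-- Morrey's bound on a `C²` domain. -/
theorem IsC2Domain.exists_sup_bound (hd : 2 ≤ d) (hΩ : IsC2Domain Ω) {p : ℝ≥0∞}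
    (hdp : (d : ℝ≥0∞) < p) (hp : p ≠ ⊤) :
    ∃ C : ℝ≥0∞, C ≠ ⊤ ∧ ∀ (F : Type) [NormedAddCommGroup F] [NormedSpace ℝ F] [CompleteSpace F]
      (u : Rd d → F) (G : Rd d → Grad d F), HasWeakGrad Ω u G → MemLp u p (volume.restrict Ω) →
      MemLp G p (volume.restrict Ω) → ∀ᵐ x ∂(volume.restrict Ω),
      ‖u x‖ₑ ≤ C * (eLpNorm u p (volume.restrict Ω) + eLpNorm G p (volume.restrict Ω)) := by
  have hd' : (2 : ℝ) ≤ d := by exact_mod_cast hd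
  have hdp' : (d : ℝ) < p.toReal := by
    have := (ENNReal.toReal_lt_toReal (ENNReal.natCast_ne_top d) hp).2 hdp
    simpa using this
  set p' := p.toReal with hp'
  have hp1 : 1 < p' := by linarith
  have h1p : 1 ≤ p := by
    rw [← ENNReal.ofReal_toReal hp, ← ENNReal.ofReal_one]
    exact ENNReal.ofReal_le_ofReal hp1.le
  -- For the conjugate exponent, `(d-1)s < d` is equivalent to `p > d`, so Hölder's inequality alone
  -- bounds the Riesz potential.
  let s : ℝ := p' / (p' - 1)
  have hconj : p'.HolderConjugate s := Real.HolderConjugate.conjExponent hp1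
  have hs : 0 < s := hconj.symm.pos
  have hsd : ((d : ℝ) - 1) * s < d := by
    simp only [s]
    rw [mul_div_assoc', div_lt_iff₀ (by linarith)]
    nlinarith
  obtain ⟨B, hB, hBx⟩ := exists_lintegral_riesz_le hd hΩ.bounded hsd
  obtain ⟨C, hC, hCu⟩ := hΩ.exists_riesz_bound hd
  have := hΩ.isFiniteMeasure
  set μ : Measure (Rd d) := volume.restrict Ω with hμ
  let C1 : ℝ≥0∞ := μ univ ^ (1 - 1 / p')
  let C2 : ℝ≥0∞ := B ^ (1 / s)
  have hC1 : C1 ≠ ⊤ := ENNReal.rpow_ne_top_of_nonneg (by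
    rw [sub_nonneg, div_le_one (by linarith)]
    exact hp1.le) (measure_ne_top _ _)
  have hC2 : C2 ≠ ⊤ := ENNReal.rpow_ne_top_of_nonneg (by positivity) hB
  refine ⟨C * (C1 + C2), ENNReal.mul_ne_top hC (ENNReal.add_ne_top.2 ⟨hC1, hC2⟩), ?_⟩
  intro F _ _ _ u G hG hu hGr
  have hN : ∫⁻ z, ‖u z‖ₑ ∂μ ≤ C1 * eLpNorm u p μ := by
    have := eLpNorm_le_eLpNorm_mul_rpow_measure_univ h1p hu.aestronglyMeasurable
    rw [eLpNorm_one_eq_lintegral_enorm] at this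
    rw [mul_comm]
    simpa [C1, hp'] using this
  filter_upwards [hCu F u G hG ((hu.mono_exponent h1p).integrable le_rfl)
    ((hGr.mono_exponent h1p).integrable le_rfl), ae_restrict_mem hΩ.isOpen.measurableSet]
    with x hx hxΩ
  have hI : ∫⁻ z, ‖G z‖ₑ * ‖z - x‖ₑ ^ (1 - (d : ℝ)) ∂μ ≤ C2 * eLpNorm G p μ := by
    have hm : Measurable fun z : Rd d => ‖z - x‖ₑ ^ (1 - (d : ℝ)) :=
      (measurable_enorm.comp (measurable_id.sub_const x)).pow_const _
    refine (ENNReal.lintegral_mul_le_Lp_mul_Lq μ hconj hGr.aestronglyMeasurable.enorm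
      hm.aemeasurable).trans ?_
    rw [eLpNorm_eq_lintegral_rpow_enorm_toReal (zero_lt_one.trans_le h1p).ne' hp, mul_comm]
    gcongr
    exact ENNReal.rpow_le_rpow (hBx x hxΩ) (by positivity)
  refine hx.trans ?_
  rw [mul_assoc C (C1 + C2)]
  gcongr
  refine (add_le_add hN hI).trans (le_trans ?_ (mul_add _ _ _).ge)
  exact add_le_add (mul_le_mul' le_self_add le_rfl) (mul_le_mul' le_add_self le_rfl)

variable {F : Type} [NormedAddCommGroup F] [NormedSpace ℝ F]

theorem W1.hasWeakGrad {q : ℝ≥0∞} [Fact (1 ≤ q)] (f : W1 Ω F q) : HasWeakGrad Ω f.fn f.grad := f.2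

/-- The Sobolev embedding as a bounded linear map. -/
theorem IsC2Domain.exists_embedding [CompleteSpace F] (hd : 2 ≤ d) (hΩ : IsC2Domain Ω)
    {r q : ℝ≥0∞} [Fact (1 ≤ r)] [Fact (1 ≤ q)]
    (hrq : r ≤ q) (hq : q ≠ ⊤) (hrqd : 1 / r.toReal - 1 / q.toReal < 1 / d) :
    ∃ J : W1 Ω F r →L[ℝ] LL Ω F q, ∀ f, J f =ᵐ[volume.restrict Ω] f.fn := by
  obtain ⟨C, hC, hb⟩ := hΩ.exists_sobolev_bound hd (Fact.out : 1 ≤ r) hrq hq hrqd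
  have hb' : ∀ f : W1 Ω F r, eLpNorm f.fn q (volume.restrict Ω)
      ≤ C * (eLpNorm f.fn r (volume.restrict Ω) + eLpNorm f.grad r (volume.restrict Ω)) :=
    fun f => hb F f.fn f.grad f.hasWeakGrad (Lp.memLp _) (Lp.memLp _)
  have hfin : ∀ f : W1 Ω F r, C * (eLpNorm f.fn r (volume.restrict Ω)
      + eLpNorm f.grad r (volume.restrict Ω)) ≠ ⊤ := fun f =>
    ENNReal.mul_ne_top hC (ENNReal.add_ne_top.2 ⟨Lp.eLpNorm_ne_top _, Lp.eLpNorm_ne_top _⟩)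
  have hmem : ∀ f : W1 Ω F r, MemLp f.fn q (volume.restrict Ω) := fun f =>
    ⟨Lp.aestronglyMeasurable _, (hb' f).trans_lt (hfin f).lt_top⟩
  refine ⟨LinearMap.mkContinuous
    { toFun := fun f => (hmem f).toLp f.fn
      map_add' := fun f g => ?_
      map_smul' := fun c f => ?_ } (C.toReal * 2) fun f => ?_, fun f => (hmem f).coeFn_toLp⟩
  · ext1
    filter_upwards [(hmem (f + g)).coeFn_toLp, (hmem f).coeFn_toLp, (hmem g).coeFn_toLp,
      Lp.coeFn_add ((hmem f).toLp f.fn) ((hmem g).toLp g.fn), Lp.coeFn_add f.fn g.fn]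
      with x h1 h2 h3 h4 h5
    rw [h1, h4, Pi.add_apply, h2, h3]
    exact h5
  · ext1
    filter_upwards [(hmem (c • f)).coeFn_toLp, (hmem f).coeFn_toLp,
      Lp.coeFn_smul c ((hmem f).toLp f.fn), Lp.coeFn_smul c f.fn] with x h1 h2 h3 h4
    rw [RingHom.id_apply, h1, h3, Pi.smul_apply, h2]
    exact h4
  · have h1 : ‖f.fn‖ ≤ ‖f‖ := norm_fst_le f.1
    have h2 : ‖f.grad‖ ≤ ‖f‖ := norm_snd_le f.1
    calc ‖(hmem f).toLp f.fn‖ = (eLpNorm f.fn q (volume.restrict Ω)).toReal := Lp.norm_toLp _ _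
      _ ≤ (C * (eLpNorm f.fn r (volume.restrict Ω)
          + eLpNorm f.grad r (volume.restrict Ω))).toReal := ENNReal.toReal_mono (hfin f) (hb' f)
      _ = C.toReal * (‖f.fn‖ + ‖f.grad‖) := by
        rw [ENNReal.toReal_mul, ENNReal.toReal_add (Lp.eLpNorm_ne_top _) (Lp.eLpNorm_ne_top _)]
        rfl
      _ ≤ C.toReal * 2 * ‖f‖ := by
        have : (0 : ℝ) ≤ C.toReal := ENNReal.toReal_nonneg
        nlinarith

/-- Weak gradients are unique up to null sets. -/
theorem HasWeakGrad.ae_eq [CompleteSpace F] (hΩ : IsOpen Ω) {u v : Rd d → F}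
    {G H : Rd d → Grad d F} (hu : HasWeakGrad Ω u G) (hv : HasWeakGrad Ω v H)
    (huv : u =ᵐ[volume.restrict Ω] v) : G =ᵐ[volume.restrict Ω] H := by
  have hi : ∀ i : Fin d, ∀ᵐ x ∂(volume.restrict Ω), G x i - H x i = 0 := by
    intro i
    rw [ae_restrict_iff' hΩ.measurableSet]
    have h1 := locInt_apply hu.locInt_grad i
    have h2 := locInt_apply hv.locInt_grad i
    refine hΩ.ae_eq_zero_of_integral_contDiff_smul_eq_zero (h1.sub h2) ?_
    intro ψ hψ hs hsub
    have i1 := integrable_test h1 hψ.continuous hs hsub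
    have i2 := integrable_test h2 hψ.continuous hs hsub
    have h3 : ∫ x, ψ x • (G x i - H x i) = ∫ x in Ω, ψ x • (G x i - H x i) := by
      refine (setIntegral_eq_integral_of_forall_compl_eq_zero fun x hx => ?_).symm
      rw [image_eq_zero_of_notMem_tsupport fun h => hx (hsub h), zero_smul]
    have h4 : ∫ x in Ω, fderiv ℝ ψ x (EuclideanSpace.single i 1) • u x
        = ∫ x in Ω, fderiv ℝ ψ x (EuclideanSpace.single i 1) • v x :=
      integral_congr_ae (by filter_upwards [huv] with x hx; rw [hx])
    rw [hu.parts ψ hψ hs hsub i, hv.parts ψ hψ hs hsub i, neg_inj] at h4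
    change ∫ x, ψ x • (G x i - H x i) = 0
    rw [h3]
    simp_rw [smul_sub]
    rw [integral_sub i1 i2, h4, sub_self]
  filter_upwards [ae_all_iff.2 hi] with x hx
  ext1 i
  exact sub_eq_zero.1 (hx i)

theorem weakGrad_ae_eq [CompleteSpace F] (hΩ : IsOpen Ω) {u v : Rd d → F} {G : Rd d → Grad d F}
    (hu : LocallyIntegrableOn u Ω) (hv : HasWeakGrad Ω v G) (huv : u =ᵐ[volume.restrict Ω] v) :
    weakGrad Ω u =ᵐ[volume.restrict Ω] G := by
  have h : ∃ G, HasWeakGrad Ω u G :=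
    ⟨G, hv.congr hu hv.locInt_grad huv.symm (ae_eq_refl _)⟩
  have h1 : HasWeakGrad Ω u (weakGrad Ω u) := by
    rw [weakGrad, dif_pos h]
    exact h.choose_spec
  exact h1.ae_eq hΩ hv huv

theorem W1.weakGrad_ae_eq [CompleteSpace F] (hΩ : IsOpen Ω) {q s : ℝ≥0∞} [Fact (1 ≤ q)]
    [Fact (1 ≤ s)] (f : W1 Ω F q) {u : LL Ω F s} (h : (f.fn : L0 Ω F) = u) :
    weakGrad Ω u =ᵐ[volume.restrict Ω] f.grad :=
  DamagePDE.weakGrad_ae_eq hΩ (locInt_Lp u) f.hasWeakGrad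
    (show (u : L0 Ω F) =ᵐ[volume.restrict Ω] (f.fn : L0 Ω F) by rw [h])

/-- Each integration-by-parts identity is a closed condition, since pairing with a test function is
continuous on `L²`. The resulting completeness is what Bochner integration of `H²`-valued curves
relies on. -/
theorem isClosed_W1sub [CompleteSpace F] [IsFiniteMeasure (volume.restrict Ω)] :
    IsClosed (W1sub Ω F 2 : Set (LL Ω F 2 × LL Ω (Grad d F) 2)) := by
  have hpair : ∀ (E : Type) [NormedAddCommGroup E] [NormedSpace ℝ E] [CompleteSpace E]
      (ψ : Rd d → ℝ) (_ : Continuous ψ) (_ : HasCompactSupport ψ),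
      Continuous fun f : LL Ω E 2 => ∫ x in Ω, ψ x • f x := by
    intro E _ _ _ ψ hψ hs
    have hm : MemLp ψ 2 (volume.restrict Ω) := hψ.memLp_of_hasCompactSupport hs
    have h1 : (fun f : LL Ω E 2 => ∫ x in Ω, ψ x • f x)
        = (ContinuousLinearMap.lsmul ℝ ℝ : ℝ →L[ℝ] E →L[ℝ] E).lpPairing (volume.restrict Ω) 2 2
          (hm.toLp ψ) := by
      ext f
      rw [ContinuousLinearMap.lpPairing_eq_integral]
      refine integral_congr_ae ?_
      filter_upwards [hm.coeFn_toLp] with x hx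
      rw [hx]
      rfl
    rw [h1]
    exact ContinuousLinearMap.continuous _
  have hset : (W1sub Ω F 2 : Set (LL Ω F 2 × LL Ω (Grad d F) 2))
      = ⋂ (ψ : Rd d → ℝ) (_ : ContDiff ℝ ∞ ψ) (_ : HasCompactSupport ψ) (_ : tsupport ψ ⊆ Ω)
        (i : Fin d), {f | ∫ x in Ω, fderiv ℝ ψ x (EuclideanSpace.single i 1) • f.1 x
          = - ∫ x in Ω, ψ x • f.2 x i} := by
    ext f
    simp only [mem_iInter, mem_ofPred_eq]
    exact ⟨fun h => h.parts, fun h => ⟨locInt_Lp _, locInt_Lp _, h⟩⟩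
  rw [hset]
  refine isClosed_iInter fun ψ => isClosed_iInter fun hψ => isClosed_iInter fun hs =>
    isClosed_iInter fun hsub => isClosed_iInter fun i => isClosed_eq ?_ (Continuous.neg ?_)
  · refine (hpair F (fun x => fderiv ℝ ψ x (EuclideanSpace.single i 1))
      ((hψ.continuous_fderiv (by simp)).clm_apply continuous_const) ?_).comp continuous_fst
    exact (hs.fderiv_apply (𝕜 := ℝ) _)
  · let π := PiLp.proj (𝕜 := ℝ) 2 (fun _ : Fin d => F) i
    have h2 : (fun f : LL Ω F 2 × LL Ω (Grad d F) 2 => ∫ x in Ω, ψ x • f.2 x i)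
        = fun f => π (∫ x in Ω, ψ x • f.2 x) := by
      ext f
      rw [← π.integral_comp_comm (integrable_test (locInt_Lp f.2) hψ.continuous hs hsub)]
      rfl
    rw [h2]
    exact π.continuous.comp ((hpair (Grad d F) ψ hψ.continuous hs).comp continuous_snd)

theorem completeSpace_W1 [CompleteSpace F] [IsFiniteMeasure (volume.restrict Ω)] :
    CompleteSpace (W1 Ω F 2) :=
  (isClosed_W1sub (Ω := Ω) (F := F)).completeSpace_coe

theorem completeSpace_H2 [CompleteSpace F] [IsFiniteMeasure (volume.restrict Ω)] :
    CompleteSpace (H2 Ω F) := by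
  have h1 := completeSpace_W1 (Ω := Ω) (F := F)
  have h2 := completeSpace_W1 (Ω := Ω) (F := Grad d F)
  have hcl : IsClosed (H2sub Ω F : Set (W1 Ω F 2 × W1 Ω (Grad d F) 2)) :=
    isClosed_eq (f := fun f : W1 Ω F 2 × W1 Ω (Grad d F) 2 => f.1.1.2)
      (g := fun f => f.2.1.1) (by fun_prop) (by fun_prop)
  exact hcl.completeSpace_coe

end Embeddings


/-! ## Time regularity of the displacement -/

section Displacement

variable {d : ℕ} {Ω : Set (Rd d)}

section Maps

variable {F : Type} [NormedAddCommGroup F] [NormedSpace ℝ F]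

noncomputable instance : NormedAddCommGroup (H2 Ω F) := Submodule.normedAddCommGroup _

noncomputable instance : NormedSpace ℝ (H2 Ω F) := Submodule.normedSpace _

/-- The function underlying an element of `H²`, as a bounded linear map. -/
noncomputable def H2.fnL : H2 Ω F →L[ℝ] LL Ω F 2 :=
  (ContinuousLinearMap.fst ℝ (LL Ω F 2) (LL Ω (Grad d F) 2)) ∘L (W1sub Ω F 2).subtypeL ∘L
    (ContinuousLinearMap.fst ℝ (W1 Ω F 2) (W1 Ω (Grad d F) 2)) ∘L (H2sub Ω F).subtypeL

/-- The gradient of an element of `H²`, as a bounded linear map into `H¹`. -/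
noncomputable def H2.gradL : H2 Ω F →L[ℝ] W1 Ω (Grad d F) 2 :=
  (ContinuousLinearMap.snd ℝ (W1 Ω F 2) (W1 Ω (Grad d F) 2)) ∘L (H2sub Ω F).subtypeL

theorem H2.fn_gradL (f : H2 Ω F) : (H2.gradL (Ω := Ω) (F := F) f).fn = f.1.1.grad := f.2.symm

end Maps

/-- A set of full measure meets every nondegenerate interval. Through continuity this upgrades
statements at almost every time to every time, endpoints included. -/
theorem mem_closure_of_ae {T : ℝ} (hT : 0 < T) {G : Set ℝ} (h : ∀ᵐ t ∂(timeMeasure T), t ∈ G)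
    {t : ℝ} (ht : t ∈ Icc 0 T) : t ∈ closure (G ∩ Ioc 0 T) := by
  rw [Metric.mem_closure_iff]
  intro ε hε
  by_contra! hcon
  rw [timeMeasure, ae_restrict_iff' measurableSet_Ioc] at h
  have h1 : volume (Ioo (max 0 (t - ε)) (min T (t + ε))) = 0 := by
    refine measure_mono_null ?_ (ae_iff.1 h)
    intro x hx
    rw [mem_Ioo, max_lt_iff, lt_min_iff] at hx
    simp only [mem_ofPred_eq, Classical.not_imp]
    refine ⟨⟨hx.1.1, hx.2.1.le⟩, fun hxG => ?_⟩
    have h2 := hcon x ⟨hxG, hx.1.1, hx.2.1.le⟩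
    rw [Real.dist_eq] at h2
    have : |t - x| < ε := abs_lt.2 ⟨by linarith [hx.2.2], by linarith [hx.1.2]⟩
    linarith
  rw [Real.volume_Ioo, ENNReal.ofReal_eq_zero, sub_nonpos, min_le_iff, le_max_iff, le_max_iff] at h1
  rcases h1 with (h1 | h1) | (h1 | h1) <;> linarith [ht.1, ht.2]

theorem exists_mem_of_ae {T : ℝ} (hT : 0 < T) {G : Set ℝ} (h : ∀ᵐ t ∂(timeMeasure T), t ∈ G) :
    ∃ t ∈ Ioc 0 T, t ∈ G := by
  obtain ⟨t, ht⟩ := closure_nonempty_iff.1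
    ⟨(0 : ℝ), mem_closure_of_ae hT h ⟨le_rfl, hT.le⟩⟩
  exact ⟨t, ht.2, ht.1⟩

/-- A continuous curve that lies in a closed set almost everywhere lies in it everywhere. -/
theorem mem_of_ae_mem_of_continuousOn {Y : Type*} [TopologicalSpace Y] {T : ℝ} (hT : 0 < T)
    {f : ℝ → Y} (hf : ContinuousOn f (Icc 0 T)) {A : Set Y} (hA : IsClosed A)
    (h : ∀ᵐ t ∂(timeMeasure T), f t ∈ A) {t : ℝ} (ht : t ∈ Icc 0 T) : f t ∈ A := by
  have h1 := mem_closure_of_ae hT (G := {t | f t ∈ A}) h ht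
  have hne := mem_closure_iff_nhdsWithin_neBot.1 h1
  refine hA.mem_of_tendsto (b := 𝓝[{t | f t ∈ A} ∩ Ioc 0 T] t) (f := f) ?_ ?_
  · exact (hf t ht).mono_left
      (nhdsWithin_mono _ (inter_subset_right.trans Ioc_subset_Icc_self))
  · filter_upwards [self_mem_nhdsWithin] with s hs using hs.1

theorem integrableOn_Ioc_of_memLp {E : Type*} [NormedAddCommGroup E] {T : ℝ} {g : ℝ → E}
    (hg : MemLp g 2 (timeMeasure T)) : IntegrableOn g (Ioc 0 T) :=
  hg.integrable one_le_two

/-- A curve with values in a larger space lifts to an absolutely continuous curve if one of its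
values and its derivative do. -/
theorem HasTimeDeriv.exists_lift {X Y : Type} [NormedAddCommGroup X] [NormedSpace ℝ X]
    [CompleteSpace X] [NormedAddCommGroup Y] [NormedSpace ℝ Y] [CompleteSpace Y] {T : ℝ}
    {u u' : ℝ → Y} (h : HasTimeDeriv T u u') (L : X →L[ℝ] Y) {V : ℝ → X}
    (hV : IntegrableOn V (Ioc 0 T)) (hVu : ∀ᵐ t ∂(timeMeasure T), L (V t) = u' t) {t0 : ℝ}
    (ht0 : t0 ∈ Icc 0 T) {x0 : X} (hx0 : L x0 = u t0) :
    ∃ U : ℝ → X, HasTimeDeriv T U V ∧ ∀ t ∈ Icc 0 T, L (U t) = u t := by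
  have h00 : (0 : ℝ) ∈ Icc 0 T := ⟨le_rfl, ht0.1.trans ht0.2⟩
  -- The primitive is anchored at `t0` rather than at `0`, because a lift of the value is given at
  -- `t0` and membership in the smaller space may be known only at almost every time.
  refine ⟨fun t => x0 + ∫ s in t0..t, V s, ⟨hV, fun t ht => ?_⟩, fun t ht => ?_⟩
  · rw [add_assoc, intervalIntegral.integral_add_adjacent_intervals]
    · exact intervalIntegrable_of_integrableOn_Ioc hV ht0 h00
    · exact intervalIntegrable_of_integrableOn_Ioc hV h00 ht
  · have h1 : ∫ s in t0..t, L (V s) = ∫ s in t0..t, u' s := by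
      refine intervalIntegral.integral_congr_ae ?_
      rw [timeMeasure, ae_restrict_iff' measurableSet_Ioc] at hVu
      filter_upwards [hVu] with r hr hmem
      rw [uIoc, mem_Ioc] at hmem
      exact hr ⟨(le_min ht0.1 ht.1).trans_lt hmem.1, hmem.2.trans (max_le ht0.2 ht.2)⟩
    rw [map_add, ← L.intervalIntegral_comp_comm (intervalIntegrable_of_integrableOn_Ioc hV ht0 ht),
      h1, hx0, ← h.sub_eq ht0 ht, add_sub_cancel]

variable {T : ℝ} {S : Triple Ω}

/-- The displacement is an absolutely continuous curve in `H²`. -/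
theorem Triple.RegU.exists_H2_curve (hΩ : IsC2Domain Ω) (hT : 0 < T) (h : S.RegU T) :
    ∃ U V : ℝ → H2 Ω (Rd d), HasTimeDeriv T U V ∧ MemLp V 2 (timeMeasure T) ∧
      (∀ t ∈ Icc 0 T, (U t).1.1.fn = S.u t) ∧
      ∀ᵐ t ∂(timeMeasure T), (V t).1.1 ∈ H10 Ω (Rd d) ∧ (V t).1.1.fn = S.ut t := by
  have := hΩ.isFiniteMeasure
  have hc := completeSpace_H2 (Ω := Ω) (F := Rd d)
  obtain ⟨V, hV, hVe⟩ := h.ut_H2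
  obtain ⟨U0, -, hU0⟩ := h.u_H2
  obtain ⟨t0, ht0, -, hut0⟩ := exists_mem_of_ae hT hU0
  have hVe' : ∀ᵐ t ∂(timeMeasure T), (V t).1.1 ∈ H10 Ω (Rd d) ∧ (V t).1.1.fn = S.ut t := by
    filter_upwards [hVe] with t ht using ⟨ht.1, Subtype.ext ht.2⟩
  obtain ⟨U, hU, hUu⟩ := h.deriv.exists_lift (X := H2 Ω (Rd d)) H2.fnL
    (V := V) (integrableOn_Ioc_of_memLp hV)
    (hVe'.mono fun t ht => ht.2) (Ioc_subset_Icc_self ht0) (x0 := U0 t0) (Subtype.ext hut0)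
  exact ⟨U, V, hU, hV, hUu, hVe'⟩

instance fact_one_le_four_ennreal : Fact ((1 : ℝ≥0∞) ≤ 4) := ⟨by norm_num⟩

/-- Products of two `L⁴` gradients lie in `L²`, the space in which the elastic density is paired
with `b(χ)`. -/
instance holderTriple_four_four_two : ENNReal.HolderTriple 4 4 2 := ⟨by
  rw [← ENNReal.toReal_eq_toReal_iff' (by simp) (by simp), ENNReal.toReal_add (by simp) (by simp)]
  norm_num⟩

/-- The displacement gradient is an absolutely continuous curve in `L⁴`. -/
theorem Triple.RegU.exists_grad_curve (hd : d = 2 ∨ d = 3) (hΩ : IsC2Domain Ω) (hT : 0 < T)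
    (h : S.RegU T) :
    ∃ P D : ℝ → LL Ω (Grad d (Rd d)) 4, HasTimeDeriv T P D ∧ MemLp D 2 (timeMeasure T) ∧
      (∀ t ∈ Icc 0 T, weakGrad Ω (S.u t) =ᵐ[volume.restrict Ω] P t) ∧
      ∀ᵐ t ∂(timeMeasure T), weakGrad Ω (S.ut t) =ᵐ[volume.restrict Ω] D t := by
  have := hΩ.isFiniteMeasure
  have hc := completeSpace_H2 (Ω := Ω) (F := Rd d)
  obtain ⟨U, V, hUV, hV, hU, hVu⟩ := h.exists_H2_curve hΩ hT
  -- The embedding of `H¹` into `L⁴` is subcritical because `1/2 - 1/4 < 1/d` for `d ≤ 3`.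
  obtain ⟨J, hJ⟩ := hΩ.exists_embedding (F := Grad d (Rd d)) (r := 2) (q := 4)
    (by omega) (by norm_num) (by simp) (by rcases hd with rfl | rfl <;> norm_num)
  let L : H2 Ω (Rd d) →L[ℝ] LL Ω (Grad d (Rd d)) 4 := J ∘L H2.gradL (Ω := Ω) (F := Rd d)
  have hL : ∀ (f : H2 Ω (Rd d)) (v : LL Ω (Rd d) 2), f.1.1.fn = v →
      weakGrad Ω v =ᵐ[volume.restrict Ω] L f := by
    intro f v hfv
    refine (f.1.1.weakGrad_ae_eq hΩ.isOpen (by rw [hfv])).trans ?_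
    rw [← H2.fn_gradL]
    exact (hJ (H2.gradL (Ω := Ω) (F := Rd d) f)).symm
  refine ⟨fun t => L (U t), fun t => L (V t), hUV.clm_comp L, L.comp_memLp' hV, ?_, ?_⟩
  · exact fun t ht => hL _ _ (hU t ht)
  · filter_upwards [hVu] with t ht using hL _ _ ht.2

/-- The trace of a displacement gradient, as a bounded linear functional. -/
noncomputable def divgL (d : ℕ) : Grad d (Rd d) →L[ℝ] ℝ :=
  ∑ i, (PiLp.proj (𝕜 := ℝ) 2 (fun _ : Fin d => ℝ) i) ∘L
    (PiLp.proj (𝕜 := ℝ) 2 (fun _ : Fin d => Rd d) i)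

theorem divgL_apply (A : Grad d (Rd d)) : divgL d A = divg A := by
  simp only [divgL, divg, _root_.sum_apply]
  rfl

/-- An entry of the symmetric part of a displacement gradient, as a bounded linear functional. -/
noncomputable def strainL (i j : Fin d) : Grad d (Rd d) →L[ℝ] ℝ :=
  (2⁻¹ : ℝ) • ((PiLp.proj (𝕜 := ℝ) 2 (fun _ : Fin d => ℝ) j) ∘L
      (PiLp.proj (𝕜 := ℝ) 2 (fun _ : Fin d => Rd d) i)
    + (PiLp.proj (𝕜 := ℝ) 2 (fun _ : Fin d => ℝ) i) ∘L
      (PiLp.proj (𝕜 := ℝ) 2 (fun _ : Fin d => Rd d) j))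

theorem strainL_apply (i j : Fin d) (A : Grad d (Rd d)) : strainL i j A = strain A i j := by
  rw [strain, div_eq_inv_mul]
  rfl

/-- The density of the elasticity form as a bounded bilinear map. -/
noncomputable def Model.elastL (M : Model d) : Grad d (Rd d) →L[ℝ] Grad d (Rd d) →L[ℝ] ℝ :=
  M.lam1 • (ContinuousLinearMap.mul ℝ ℝ).bilinearComp (divgL d) (divgL d)
    + (2 * M.lam2) • ∑ i, ∑ j,
      (ContinuousLinearMap.mul ℝ ℝ).bilinearComp (strainL i j) (strainL i j)

theorem Model.elastL_apply (M : Model d) (A B : Grad d (Rd d)) :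
    M.elastL A B = M.elast A B := by
  simp only [Model.elastL, Model.elast, _root_.add_apply,
    _root_.smul_apply, _root_.sum_apply,
    ContinuousLinearMap.bilinearComp_apply, ContinuousLinearMap.mul_apply', divgL_apply,
    strainL_apply, smul_eq_mul, mul_assoc]

theorem Model.elast_comm (M : Model d) (A B : Grad d (Rd d)) : M.elast A B = M.elast B A := by
  simp only [Model.elast, mul_comm (strain A _ _)]
  ring

/-- The elastic energy density is an absolutely continuous curve in `L²`. -/
theorem Triple.RegU.exists_elast_curve (hd : d = 2 ∨ d = 3) (hΩ : IsC2Domain Ω) (hT : 0 < T)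
    (h : S.RegU T) (M : Model d) :
    ∃ Q R : ℝ → LL Ω ℝ 2, HasTimeDeriv T Q ((2 : ℝ) • R) ∧
      (∀ t ∈ Icc 0 T, Q t =ᵐ[volume.restrict Ω]
        fun x => M.elast (weakGrad Ω (S.u t) x) (weakGrad Ω (S.u t) x)) ∧
      ∀ᵐ t ∂(timeMeasure T), R t =ᵐ[volume.restrict Ω]
        fun x => M.elast (weakGrad Ω (S.u t) x) (weakGrad Ω (S.ut t) x) := by
  obtain ⟨P, D, hPD, -, hP, hD⟩ := h.exists_grad_curve hd hΩ hT
  let B := M.elastL.holderL (volume.restrict Ω) 4 4 2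
  have hB : ∀ f g : LL Ω (Grad d (Rd d)) 4, B f g =ᵐ[volume.restrict Ω]
      fun x => M.elast (f x) (g x) := fun f g => by
    filter_upwards [M.elastL.coeFn_holder (r := 2) f g] with x hx
    rw [← M.elastL_apply]
    exact hx
  have hcomm : ∀ f g, B f g = B g f := by
    intro f g
    ext1
    filter_upwards [hB f g, hB g f] with x h1 h2
    rw [h1, h2, M.elast_comm]
  refine ⟨fun t => B (P t) (P t), fun t => B (P t) (D t), ?_, ?_, ?_⟩
  · refine (hPD.bilin hPD B).congr_deriv (Eventually.of_forall fun t => ?_)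
    rw [hcomm (D t), ← two_smul ℝ]
    rfl
  · intro t ht
    filter_upwards [hB (P t) (P t), hP t ht] with x h1 h2
    rw [h1, h2]
  · filter_upwards [hD, ae_restrict_mem measurableSet_Ioc] with t ht htT
    filter_upwards [hB (P t) (D t), hP t (Ioc_subset_Icc_self htT), ht] with x h1 h2 h3
    rw [h1, h2, h3]

end Displacement

/-! ## Functions of the phase parameter -/

section Phase

/-- A `C²` function agrees on a bounded interval with a function whose derivative is bounded and
Lipschitz. -/
theorem exists_clamped {b : ℝ → ℝ} (hb : ContDiff ℝ 2 b) {C : ℝ} (hC : 0 ≤ C) :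
    ∃ (β β' : ℝ → ℝ) (K L : ℝ≥0), (∀ x, HasDerivAt β (β' x) x) ∧ (∀ x, |β' x| ≤ K) ∧
      LipschitzWith L β' ∧ ∀ x, |x| ≤ C → β x = b x ∧ β' x = deriv b x := by
  -- The cutoff equals one up to `C + 1`, so the two functions agree near every point with `|x| ≤
  -- C`, and so do their derivatives, also at `|x| = C`.
  let ψ : ContDiffBump (0 : ℝ) := ⟨C + 1, C + 2, by linarith, by linarith⟩
  let β : ℝ → ℝ := fun x => ψ x * b x
  have hβ : ContDiff ℝ 2 β := ψ.contDiff.mul hb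
  have hs : HasCompactSupport β := ψ.hasCompactSupport.mul_right
  have hβ' : ContDiff ℝ 1 (deriv β) := hβ.deriv' 
  obtain ⟨K, hK⟩ := hβ'.continuous.bounded_above_of_compact_support hs.deriv
  obtain ⟨L, hL⟩ := hβ'.lipschitzWith_of_hasCompactSupport hs.deriv one_ne_zero
  refine ⟨β, deriv β, K.toNNReal, L,
    fun x => (hβ.differentiable two_ne_zero x).hasDerivAt,
    fun x => (hK x).trans (Real.le_coe_toNNReal K), hL, fun x hx => ?_⟩
  have hnear : β =ᶠ[𝓝 x] b := by
    have hx' : x ∈ Metric.ball (0 : ℝ) (C + 1) := by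
      rw [mem_ball_zero_iff, Real.norm_eq_abs]
      linarith
    filter_upwards [Metric.isOpen_ball.mem_nhds hx'] with y hy
    simp only [β]
    rw [ψ.one_of_mem_closedBall (Metric.ball_subset_closedBall hy), one_mul]
  exact ⟨hnear.eq_of_nhds, hnear.deriv_eq⟩

/-- The set consists of the fixed points of truncation to `[-C, C]`, a Lipschitz operator on `L²`.
-/
theorem isClosed_setOf_abs_le {X : Type*} [MeasurableSpace X] {μ : Measure X} [IsFiniteMeasure μ]
    {C : ℝ} (hC : 0 ≤ C) : IsClosed {f : Lp ℝ 2 μ | ∀ᵐ x ∂μ, |f x| ≤ C} := by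
  let c : ℝ → ℝ := fun x => (projIcc (-C) C (by linarith) x : ℝ)
  have hc : LipschitzWith 1 c := LipschitzWith.projIcc _
  have hset : {f : Lp ℝ 2 μ | ∀ᵐ x ∂μ, |f x| ≤ C} = {f | nemytskii μ 2 hc f = f} := by
    ext f
    constructor
    · intro hf
      ext1
      filter_upwards [coeFn_nemytskii hc f, hf] with x h1 h2
      rw [h1]
      exact congrArg Subtype.val (projIcc_of_mem _ (abs_le.1 h2))
    · intro hf
      have h1 := coeFn_nemytskii hc f
      have hf' : nemytskii μ 2 hc f = f := hf
      rw [hf'] at h1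
      filter_upwards [h1] with x hx
      rw [hx]
      exact abs_le.2 (projIcc (-C) C _ (f x)).2
  rw [hset]
  exact isClosed_eq (lipschitzWith_nemytskii hc).continuous continuous_id

variable {d : ℕ} {Ω : Set (Rd d)} {T : ℝ} {S : Triple Ω} {p : ℝ≥0∞} [Fact (1 ≤ p)]

/-- Since `p > d`, Morrey's bound turns `L^∞(0,T; W^{1,p})` into a sup bound at almost every time.
Continuity in `L²` extends it to every time, because the bound is a closed condition. -/
theorem Triple.RegChi.exists_bound (hd : 2 ≤ d) (hΩ : IsC2Domain Ω) (hT : 0 < T)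
    (hdp : (d : ℝ≥0∞) < p) (hp : p ≠ ⊤) (h : S.RegChi T p) :
    ∃ C : ℝ, 0 ≤ C ∧ ∀ t ∈ Icc 0 T, ∀ᵐ x ∂(volume.restrict Ω), |S.chi t x| ≤ C := by
  have := hΩ.isFiniteMeasure
  obtain ⟨g, hg, hge⟩ := h.sobolev
  obtain ⟨C, hC, hb⟩ := hΩ.exists_sup_bound hd hdp hp
  let N : ℝ := (eLpNorm g ⊤ (timeMeasure T)).toReal
  let A : ℝ := (C * (ENNReal.ofReal N + ENNReal.ofReal N)).toReal
  refine ⟨A, ENNReal.toReal_nonneg, fun t ht => ?_⟩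
  refine mem_of_ae_mem_of_continuousOn hT h.deriv.continuousOn
    (isClosed_setOf_abs_le (μ := volume.restrict Ω) (C := A) ENNReal.toReal_nonneg) ?_ ht
  have hN : ∀ᵐ t ∂(timeMeasure T), ‖g t‖ ≤ N := by
    filter_upwards [ae_le_eLpNormEssSup (f := g) (μ := timeMeasure T)] with t ht
    have := ENNReal.toReal_mono (by simpa using hg.2.ne) ht
    simpa [N] using this
  filter_upwards [hN, hge] with t htN hgt
  have e1 : S.chi t =ᵐ[volume.restrict Ω] (g t).fn := by
    rw [show (S.chi t : Rd d → ℝ) = (g t).fn from congrArg (fun f : L0 Ω ℝ => (f : Rd d → ℝ))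
      hgt.symm]
  have hn : ∀ {E : Type} [NormedAddCommGroup E] (f : LL Ω E p), ‖f‖ ≤ N →
      eLpNorm f p (volume.restrict Ω) ≤ ENNReal.ofReal N := by
    intro E _ f hf
    rw [← ENNReal.ofReal_toReal (Lp.eLpNorm_ne_top f)]
    exact ENNReal.ofReal_le_ofReal hf
  filter_upwards [hb ℝ (g t).fn (g t).grad (g t).hasWeakGrad (Lp.memLp _) (Lp.memLp _), e1]
    with x hx hx1
  rw [hx1]
  have h1 := hx.trans (mul_le_mul' (le_refl C) (add_le_add (hn _ ((norm_fst_le (g t).1).trans htN))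
    (hn _ ((norm_snd_le (g t).1).trans htN))))
  have h2 := ENNReal.toReal_mono (ENNReal.mul_ne_top hC (by simp)) h1
  simpa [A] using h2

/-- Chain rule for a `C²` function of the phase parameter. -/
theorem Triple.RegChi.exists_comp_curve (hd : 2 ≤ d) (hΩ : IsC2Domain Ω) (hT : 0 < T)
    (hdp : (d : ℝ≥0∞) < p) (hp : p ≠ ⊤) (h : S.RegChi T p) {b : ℝ → ℝ} (hb : ContDiff ℝ 2 b) :
    ∃ B E : ℝ → LL Ω ℝ 2, HasTimeDeriv T B E ∧
      (∀ t ∈ Icc 0 T, B t =ᵐ[volume.restrict Ω] fun x => b (S.chi t x)) ∧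
      ∀ᵐ t ∂(timeMeasure T), E t =ᵐ[volume.restrict Ω]
        fun x => _root_.deriv b (S.chi t x) * S.chit t x := by
  have := hΩ.isFiniteMeasure
  obtain ⟨C, hC0, hC⟩ := h.exists_bound hd hΩ hT hdp hp
  -- Only values in `[-C, C]` occur, so `b` may be replaced by a function with bounded Lipschitz
  -- derivative.
  obtain ⟨β, β', K, L, h1, h2, h3, h4⟩ := exists_clamped hb hC0
  obtain ⟨E, hE, -, hBE⟩ := h.deriv.nemytskii_comp h1 h2 h3
  refine ⟨_, E, hBE, fun t ht => ?_, ?_⟩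
  · filter_upwards [coeFn_nemytskii (lipschitzWith_of_abs_deriv_le h1 h2) (S.chi t), hC t ht]
      with x e1 e2
    rw [e1, (h4 _ e2).1]
  · filter_upwards [hE, ae_restrict_mem measurableSet_Ioc] with t e1 ht
    filter_upwards [e1, hC t (Ioc_subset_Icc_self ht)] with x e2 e3
    rw [e2, (h4 _ e3).2]

/-- Products of the derivative of a `C²` function of the phase parameter with square integrable
functions. -/
theorem Triple.RegChi.exists_deriv_mul (hd : 2 ≤ d) (hΩ : IsC2Domain Ω) (hT : 0 < T)
    (hdp : (d : ℝ≥0∞) < p) (hp : p ≠ ⊤) (h : S.RegChi T p) {b : ℝ → ℝ} (hb : ContDiff ℝ 2 b)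
    {g : ℝ → LL Ω ℝ 2} (hg : MemLp g 2 (timeMeasure T)) :
    ∃ E : ℝ → LL Ω ℝ 2, MemLp E 2 (timeMeasure T) ∧
      ∀ᵐ t ∂(timeMeasure T), E t =ᵐ[volume.restrict Ω]
        fun x => _root_.deriv b (S.chi t x) * g t x := by
  have := hΩ.isFiniteMeasure
  obtain ⟨C, hC0, hC⟩ := h.exists_bound hd hΩ hT hdp hp
  obtain ⟨β, β', K, L, h1, h2, h3, h4⟩ := exists_clamped hb hC0
  obtain ⟨E, hEm, hE, hEn⟩ := exists_bounded_mul h.deriv.aestronglyMeasurable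
    hg.aestronglyMeasurable h2 h3
  refine ⟨E, hg.of_le_mul hEm hEn, ?_⟩
  filter_upwards [hE, ae_restrict_mem measurableSet_Ioc] with t e1 ht
  filter_upwards [e1, hC t (Ioc_subset_Icc_self ht)] with x e2 e3
  rw [e2, (h4 _ e3).2]

end Phase


/-! ## The temperature -/

section Temperature

variable {d : ℕ} {M : Model d}

theorem Model.heat_intervalIntegrable (hH : HypHeat d M.heat) {a b : ℝ} (ha : 0 ≤ a) (hb : 0 ≤ b) :
    IntervalIntegrable M.heat volume a b :=
  (hH.1.mono fun _ hx => (le_min ha hb).trans hx.1).intervalIntegrable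

theorem Model.h_sub (hH : HypHeat d M.heat) {a b : ℝ} (ha : 0 ≤ a) (hb : 0 ≤ b) :
    M.h b - M.h a = ∫ s in a..b, M.heat s :=
  intervalIntegral.integral_interval_sub_left (Model.heat_intervalIntegrable hH le_rfl hb)
    (Model.heat_intervalIntegrable hH le_rfl ha)

theorem Model.h_zero : M.h 0 = 0 := intervalIntegral.integral_same

/-- The temperature is a Lipschitz function of the enthalpy, of subcritical growth. -/
theorem Model.exists_temperature_bounds (hd : 2 ≤ d) (hH : HypHeat d M.heat) :
    ∃ (L : ℝ≥0) (k m : ℝ), LipschitzWith L M.Θ ∧ 0 ≤ k ∧ m < ((d : ℝ) + 2) / d ∧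
      (∀ w, 0 ≤ M.Θ w) ∧ ∀ w, M.Θ w ^ 2 ≤ (1 + k * |w|) ^ m := by
  obtain ⟨σ1, σ, c1, c0, hσ, -, hc0, -, hgr⟩ := hH.2
  have hd' : (2 : ℝ) ≤ d := by exact_mod_cast hd
  -- For `d ≥ 2` one has `2d/(d+2) ≥ 1`. Hence the heat capacity is at least `c0`, the enthalpy `h`
  -- is expanding, and its inverse is Lipschitz.
  have hσ1 : 1 < σ := by
    refine lt_of_le_of_lt ?_ hσ
    rw [le_div_iff₀ (by linarith)]
    linarith
  have hpow : ∀ a b : ℝ, 0 ≤ a → a ≤ b →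
      c0 / σ * ((1 + b) ^ σ - (1 + a) ^ σ) ≤ M.h b - M.h a := by
    intro a b ha hab
    have hderiv : ∀ x ∈ uIcc a b, HasDerivAt (fun s : ℝ => c0 / σ * (1 + s) ^ σ)
        (c0 * (1 + x) ^ (σ - 1)) x := by
      intro x hx
      rw [uIcc_of_le hab] at hx
      have h1 := (((hasDerivAt_id x).const_add 1).rpow_const (p := σ)
        (Or.inr hσ1.le)).const_mul (c0 / σ)
      refine h1.congr_deriv ?_
      field_simp
      rfl
    have hcont : ContinuousOn (fun s : ℝ => c0 * (1 + s) ^ (σ - 1)) (uIcc a b) := by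
      refine continuousOn_const.mul (ContinuousOn.rpow_const (by fun_prop) fun x hx => ?_)
      exact Or.inr (by linarith)
    have h1 := intervalIntegral.integral_eq_sub_of_hasDerivAt hderiv hcont.intervalIntegrable
    rw [mul_sub, ← h1, Model.h_sub hH ha (ha.trans hab)]
    refine intervalIntegral.integral_mono_on hab hcont.intervalIntegrable
      (Model.heat_intervalIntegrable hH ha (ha.trans hab)) fun x hx => ?_
    exact (hgr x (ha.trans hx.1)).1
  have hlin : ∀ a b : ℝ, 0 ≤ a → a ≤ b → c0 * (b - a) ≤ M.h b - M.h a := by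
    intro a b ha hab
    rw [Model.h_sub hH ha (ha.trans hab)]
    have h1 : ∫ s in a..b, c0 = c0 * (b - a) := by
      rw [intervalIntegral.integral_const, smul_eq_mul, mul_comm]
    rw [← h1]
    refine intervalIntegral.integral_mono_on hab (by simp)
      (Model.heat_intervalIntegrable hH ha (ha.trans hab)) fun x hx => ?_
    have hx0 : 0 ≤ x := ha.trans hx.1
    refine le_trans ?_ (hgr x hx0).1
    have : (1 : ℝ) ≤ (1 + x) ^ (σ - 1) := Real.one_le_rpow (by linarith) (by linarith)
    nlinarith
  have hsurj : ∀ w, 0 ≤ w → ∃ r ∈ Ici (0 : ℝ), M.h r = w := by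
    intro w hw
    have hcont : ContinuousOn M.h (Icc 0 (w / c0)) := by
      have := intervalIntegral.continuousOn_primitive_interval (μ := volume) (f := M.heat) (a := 0)
        (b := w / c0) ((hH.1.mono fun x hx => by
          rw [uIcc_of_le (by positivity)] at hx
          exact hx.1).integrableOn_compact isCompact_uIcc)
      rwa [uIcc_of_le (by positivity)] at this
    have h2 := hlin 0 (w / c0) le_rfl (by positivity)
    rw [Model.h_zero, sub_zero, sub_zero, mul_div_cancel₀ _ hc0.ne'] at h2
    obtain ⟨r, hr, hrw⟩ := intermediate_value_Icc (show 0 ≤ w / c0 by positivity) hcont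
      ⟨by rwa [Model.h_zero], h2⟩
    exact ⟨r, hr.1, hrw⟩
  have hΘ : ∀ w, 0 ≤ M.Θ w ∧ M.h (M.Θ w) = max w 0 := by
    intro w
    by_cases hw : 0 ≤ w
    · rw [Model.Θ, if_pos hw, max_eq_left hw]
      exact ⟨Function.invFunOn_mem (hsurj w hw), Function.invFunOn_eq (hsurj w hw)⟩
    · rw [Model.Θ, if_neg hw, max_eq_right (not_le.1 hw).le]
      exact ⟨le_rfl, Model.h_zero⟩
  have hLip : ∀ v w, M.Θ v ≤ M.Θ w → M.Θ w - M.Θ v ≤ c0⁻¹ * |w - v| := by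
    intro v w hvw
    have h1 := hlin _ _ (hΘ v).1 hvw
    rw [(hΘ v).2, (hΘ w).2] at h1
    rw [le_inv_mul_iff₀ hc0]
    refine h1.trans ((le_abs_self _).trans ?_)
    simpa using abs_max_sub_max_le_abs w v 0
  -- Integrating the lower growth bound gives `(1 + Θ)^σ ≤ 1 + (σ/c0)|w|`, hence `k = σ / c0` and `m
  -- = 2 / σ`; `m < (d+2)/d` restates `σ > 2d/(d+2)`.
  refine ⟨c0⁻¹.toNNReal, σ / c0, 2 / σ, LipschitzWith.of_dist_le_mul fun v w => ?_,
    by positivity, ?_, fun w => (hΘ w).1, fun w => ?_⟩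
  · rw [Real.coe_toNNReal _ (by positivity), Real.dist_eq, Real.dist_eq]
    rcases le_total (M.Θ v) (M.Θ w) with h | h
    · rw [abs_sub_comm, abs_of_nonneg (sub_nonneg.2 h), abs_sub_comm v]
      exact hLip _ _ h
    · rw [abs_of_nonneg (sub_nonneg.2 h)]
      exact hLip _ _ h
  · rw [div_lt_div_iff₀ (by positivity) (by positivity)]
    rw [div_lt_iff₀ (by positivity)] at hσ
    linarith
  · have h1 := hpow 0 (M.Θ w) le_rfl (hΘ w).1
    rw [(hΘ w).2, Model.h_zero, sub_zero, add_zero, Real.one_rpow] at h1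
    have h2 : (1 + M.Θ w) ^ σ ≤ 1 + σ / c0 * |w| := by
      have h3 : max w 0 ≤ |w| := max_le (le_abs_self w) (abs_nonneg w)
      have h4 := h1.trans h3
      rw [div_mul_eq_mul_div, div_le_iff₀ (by positivity)] at h4
      rw [div_mul_eq_mul_div, ← sub_le_iff_le_add', le_div_iff₀ hc0]
      linarith
    calc M.Θ w ^ 2 ≤ (1 + M.Θ w) ^ 2 := by
          have := (hΘ w).1
          gcongr
          linarith
      _ = ((1 + M.Θ w) ^ σ) ^ (2 / σ) := by
          have := (hΘ w).1
          rw [← Real.rpow_mul (by positivity), mul_div_cancel₀ _ (by positivity), Real.rpow_ofNat]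
      _ ≤ _ := Real.rpow_le_rpow (by have := (hΘ w).1; positivity) h2 (by positivity)

end Temperature


/-! ### Square integrability of the temperature by interpolation. -/

section TemperatureCurve

/-- Minkowski's inequality for `1 + k|f|` in `L^s`. -/
theorem lintegral_ofReal_one_add_rpow_le {X : Type*} [MeasurableSpace X] {μ : Measure X}
    {f : X → ℝ} (hf : AEStronglyMeasurable f μ) {k s : ℝ} (hk : 0 ≤ k) (hs : 1 ≤ s) :
    (∫⁻ x, ENNReal.ofReal (1 + k * |f x|) ^ s ∂μ) ^ (1 / s)
      ≤ μ univ ^ (1 / s) + ENNReal.ofReal k * eLpNorm f (ENNReal.ofReal s) μ := by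
  have hs0 : ENNReal.ofReal s ≠ 0 := by
    rw [Ne, ENNReal.ofReal_eq_zero, not_le]
    linarith
  have hs1 : 1 ≤ ENNReal.ofReal s := by
    rw [← ENNReal.ofReal_one]
    exact ENNReal.ofReal_le_ofReal hs
  have hsr : (ENNReal.ofReal s).toReal = s := ENNReal.toReal_ofReal (by linarith)
  have h1 : (∫⁻ x, ENNReal.ofReal (1 + k * |f x|) ^ s ∂μ) ^ (1 / s)
      = eLpNorm ((fun _ => (1 : ℝ)) + k • fun x => ‖f x‖) (ENNReal.ofReal s) μ := by
    rw [eLpNorm_eq_lintegral_rpow_enorm_toReal hs0 ENNReal.ofReal_ne_top, hsr]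
    congr 1
    refine lintegral_congr fun x => ?_
    rw [Real.enorm_of_nonneg]
    · rfl
    · change 0 ≤ 1 + k * ‖f x‖
      positivity
  rw [h1]
  refine (eLpNorm_add_le aestronglyMeasurable_const (hf.norm.const_smul k) hs1).trans
    (add_le_add ?_ ?_)
  · by_cases hμ : μ = 0
    · simp [hμ]
    · rw [eLpNorm_const _ hs0 hμ, hsr]
      simp
  · rw [eLpNorm_const_smul, eLpNorm_norm, Real.enorm_of_nonneg hk]

theorem memLp_two_of_enorm_rpow_le {E X : Type*} [NormedAddCommGroup E] [MeasurableSpace X]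
    {ν : Measure X} {r : ℝ} (hr : 0 < r) {θ : X → E} (hθ : AEStronglyMeasurable θ ν) {b : X → ℝ}
    (hb : MemLp b (ENNReal.ofReal r) ν) {A : ℝ≥0∞} (hA : A ≠ ⊤)
    (h : ∀ᵐ t ∂ν, ‖θ t‖ₑ ^ (2 : ℝ) ≤ A * ‖b t‖ₑ ^ r) : MemLp θ 2 ν := by
  refine ⟨hθ, ?_⟩
  rw [eLpNorm_lt_top_iff_lintegral_rpow_enorm_lt_top (by simp) (by simp), ENNReal.toReal_ofNat]
  refine (lintegral_mono_ae h).trans_lt ?_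
  rw [lintegral_const_mul' _ _ hA]
  have h1 := (eLpNorm_lt_top_iff_lintegral_rpow_enorm_lt_top
    (by rw [Ne, ENNReal.ofReal_eq_zero, not_le]; exact hr) ENNReal.ofReal_ne_top).1 hb.2
  rw [ENNReal.toReal_ofReal hr.le] at h1
  exact ENNReal.mul_lt_top hA.lt_top h1

variable {d : ℕ} {Ω : Set (Rd d)} {T : ℝ} {S : Triple Ω} {M : Model d}

/-- The exponents for the interpolation between `L^∞(0,T; L¹)` and `L^r(0,T; W^{1,r})`. -/
theorem exists_interpolation_exponents (hd : 2 ≤ d) {m0 : ℝ}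
    (hm0d : m0 < ((d : ℝ) + 2) / d) :
    ∃ r q m : ℝ, 1 < r ∧ r < ((d : ℝ) + 2) / (d + 1) ∧ r ≤ q ∧ 1 / r - 1 / q < 1 / d ∧ m0 ≤ m ∧
      m = 1 - r / q + r ∧ r / q ≤ 1 := by
  have hd' : (2 : ℝ) ≤ d := by exact_mod_cast hd
  -- The exponent `r` is taken close enough to `(d+2)/(d+1)` that `m0 d < r(d+1)`. With `m = max m0
  -- r` the relation `m = 1 - r/q + r` fixes `q`: subcriticality becomes `m d < r(d+1)`, and `m ≥ r`
  -- gives `r ≤ q`.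
  have hlo : max 1 (m0 * d / (d + 1)) < ((d : ℝ) + 2) / (d + 1) := by
    rw [max_lt_iff, lt_div_iff₀ (by positivity), div_lt_div_iff_of_pos_right (by positivity)]
    rw [lt_div_iff₀ (by positivity)] at hm0d
    exact ⟨by linarith, hm0d⟩
  obtain ⟨r, hr1, hr2⟩ := exists_between hlo
  rw [max_lt_iff] at hr1
  obtain ⟨hr1, hrm⟩ := hr1
  have hr0 : 0 < r := by linarith
  rw [div_lt_iff₀ (by positivity)] at hrm
  have hmd : max m0 r * d < r * (d + 1) := by
    rcases max_choice m0 r with h | h <;> rw [h] <;> nlinarith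
  have hrd : r < d := by
    refine hr2.trans ?_
    rw [div_lt_iff₀ (by positivity)]
    nlinarith
  have hrm' : r ≤ max m0 r := le_max_right _ _
  have hpos : 0 < 1 + r - max m0 r := by nlinarith
  have hq : r / (r / (1 + r - max m0 r)) = 1 + r - max m0 r := by
    field_simp
  refine ⟨r, r / (1 + r - max m0 r), max m0 r, hr1, hr2, ?_, ?_, le_max_left _ _, ?_, ?_⟩
  · rw [le_div_iff₀ hpos]
    nlinarith
  · rw [one_div_div, ← sub_div, div_lt_div_iff₀ hr0 (by positivity)]
    nlinarith
  · rw [hq]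
    ring
  · rw [hq]
    linarith

/-- The temperature belongs to `L²(0,T; L²(Ω))`. -/
theorem Triple.RegW.exists_temperature_curve (hd : 2 ≤ d) (hΩ : IsC2Domain Ω)
    (hH : HypHeat d M.heat) (h : S.RegW T) :
    ∃ θ : ℝ → LL Ω ℝ 2, MemLp θ 2 (timeMeasure T) ∧
      ∀ᵐ t ∂(timeMeasure T), θ t =ᵐ[volume.restrict Ω] fun x => M.Θ (S.w t x) := by
  have := hΩ.isFiniteMeasure
  set μ : Measure (Rd d) := volume.restrict Ω with hμ
  obtain ⟨L, k, m0, hL, hk, hm0d, hΘ0, hΘ2⟩ := Model.exists_temperature_bounds hd hH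
  obtain ⟨r, q, m, hr1, hrd, hrq, hrqd, hm0m, hm, hlam⟩ := exists_interpolation_exponents hd hm0d
  have hr0 : 0 < r := by linarith
  have hq0 : 0 < q := by linarith
  set R := ENNReal.ofReal r with hR
  set Q := ENNReal.ofReal q with hQ
  have hRr : R.toReal = r := ENNReal.toReal_ofReal hr0.le
  have hQq : Q.toReal = q := ENNReal.toReal_ofReal hq0.le
  have hR1 : Fact (1 ≤ R) := ⟨by
    rw [← ENNReal.ofReal_one]
    exact ENNReal.ofReal_le_ofReal hr1.le⟩
  have hQ1 : Fact (1 ≤ Q) := ⟨hR1.out.trans (ENNReal.ofReal_le_ofReal hrq)⟩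
  obtain ⟨J, hJ⟩ := hΩ.exists_embedding (F := ℝ) (r := R) (q := Q) hd
    (ENNReal.ofReal_le_ofReal hrq) ENNReal.ofReal_ne_top (by rw [hRr, hQq]; exact hrqd)
  have hadm : AdmExp d R (ENNReal.ofReal (r / (r - 1))) := by
    refine ⟨(Real.HolderConjugate.conjExponent hr1).ennrealOfReal, ?_⟩
    rw [hR, ← ENNReal.ofReal_natCast, ← ENNReal.ofReal_ofNat, ← ENNReal.ofReal_one,
      ← ENNReal.ofReal_add (by positivity) (by positivity),
      ← ENNReal.ofReal_add (by positivity) (by positivity),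
      ← ENNReal.ofReal_div_of_pos (by positivity)]
    exact (ENNReal.ofReal_lt_ofReal_iff (by positivity)).2 hrd
  obtain ⟨g, hg, hge⟩ := h.sobolev R _ hadm
  let N : ℝ≥0∞ := eLpNorm S.w ⊤ (timeMeasure T)
  have hN : N ≠ ⊤ := h.bounded.2.ne
  have hwN : ∀ᵐ t ∂(timeMeasure T), ‖S.w t‖ₑ ≤ N := by
    filter_upwards [ae_le_eLpNormEssSup (f := S.w) (μ := timeMeasure T)] with t ht
    simpa [N] using ht
  let A : ℝ≥0∞ := (μ univ + ENNReal.ofReal k * N) ^ (1 - r / q)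
  have hA : A ≠ ⊤ := ENNReal.rpow_ne_top_of_nonneg (by linarith)
    (ENNReal.add_ne_top.2 ⟨measure_ne_top _ _, ENNReal.mul_ne_top ENNReal.ofReal_ne_top hN⟩)
  let c : ℝ≥0∞ := μ univ ^ (1 / q)
  have hc : c ≠ ⊤ := ENNReal.rpow_ne_top_of_nonneg (by positivity) (measure_ne_top _ _)
  let b : ℝ → ℝ := fun t => c.toReal + k * ‖J‖ * ‖g t‖
  have hb0 : ∀ t, 0 ≤ b t := fun t => by positivity
  -- With `v = 1 + k|w|` and `m = (1 - r/q) + r`, Hölder's inequality in space bounds `∫ v^m` by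
  -- `‖v‖_1^{1 - r/q} ‖v‖_q^r`. The first factor is bounded in time, and the second is integrable in
  -- time by the embedding of `W^{1,r}` into `L^q`.
  have key : ∀ᵐ t ∂(timeMeasure T), ∫⁻ x, ‖M.Θ (S.w t x)‖ₑ ^ (2 : ℝ) ∂μ
      ≤ A * ENNReal.ofReal (b t) ^ r := by
    filter_upwards [hwN, hge] with t h1 h2
    have hw : (S.w t : Rd d → ℝ) =ᵐ[μ] J (g t) := by
      refine EventuallyEq.trans ?_ (hJ (g t)).symm
      exact Eventually.of_forall fun x =>
        congrArg (fun f : L0 Ω ℝ => (f : Rd d → ℝ) x) h2.symm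
    let v : Rd d → ℝ≥0∞ := fun x => ENNReal.ofReal (1 + k * |S.w t x|)
    have hv : AEMeasurable v μ :=
      (((Lp.aestronglyMeasurable (S.w t)).norm.const_mul k).const_add 1).aemeasurable.ennreal_ofReal
    have e1 : ∫⁻ x, ‖M.Θ (S.w t x)‖ₑ ^ (2 : ℝ) ∂μ
        ≤ ∫⁻ x, v x ^ (1 - r / q) * (v x ^ q) ^ (r / q) ∂μ := by
      refine lintegral_mono fun x => ?_
      have hx1 : 1 ≤ 1 + k * |S.w t x| := le_add_of_nonneg_right (by positivity)
      rw [← ENNReal.rpow_mul, mul_div_cancel₀ r hq0.ne', ← ENNReal.rpow_add_of_nonneg _ _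
        (by linarith) hr0.le, ← hm, Real.enorm_of_nonneg (hΘ0 _),
        ENNReal.ofReal_rpow_of_nonneg (hΘ0 _) (by norm_num),
        ENNReal.ofReal_rpow_of_nonneg (by linarith) (by linarith), Real.rpow_ofNat]
      exact ENNReal.ofReal_le_ofReal ((hΘ2 _).trans
        (Real.rpow_le_rpow_of_exponent_le hx1 hm0m))
    have e2 := ENNReal.lintegral_mul_norm_pow_le hv (hv.pow_const q)
      (show 0 ≤ 1 - r / q by linarith) (show 0 ≤ r / q by positivity) (by ring)
    refine e1.trans (e2.trans (mul_le_mul' ?_ ?_))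
    · refine ENNReal.rpow_le_rpow ?_ (by linarith)
      have e3 := lintegral_ofReal_one_add_rpow_le (μ := μ) (Lp.aestronglyMeasurable (S.w t)) hk
        (le_refl (1 : ℝ))
      simp only [ENNReal.rpow_one, div_one, ENNReal.ofReal_one] at e3
      refine e3.trans ?_
      gcongr
      rwa [Lp.enorm_def] at h1
    · have e3 := lintegral_ofReal_one_add_rpow_le (μ := μ) (Lp.aestronglyMeasurable (S.w t)) hk
        (show 1 ≤ q by linarith)
      have e4 : ∀ I : ℝ≥0∞, I ^ (r / q) = (I ^ (1 / q)) ^ r := fun I => by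
        rw [← ENNReal.rpow_mul]
        congr 1
        ring
      rw [e4]
      refine ENNReal.rpow_le_rpow (e3.trans ?_) hr0.le
      rw [ENNReal.ofReal_add ENNReal.toReal_nonneg (by positivity), ENNReal.ofReal_toReal hc,
        mul_assoc, ENNReal.ofReal_mul hk]
      gcongr
      rw [eLpNorm_congr_ae hw, ← Lp.enorm_def, ← ofReal_norm]
      exact ENNReal.ofReal_le_ofReal (J.le_opNorm _)
  have hmemΘ : ∀ᵐ t ∂(timeMeasure T), MemLp (nemytskii μ 1 hL (S.w t)) 2 μ := by
    filter_upwards [key] with t ht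
    refine ⟨Lp.aestronglyMeasurable _, ?_⟩
    rw [eLpNorm_lt_top_iff_lintegral_rpow_enorm_lt_top (by simp) (by simp)]
    refine lt_of_eq_of_lt (lintegral_congr_ae ?_) (ht.trans_lt (ENNReal.mul_lt_top hA.lt_top
      (ENNReal.rpow_lt_top_of_nonneg hr0.le ENNReal.ofReal_ne_top)))
    filter_upwards [coeFn_nemytskii (s := 1) hL (S.w t)] with x hx
    rw [hx]
    norm_num
  obtain ⟨θ, hθm, hθ⟩ := exists_Lp_lift (q := 2) (by simp)
    ((lipschitzWith_nemytskii (p := 1) (μ := μ) hL).continuous.comp_aestronglyMeasurable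
      h.bounded.1) hmemΘ
  have hθ' : ∀ᵐ t ∂(timeMeasure T), θ t =ᵐ[μ] fun x => M.Θ (S.w t x) := by
    filter_upwards [hθ] with t ht using ht.trans (coeFn_nemytskii hL (S.w t))
  refine ⟨θ, ?_, hθ'⟩
  have hbm : MemLp b R (timeMeasure T) := MemLp.add (memLp_const _) (hg.norm.const_mul _)
  refine memLp_two_of_enorm_rpow_le hr0 hθm hbm hA ?_
  filter_upwards [key, hθ'] with t h1 h2
  have h4 : ‖θ t‖ₑ ^ (2 : ℝ) = ∫⁻ x, ‖θ t x‖ₑ ^ (2 : ℝ) ∂μ := by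
    rw [Lp.enorm_def, eLpNorm_eq_lintegral_rpow_enorm_toReal (by simp) (by simp),
      ← ENNReal.rpow_mul]
    simp
  rw [h4, Real.enorm_of_nonneg (hb0 t)]
  refine le_of_eq_of_le (lintegral_congr_ae ?_) h1
  filter_upwards [h2] with x hx
  rw [hx]

end TemperatureCurve


/-! ## Smooth functions as elements of Sobolev spaces -/

section Smooth

variable {d : ℕ} {Ω : Set (Rd d)}

/-- The vector of the partial derivatives of `u`. -/
noncomputable def partials (u : Rd d → ℝ) (x : Rd d) : Grad d ℝ :=
  WithLp.toLp 2 fun i => fderiv ℝ u x (EuclideanSpace.single i 1)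

theorem continuous_partials {u : Rd d → ℝ} (hu : ContDiff ℝ 1 u) : Continuous (partials u) := by
  refine (PiLp.continuous_toLp 2 _).comp (continuous_pi fun i => ?_)
  exact (hu.continuous_fderiv one_ne_zero).clm_apply continuous_const

theorem hasWeakGrad_of_contDiff {u : Rd d → ℝ} (hu : ContDiff ℝ 1 u) :
    HasWeakGrad Ω u (partials u) where
  locInt := hu.continuous.locallyIntegrable.locallyIntegrableOn _
  locInt_grad := (continuous_partials hu).locallyIntegrable.locallyIntegrableOn _
  parts := by
    intro ψ hψ hs hsub i
    let v : Rd d := EuclideanSpace.single i 1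
    have hu' : Continuous fun x => fderiv ℝ u x v :=
      (hu.continuous_fderiv one_ne_zero).clm_apply continuous_const
    have hψ' : Continuous fun x => fderiv ℝ ψ x v :=
      (hψ.continuous_fderiv (by simp)).clm_apply continuous_const
    have hs' : HasCompactSupport fun x => fderiv ℝ ψ x v := hs.fderiv_apply (𝕜 := ℝ) _
    have h0 : ∀ x, x ∉ Ω → ψ x = 0 ∧ fderiv ℝ ψ x v = 0 := fun x hx =>
      ⟨image_eq_zero_of_notMem_tsupport fun h => hx (hsub h), by
        rw [fderiv_of_notMem_tsupport (𝕜 := ℝ) fun h => hx (hsub h)]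
        rfl⟩
    have h1 := integral_mul_fderiv_eq_neg_fderiv_mul_of_integrable (μ := volume) (f := u) (g := ψ)
      (v := v) ((hu'.mul hψ.continuous).integrable_of_hasCompactSupport hs.mul_left)
      ((hu.continuous.mul hψ').integrable_of_hasCompactSupport hs'.mul_left)
      ((hu.continuous.mul hψ.continuous).integrable_of_hasCompactSupport hs.mul_left)
      (fun x _ => hu.differentiable one_ne_zero x) (fun x _ => hψ.differentiable (by simp) x)
    rw [setIntegral_eq_integral_of_forall_compl_eq_zero fun x hx => by
        rw [(h0 x hx).2, zero_smul],
      setIntegral_eq_integral_of_forall_compl_eq_zero fun x hx => by rw [(h0 x hx).1, zero_smul]]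
    simp only [smul_eq_mul, mul_comm _ (u _)]
    rw [h1]
    simp only [mul_comm (ψ _)]
    rfl

theorem memLp_of_continuous (hΩ : IsC2Domain Ω) {E : Type*} [NormedAddCommGroup E] {u : Rd d → E}
    (hu : Continuous u) (q : ℝ≥0∞) : MemLp u q (volume.restrict Ω) := by
  have := hΩ.isFiniteMeasure
  obtain ⟨C, hC⟩ := (hΩ.bounded.isCompact_closure).exists_bound_of_continuousOn hu.continuousOn
  refine MemLp.of_bound hu.aestronglyMeasurable C ?_
  filter_upwards [ae_restrict_mem hΩ.isOpen.measurableSet] with x hx using hC x (subset_closure hx)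

theorem exists_W1_of_contDiff (hΩ : IsC2Domain Ω) {u : Rd d → ℝ} (hu : ContDiff ℝ 1 u)
    (q : ℝ≥0∞) [Fact (1 ≤ q)] :
    ∃ f : W1 Ω ℝ q, f.fn =ᵐ[volume.restrict Ω] u ∧ f.grad =ᵐ[volume.restrict Ω] partials u := by
  have h1 := memLp_of_continuous hΩ hu.continuous q
  have h2 := memLp_of_continuous hΩ (continuous_partials hu) q
  exact ⟨⟨(h1.toLp u, h2.toLp _), (hasWeakGrad_of_contDiff hu).congr (locInt_Lp _) (locInt_Lp _)
    h1.coeFn_toLp.symm h2.coeFn_toLp.symm⟩, h1.coeFn_toLp, h2.coeFn_toLp⟩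

end Smooth

/-! ## Square integrable curves -/

section Curves

variable {d : ℕ} {Ω : Set (Rd d)} {T : ℝ}

theorem inner_eq_integral {X : Type*} [MeasurableSpace X] {μ : Measure X} {f g : Lp ℝ 2 μ}
    {f' g' : X → ℝ} (hf : f =ᵐ[μ] f') (hg : g =ᵐ[μ] g') :
    inner ℝ f g = ∫ x, f' x * g' x ∂μ := by
  rw [L2.inner_def]
  refine integral_congr_ae ?_
  filter_upwards [hf, hg] with x h1 h2
  rw [h1, h2]
  simp [mul_comm]

theorem integrable_mul_of_ae_eq {X : Type*} [MeasurableSpace X] {μ : Measure X} {f g : Lp ℝ 2 μ}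
    {f' g' : X → ℝ} (hf : f =ᵐ[μ] f') (hg : g =ᵐ[μ] g') :
    Integrable (fun x => f' x * g' x) μ :=
  ((Lp.memLp f).integrable_mul (Lp.memLp g)).congr (by
    filter_upwards [hf, hg] with x h1 h2
    rw [Pi.mul_apply, h1, h2])

variable {H : Type} [NormedAddCommGroup H] [InnerProductSpace ℝ H]

theorem integrable_inner_of_memLp {ν : Measure ℝ} {f g : ℝ → H} (hf : MemLp f 2 ν)
    (hg : MemLp g 2 ν) : Integrable (fun t => inner ℝ (f t) (g t)) ν := by
  refine (hf.norm.integrable_mul hg.norm).mono'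
    (hf.aestronglyMeasurable.inner hg.aestronglyMeasurable) ?_
  exact Eventually.of_forall fun t => norm_inner_le_norm _ _

theorem HasTimeDeriv.integrable_inner {f f' g : ℝ → H} (hf : HasTimeDeriv T f f')
    (hg : IntegrableOn g (Ioc 0 T)) : IntegrableOn (fun t => inner ℝ (f t) (g t)) (Ioc 0 T) := by
  obtain ⟨C, -, hC⟩ := hf.exists_bound
  refine (hg.norm.const_mul C).mono'
    (hf.aestronglyMeasurable.inner hg.aestronglyMeasurable) ?_
  filter_upwards [ae_restrict_mem measurableSet_Ioc] with t ht
  refine (norm_inner_le_norm _ _).trans ?_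
  gcongr
  exact hC t (Ioc_subset_Icc_self ht)

theorem HasTimeDeriv.memLp {f f' : ℝ → H} (hf : HasTimeDeriv T f f') :
    MemLp f 2 (timeMeasure T) := by
  obtain ⟨C, -, hC⟩ := hf.exists_bound
  refine MemLp.of_bound hf.aestronglyMeasurable C ?_
  filter_upwards [ae_restrict_mem measurableSet_Ioc] with t ht
    using hC t (Ioc_subset_Icc_self ht)

theorem HasTimeDeriv.integral_inner_add [CompleteSpace H] {f f' g g' : ℝ → H}
    (hf : HasTimeDeriv T f f') (hg : HasTimeDeriv T g g') {s t : ℝ} (hs : s ∈ Icc 0 T)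
    (ht : t ∈ Icc 0 T) :
    ∫ r in s..t, (inner ℝ (f' r) (g r) + inner ℝ (f r) (g' r))
      = inner ℝ (f t) (g t) - inner ℝ (f s) (g s) :=
  ((hf.bilin hg (innerSL ℝ)).sub_eq hs ht).symm

theorem intervalIntegral_congr_ae_timeMeasure {E : Type*} [NormedAddCommGroup E] [NormedSpace ℝ E]
    {f g : ℝ → E} (h : ∀ᵐ t ∂(timeMeasure T), f t = g t) {s t : ℝ} (hs : s ∈ Icc 0 T)
    (ht : t ∈ Icc 0 T) : ∫ r in s..t, f r = ∫ r in s..t, g r := by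
  refine intervalIntegral.integral_congr_ae ?_
  rw [timeMeasure, ae_restrict_iff' measurableSet_Ioc] at h
  filter_upwards [h] with r hr hmem
  rw [uIoc, mem_Ioc] at hmem
  exact hr ⟨(le_min hs.1 ht.1).trans_lt hmem.1, hmem.2.trans (max_le hs.2 ht.2)⟩

end Curves


/-! ## The total energy inequality -/

section TotalEnergy

variable {d : ℕ} {Ω : Set (Rd d)} {T : ℝ} {S : Triple Ω} {M : Model d} {D : Data Ω}
  {p : ℝ≥0∞} [Fact (1 ≤ p)]

theorem Triple.RegU.exists_div_curve (hd : d = 2 ∨ d = 3) (hΩ : IsC2Domain Ω) (hT : 0 < T)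
    (h : S.RegU T) :
    ∃ δ : ℝ → LL Ω ℝ 2, MemLp δ 2 (timeMeasure T) ∧ ∀ᵐ t ∂(timeMeasure T),
      δ t =ᵐ[volume.restrict Ω] fun x => divg (weakGrad Ω (S.ut t) x) := by
  have := hΩ.isFiniteMeasure
  obtain ⟨-, G, -, hG, -, hGe⟩ := h.exists_grad_curve hd hΩ hT
  let I := LpIncl (Grad d (Rd d)) (volume.restrict Ω) (p := 2) (q := 4) (by norm_num)
  refine ⟨fun t => (divgL d).compLpL 2 (volume.restrict Ω) (I (G t)),
    ((divgL d).compLpL 2 (volume.restrict Ω)).comp_memLp' (I.comp_memLp' hG), ?_⟩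
  filter_upwards [hGe] with t ht
  filter_upwards [(divgL d).coeFn_compLpL (I (G t)), coeFn_LpIncl (p := 2) (q := 4) (by norm_num) (G t), ht]
    with x h1 h2 h3
  rw [h1, h2, h3, divgL_apply]

/-- This endpoint suffices for the heat balance, whose test function is a constant in `W^{1,∞}`. -/
theorem admExp_one_top (d : ℕ) : AdmExp d 1 ⊤ := by
  refine ⟨inferInstance, ?_⟩
  have h1 : (d : ℝ≥0∞) + 1 ≠ 0 := by simp
  have h2 : (d : ℝ≥0∞) + 1 ≠ ⊤ := by simp
  rw [ENNReal.lt_div_iff_mul_lt (Or.inl h1) (Or.inl h2), one_mul]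
  exact ENNReal.add_lt_add_left (by simp) (by norm_num)

/-- The balance of heat: the enthalpy equation tested with constants. -/
theorem IsWeakSolution.heat_balance (hΩ : IsC2Domain Ω) (hT : 0 < T)
    (h : IsWeakSolution Ω T p M D S) (hD : D.Admissible T) {θ δ : ℝ → LL Ω ℝ 2}
    (hθ : MemLp θ 2 (timeMeasure T)) (hδ : MemLp δ 2 (timeMeasure T))
    (hθe : ∀ᵐ t ∂(timeMeasure T), θ t =ᵐ[volume.restrict Ω] fun x => M.Θ (S.w t x))
    (hδe : ∀ᵐ t ∂(timeMeasure T),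
      δ t =ᵐ[volume.restrict Ω] fun x => divg (weakGrad Ω (S.ut t) x))
    {s t : ℝ} (hs : s ∈ Icc 0 T) (ht : t ∈ Icc 0 T) :
    S.wDual t 1 - S.wDual s 1 + (∫ r in s..t, inner ℝ (S.chit r) (θ r))
      + M.ρ * (∫ r in s..t, inner ℝ (δ r) (θ r)) = ∫ r in s..t, ∫ x in Ω, D.g r x := by
  have := hΩ.isFiniteMeasure
  -- The constant curve `1` has zero gradient and zero time derivative, so the heat flux term and
  -- the term with `φ_t` drop out.
  obtain ⟨f, hf, hgf⟩ := exists_W1_of_contDiff hΩ (u := fun _ : Rd d => (1 : ℝ)) contDiff_const ⊤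
  have hf1 : (f.fn : L0 Ω ℝ) = 1 := by
    ext1
    exact hf.trans AEEqFun.coeFn_one.symm
  have hgf0 : f.grad =ᵐ[volume.restrict Ω] fun _ => 0 := by
    filter_upwards [hgf] with x hx
    rw [hx]
    ext i
    simp [partials]
  have hcurve : IsTestCurve T (fun _ => f) (fun _ => (0 : LL Ω ℝ ⊤)) :=
    ⟨continuousOn_const, MemLp.zero', by
      refine ⟨integrableOn_zero, fun t _ => ?_⟩
      simp⟩
  obtain ⟨-, -, heq⟩ := h.enthalpy 1 ⊤ (admExp_one_top d) (fun _ => f) (fun _ => 0) hcurve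
  have h00 : (0 : ℝ) ∈ Icc 0 T := ⟨le_rfl, hT.le⟩
  have hi1 := integrable_inner_of_memLp h.regular.regChi.chit_L2 hθ
  have hi2 := integrable_inner_of_memLp hδ hθ
  have hi3 : IntegrableOn (fun r => ∫ x in Ω, D.g r x) (Ioc 0 T) := by
    have h1 : Integrable D.g (timeMeasure T) := hD.2.integrable le_rfl
    exact (L1.integralCLM (α := Rd d) (E := ℝ) (μ := volume.restrict Ω)).integrable_comp h1 |>.congr
      (Eventually.of_forall fun r =>
        (L1.integral_eq (D.g r)).symm.trans (L1.integral_eq_integral (D.g r)))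
  have key : ∀ t ∈ Icc 0 T, S.wDual t 1 + (∫ r in (0 : ℝ)..t, inner ℝ (S.chit r) (θ r))
      + M.ρ * (∫ r in (0 : ℝ)..t, inner ℝ (δ r) (θ r))
      = (∫ r in (0 : ℝ)..t, ∫ x in Ω, D.g r x) + ∫ x in Ω, D.w0 x := by
    intro t ht
    have hw0 : ∫ x in Ω, D.w0 x * f.fn x = ∫ x in Ω, D.w0 x := by
      refine integral_congr_ae ?_
      filter_upwards [hf] with x hx
      rw [hx, mul_one]
    rcases ht.1.eq_or_lt with rfl | ht0
    -- The enthalpy equation is imposed for `t > 0` only; at `t = 0` the initial condition takes its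
    -- place.
    · have h1 := h.initial.w 1 ⊤ (admExp_one_top d) f
      rw [hw0, hf1] at h1
      simp [h1]
    · have h1 := heq t ⟨ht0, ht.2⟩
      have e1 : ∫ s in (0 : ℝ)..t, ∫ x in Ω, S.w s x * (0 : LL Ω ℝ ⊤) x = 0 := by
        have : ∀ s, ∫ x in Ω, S.w s x * (0 : LL Ω ℝ ⊤) x = 0 := fun s => by
          refine integral_eq_zero_of_ae ?_
          filter_upwards [Lp.coeFn_zero ℝ ⊤ (volume.restrict Ω)] with x hx
          rw [hx, Pi.zero_apply, mul_zero]
        exact (intervalIntegral.integral_congr fun s _ => this s).trans (by simp)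
      have e2 : ∫ s in (0 : ℝ)..t, ∫ x in Ω, S.heatFlux M (fun _ => f) s x = 0 := by
        have : ∀ s, ∫ x in Ω, S.heatFlux M (fun _ => f) s x = 0 := fun s => by
          refine integral_eq_zero_of_ae ?_
          filter_upwards [hgf0] with x hx
          rw [Triple.heatFlux, hx, inner_zero_right, mul_zero, Pi.zero_apply]
        simp [this]
      have e3 : ∫ s in (0 : ℝ)..t, ∫ x in Ω, S.chit s x * M.Θ (S.w s x) * f.fn x
          = ∫ r in (0 : ℝ)..t, inner ℝ (S.chit r) (θ r) := by
        refine intervalIntegral_congr_ae_timeMeasure ?_ h00 ht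
        filter_upwards [hθe] with s hs
        rw [inner_eq_integral (ae_eq_refl _) hs]
        refine integral_congr_ae ?_
        filter_upwards [hf] with x hx
        rw [hx, mul_one]
      have e4 : ∫ s in (0 : ℝ)..t, ∫ x in Ω, divg (weakGrad Ω (S.ut s) x) * M.Θ (S.w s x) * f.fn x
          = ∫ r in (0 : ℝ)..t, inner ℝ (δ r) (θ r) := by
        refine intervalIntegral_congr_ae_timeMeasure ?_ h00 ht
        filter_upwards [hθe, hδe] with s hs hs'
        rw [inner_eq_integral hs' hs]
        refine integral_congr_ae ?_
        filter_upwards [hf] with x hx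
        rw [hx, mul_one]
      have e5 : ∫ s in (0 : ℝ)..t, ∫ x in Ω, D.g s x * f.fn x
          = ∫ r in (0 : ℝ)..t, ∫ x in Ω, D.g r x := by
        congr 1
        ext s
        refine integral_congr_ae ?_
        filter_upwards [hf] with x hx
        rw [hx, mul_one]
      rw [e1, e2, e3, e4, e5, hw0, hf1] at h1
      linarith
  have hint : ∀ {φ : ℝ → ℝ}, IntegrableOn φ (Ioc 0 T) →
      ∫ r in s..t, φ r = (∫ r in (0 : ℝ)..t, φ r) - ∫ r in (0 : ℝ)..s, φ r := fun hφ =>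
    (intervalIntegral.integral_interval_sub_left
      (intervalIntegrable_of_integrableOn_Ioc hφ h00 ht)
      (intervalIntegrable_of_integrableOn_Ioc hφ h00 hs)).symm
  rw [hint hi1, hint hi2, hint hi3]
  linear_combination key t ht - key s hs

/-- The balance of mechanical energy in integrand form: the momentum equation tested with the
velocity. -/
theorem IsWeakSolution.power_balance (hΩ : IsC2Domain Ω) (hT : 0 < T)
    (h : IsWeakSolution Ω T p M D S) {θ δ B R : ℝ → LL Ω ℝ 2}
    (hθ : ∀ᵐ t ∂(timeMeasure T), θ t =ᵐ[volume.restrict Ω] fun x => M.Θ (S.w t x))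
    (hδ : ∀ᵐ t ∂(timeMeasure T),
      δ t =ᵐ[volume.restrict Ω] fun x => divg (weakGrad Ω (S.ut t) x))
    (hB : ∀ t ∈ Icc 0 T, B t =ᵐ[volume.restrict Ω] fun x => M.b (S.chi t x))
    (hR : ∀ᵐ t ∂(timeMeasure T), R t =ᵐ[volume.restrict Ω]
        fun x => M.elast (weakGrad Ω (S.u t) x) (weakGrad Ω (S.ut t) x)) :
    ∀ᵐ t ∂(timeMeasure T),
      M.bilV Ω (fun x => M.a (S.chi t x) + M.δ) (weakGrad Ω (S.ut t)) (weakGrad Ω (S.ut t))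
        = inner ℝ (D.f t) (S.ut t) - inner ℝ (S.ut t) (S.utt t) - inner ℝ (B t) (R t)
          + M.ρ * inner ℝ (δ t) (θ t) := by
  obtain ⟨U, V, -, -, -, hV⟩ := h.regular.regU.exists_H2_curve hΩ hT
  filter_upwards [h.momentum, hV, hθ, hδ, hR, ae_restrict_mem measurableSet_Ioc]
    with t h1 h2 h3 h4 h5 ht
  -- The velocity belongs to `H¹₀` at almost every time, so it is an admissible test function there.
  have h6 := h1 _ h2.1
  have hgrad := (V t).1.1.weakGrad_ae_eq hΩ.isOpen (u := S.ut t) (by rw [h2.2])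
  rw [h2.2] at h6
  have e1 : M.bilV Ω (fun x => M.a (S.chi t x) + M.δ) (weakGrad Ω (S.ut t)) (V t).1.1.grad
      = M.bilV Ω (fun x => M.a (S.chi t x) + M.δ) (weakGrad Ω (S.ut t)) (weakGrad Ω (S.ut t)) := by
    refine integral_congr_ae ?_
    filter_upwards [hgrad] with x hx
    rw [hx]
  have e2 : M.bilE Ω (fun x => M.b (S.chi t x)) (weakGrad Ω (S.u t)) (V t).1.1.grad
      = inner ℝ (B t) (R t) := by
    rw [inner_eq_integral (hB t (Ioc_subset_Icc_self ht)) h5]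
    refine integral_congr_ae ?_
    filter_upwards [hgrad] with x hx
    rw [hx]
  have e3 : ∫ x in Ω, M.Θ (S.w t x) * divg ((V t).1.1.grad x) = inner ℝ (δ t) (θ t) := by
    rw [inner_eq_integral h4 h3]
    refine integral_congr_ae ?_
    filter_upwards [hgrad] with x hx
    rw [hx, mul_comm]
  rw [e1, e2, e3, ← L2.inner_def, ← L2.inner_def] at h6
  rw [real_inner_comm (S.utt t)]
  linarith

/-- The balance of energy for the enthalpy and the momentum equation. -/
theorem IsWeakSolution.mech_balance (hd : d = 2 ∨ d = 3) (hΩ : IsC2Domain Ω) (hT : 0 < T)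
    (hdp : (d : ℝ≥0∞) < p) (hp : p ≠ ⊤) (hM : M.Standing Ω p)
    (h : IsWeakSolution Ω T p M D S) (hD : D.Admissible T) {s t : ℝ} (hs : s ∈ Icc 0 T)
    (ht : t ∈ Icc 0 T) :
    S.mechEnergy M t + (∫ r in s..t, M.bilV Ω (fun x => M.a (S.chi r x) + M.δ)
        (weakGrad Ω (S.ut r)) (weakGrad Ω (S.ut r)))
      + (∫ r in s..t, ∫ x in Ω, S.chit r x *
          (-(deriv M.b (S.chi r x) * S.elastEnergy M r x) + M.Θ (S.w r x)))
    = S.mechEnergy M s + (∫ r in s..t, ∫ x in Ω, inner ℝ (D.f r x) (S.ut r x))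
      + ∫ r in s..t, ∫ x in Ω, D.g r x := by
  have hd2 : 2 ≤ d := by omega
  have hU := h.regular.regU
  have hC := h.regular.regChi
  obtain ⟨θ, hθ, hθe⟩ := h.regular.regW.exists_temperature_curve hd2 hΩ hM.heat
  obtain ⟨δ, hδ, hδe⟩ := hU.exists_div_curve hd hΩ hT
  obtain ⟨Q, R, hQ, hQe, hRe⟩ := hU.exists_elast_curve hd hΩ hT M
  obtain ⟨B, E, hB, hBe, hEe⟩ := hC.exists_comp_curve hd2 hΩ hT hdp hp hM.b_smooth
  have hheat := h.heat_balance hΩ hT hD hθ hδ hθe hδe hs ht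
  have hpow := h.power_balance hΩ hT hθe hδe hBe hRe
  have hRi : IntegrableOn R (Ioc 0 T) := by
    refine (hQ.1.smul (2⁻¹ : ℝ)).congr (Eventually.of_forall fun r => ?_)
    simp
  have i1 : IntegrableOn (fun r => inner ℝ (D.f r) (S.ut r)) (Ioc 0 T) :=
    integrable_inner_of_memLp hD.1 hU.deriv2.memLp
  have i2 : IntegrableOn (fun r => inner ℝ (S.ut r) (S.utt r)) (Ioc 0 T) :=
    hU.deriv2.integrable_inner hU.deriv2.1
  have i3 := hB.integrable_inner hRi
  have i4 : IntegrableOn (fun r => inner ℝ (δ r) (θ r)) (Ioc 0 T) :=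
    integrable_inner_of_memLp hδ hθ
  have i5 := hQ.integrable_inner hB.1
  have i6 : IntegrableOn (fun r => inner ℝ (S.chit r) (θ r)) (Ioc 0 T) :=
    integrable_inner_of_memLp hC.chit_L2 hθ
  have hii : ∀ {φ : ℝ → ℝ}, IntegrableOn φ (Ioc 0 T) → IntervalIntegrable φ volume s t :=
    fun hφ => intervalIntegrable_of_integrableOn_Ioc hφ hs ht
  -- The viscous dissipation is integrated through the other side of the power balance, all of whose
  -- terms are known to be integrable.
  have e1 := intervalIntegral_congr_ae_timeMeasure hpow hs ht
  rw [intervalIntegral.integral_add ((hii i1).sub (hii i2) |>.sub (hii i3)) ((hii i4).const_mul _),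
    intervalIntegral.integral_sub ((hii i1).sub (hii i2)) (hii i3),
    intervalIntegral.integral_sub (hii i1) (hii i2), intervalIntegral.integral_const_mul] at e1
  have hY : ∀ᵐ r ∂(timeMeasure T), ∫ x in Ω, S.chit r x *
          (-(deriv M.b (S.chi r x) * S.elastEnergy M r x) + M.Θ (S.w r x))
      = -(1 / 2) * inner ℝ (Q r) (E r) + inner ℝ (S.chit r) (θ r) := by
    filter_upwards [hEe, hθe, ae_restrict_mem measurableSet_Ioc] with r h1 h2 hr
    have h3 := hQe r (Ioc_subset_Icc_self hr)
    rw [inner_eq_integral h3 h1, inner_eq_integral (ae_eq_refl _) h2, ← integral_const_mul,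
      ← integral_add ((integrable_mul_of_ae_eq h3 h1).const_mul _)
        (integrable_mul_of_ae_eq (ae_eq_refl _) h2)]
    refine integral_congr_ae (Eventually.of_forall fun x => ?_)
    simp only [Triple.elastEnergy]
    ring
  have e2 := intervalIntegral_congr_ae_timeMeasure hY hs ht
  rw [intervalIntegral.integral_add ((hii i5).const_mul _) (hii i6),
    intervalIntegral.integral_const_mul] at e2
  have e3 := hU.deriv2.integral_inner_add hU.deriv2 hs ht
  have e3' : ∫ r in s..t, (inner ℝ (S.utt r) (S.ut r) + inner ℝ (S.ut r) (S.utt r))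
      = 2 * ∫ r in s..t, inner ℝ (S.ut r) (S.utt r) := by
    rw [← intervalIntegral.integral_const_mul]
    congr 1
    ext r
    rw [real_inner_comm (S.ut r)]
    ring
  -- Product rule for the elastic energy: the derivative of `⟨b(χ), ε(u)R_eε(u)⟩` consists of the
  -- phase power `⟨E, Q⟩` and twice the mechanical power `⟨B, R⟩`.
  have e4 := hB.integral_inner_add hQ hs ht
  have e4' : ∫ r in s..t, (inner ℝ (E r) (Q r) + inner ℝ (B r) (((2 : ℝ) • R) r))
      = (∫ r in s..t, inner ℝ (Q r) (E r)) + 2 * ∫ r in s..t, inner ℝ (B r) (R r) := by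
    rw [← intervalIntegral.integral_const_mul, ← intervalIntegral.integral_add (hii i5)
      ((hii i3).const_mul _)]
    congr 1
    ext r
    rw [real_inner_comm (Q r), Pi.smul_apply, inner_smul_right]
  have hm : ∀ r ∈ Icc 0 T, S.mechEnergy M r = S.wDual r 1
      + 1 / 2 * inner ℝ (S.ut r) (S.ut r) + 1 / 2 * inner ℝ (B r) (Q r) := by
    intro r hr
    rw [Triple.mechEnergy, L2.inner_def, inner_eq_integral (hBe r hr) (hQe r hr), Model.bilE]
    simp only [real_inner_self_eq_norm_sq]
  have e5 : ∫ r in s..t, ∫ x in Ω, inner ℝ (D.f r x) (S.ut r x)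
      = ∫ r in s..t, inner ℝ (D.f r) (S.ut r) := by
    congr 1
  rw [hm t ht, hm s hs, e1, e2, e5]
  rw [e3'] at e3
  rw [e4'] at e4
  -- The exchange terms `⟨χ_t, θ⟩` and `ρ⟨δ, θ⟩` cancel here; the halves are those of the kinetic
  -- and elastic energies.
  linear_combination hheat - (1 / 2 : ℝ) * e3 - (1 / 2 : ℝ) * e4

/-- The power `Y` of the driving forces on `χ` occurs in both the balance and the inequality for `χ`
and is eliminated between them. The energy of `χ` may be infinite, so only real numbers are moved
across the inequality in `EReal`. -/
theorem IsWeakSolution.totalEnergyIneqAt (hd : d = 2 ∨ d = 3) (hΩ : IsC2Domain Ω) (hT : 0 < T)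
    (hdp : (d : ℝ≥0∞) < p) (hp : p ≠ ⊤) (hM : M.Standing Ω p)
    (h : IsWeakSolution Ω T p M D S) (hD : D.Admissible T) {s t : ℝ} (hs : s ∈ Icc 0 T)
    (ht : t ∈ Icc 0 T) (hst : S.EnergyIneqAt M s t) : S.TotalEnergyIneqAt M D s t := by
  have hb := h.mech_balance hd hΩ hT hdp hp hM hD hs ht
  unfold Triple.EnergyIneqAt at hst
  unfold Triple.TotalEnergyIneqAt
  set X2 := ∫ r in s..t, ∫ x in Ω, S.chit r x ^ 2
  set Y := ∫ r in s..t, ∫ x in Ω, S.chit r x *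
    (-(deriv M.b (S.chi r x) * S.elastEnergy M r x) + M.Θ (S.w r x))
  set V := ∫ r in s..t, M.bilV Ω (fun x => M.a (S.chi r x) + M.δ)
    (weakGrad Ω (S.ut r)) (weakGrad Ω (S.ut r))
  set F := ∫ r in s..t, ∫ x in Ω, inner ℝ (D.f r x) (S.ut r x)
  set G := ∫ r in s..t, ∫ x in Ω, D.g r x
  have e1 : S.mechEnergy M t + X2 + V = (S.mechEnergy M s + F + G - Y) + X2 := by linarith
  have e2 : ((S.mechEnergy M s + F + G : ℝ) : EReal)
      = ((S.mechEnergy M s + F + G - Y : ℝ) : EReal) + (Y : EReal) := by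
    rw [← EReal.coe_add, sub_add_cancel]
  rw [e1, EReal.coe_add, e2, add_assoc (_ : EReal) (X2 : EReal), add_assoc (_ : EReal) (Y : EReal),
    add_comm (Y : EReal)]
  gcongr

end TotalEnergy


/-! ## The gradient energy and its flux -/

section GradientEnergy

variable {d : ℕ} {Ω : Set (Rd d)} {p : ℝ≥0∞} {φ : Rd d → Rd d → ℝ}

/-- The composition of a Carathéodory integrand with a measurable function is measurable. -/
theorem HypPhi.aestronglyMeasurable_comp (h : HypPhi Ω p φ) {u : Rd d → Rd d}
    (hu : AEStronglyMeasurable u (volume.restrict Ω)) :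
    AEStronglyMeasurable (fun x => φ x (u x)) (volume.restrict Ω) := by
  -- For simple functions only measurability in `x` is used; continuity in the second variable
  -- handles the pointwise limit.
  have hsimple : ∀ s : SimpleFunc (Rd d) (Rd d),
      AEStronglyMeasurable (fun x => φ x (s x)) (volume.restrict Ω) := by
    intro s
    have h1 : (fun x => φ x (s x))
        = fun x => ∑ z ∈ s.range, (s ⁻¹' {z}).indicator (fun x => φ x z) x := by
      ext x
      rw [Finset.sum_eq_single (s x)]
      · rw [indicator_of_mem (by simp)]
      · intro z _ hz
        rw [indicator_of_notMem (by simpa using hz.symm)]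
      · intro hx
        exact absurd (s.mem_range_self x) hx
    rw [h1]
    exact Finset.aestronglyMeasurable_fun_sum _ fun z _ =>
      (h.meas z).indicator (s.measurableSet_fiber z)
  have hm := hu.stronglyMeasurable_mk
  refine aestronglyMeasurable_of_tendsto_ae atTop (fun n => hsimple (hm.approx n)) ?_
  filter_upwards [hu.ae_eq_mk, h.smooth] with x hx hc
  rw [hx]
  exact (hc.continuous.tendsto _).comp (hm.tendsto_approx x)

/-- Mean value inequality on the ball of radius `‖z‖ + ‖y‖`, where the gradient has growth of order
`p - 1`. It supplies the dominating function for difference quotients of `Φ`. -/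
theorem HypPhi.exists_lipschitz_bound (h : HypPhi Ω p φ) (hp : 1 ≤ p.toReal) :
    ∃ c : ℝ, 0 < c ∧ ∀ᵐ x ∂(volume.restrict Ω), ∀ z y : Rd d,
      |φ x (z + y) - φ x z| ≤ c * (1 + ‖z‖ + ‖y‖) ^ (p.toReal - 1) * ‖y‖ := by
  obtain ⟨c, hc, hgr⟩ := h.growth
  refine ⟨2 * c, by positivity, ?_⟩
  filter_upwards [hgr, h.smooth] with x hx hs z y
  have hball : Convex ℝ (Metric.closedBall (0 : Rd d) (‖z‖ + ‖y‖)) := convex_closedBall _ _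
  have h1 := hball.norm_image_sub_le_of_norm_fderiv_le (𝕜 := ℝ) (f := φ x)
    (C := 2 * c * (1 + ‖z‖ + ‖y‖) ^ (p.toReal - 1)) (x := z) (y := z + y)
    (fun w _ => hs.differentiable one_ne_zero w) (fun w hw => ?_)
    (by rw [mem_closedBall_zero_iff]; linarith [norm_nonneg y])
    (by rw [mem_closedBall_zero_iff]; exact norm_add_le _ _)
  · rwa [add_sub_cancel_left, Real.norm_eq_abs] at h1
  · rw [mem_closedBall_zero_iff] at hw
    have h2 : ‖fderiv ℝ (φ x) w‖ = ‖gradient (φ x) w‖ := by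
      rw [gradient, LinearIsometryEquiv.norm_map]
    rw [h2]
    refine (hx w).trans ?_
    have h3 : (1 : ℝ) ≤ (1 + ‖z‖ + ‖y‖) ^ (p.toReal - 1) :=
      Real.one_le_rpow (by linarith [norm_nonneg z, norm_nonneg y]) (by linarith)
    have h4 : ‖w‖ ^ (p.toReal - 1) ≤ (1 + ‖z‖ + ‖y‖) ^ (p.toReal - 1) :=
      Real.rpow_le_rpow (norm_nonneg _) (by linarith) (by linarith)
    nlinarith

theorem rpow_sub_one_mul_le {a b q : ℝ} (ha : 1 ≤ a) (hba : b ≤ a) :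
    a ^ (q - 1) * b ≤ a ^ q := by
  have h0 : 0 < a := by linarith
  calc a ^ (q - 1) * b ≤ a ^ (q - 1) * a := by gcongr
    _ = a ^ q := by rw [Real.rpow_sub_one h0.ne', div_mul_cancel₀ _ h0.ne']

theorem HypPhi.exists_growth_bound (h : HypPhi Ω p φ) (hp : 1 ≤ p.toReal) :
    ∃ c : ℝ, 0 < c ∧ ∀ᵐ x ∂(volume.restrict Ω), ∀ z : Rd d,
      φ x z ≤ c * (1 + ‖z‖) ^ p.toReal := by
  obtain ⟨c, hc, hb⟩ := h.exists_lipschitz_bound hp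
  refine ⟨c, hc, ?_⟩
  filter_upwards [hb, h.zero] with x hx h0 z
  have h1 := hx 0 z
  rw [zero_add, h0, sub_zero, norm_zero, add_zero, mul_assoc] at h1
  refine (le_abs_self _).trans (h1.trans ?_)
  gcongr
  exact rpow_sub_one_mul_le (by linarith [norm_nonneg z]) (by linarith)

variable {M : Model d} {T : ℝ} {S : Triple Ω}

theorem Model.Φ_eq (M : Model d) (hΩ : IsOpen Ω) {v : LL Ω ℝ 2} {G : Rd d → Grad d ℝ}
    (hG : HasWeakGrad Ω v G) :
    M.Φ Ω v = ∫⁻ x in Ω, ENNReal.ofReal (M.φ x (G x)) := by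
  refine le_antisymm (iInf₂_le G hG) (le_iInf₂ fun H hH => le_of_eq ?_)
  refine lintegral_congr_ae ?_
  filter_upwards [hG.ae_eq hΩ hH (ae_eq_refl _)] with x hx
  rw [hx]

/-- The gradient energy is bounded on bounded subsets of `W^{1,p}`. -/
theorem Model.exists_Φ_le (hΩ : IsC2Domain Ω) (h : HypPhi Ω p M.φ) [Fact (1 ≤ p)] (hp : p ≠ ⊤)
    (N : ℝ) : ∃ C : ℝ≥0∞, C ≠ ⊤ ∧ ∀ (f : W1 Ω ℝ p) (v : LL Ω ℝ 2), (f.fn : L0 Ω ℝ) = v →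
      ‖f‖ ≤ N → M.Φ Ω v ≤ C := by
  have := hΩ.isFiniteMeasure
  have hp1 : 1 ≤ p.toReal := by
    have := ENNReal.toReal_mono hp (Fact.out : 1 ≤ p)
    simpa using this
  obtain ⟨c, hc, hb⟩ := h.exists_growth_bound hp1
  let A : ℝ≥0∞ := volume.restrict Ω univ ^ (1 / p.toReal) + ENNReal.ofReal 1 * ENNReal.ofReal N
  have hA : A ≠ ⊤ := ENNReal.add_ne_top.2
    ⟨ENNReal.rpow_ne_top_of_nonneg (by positivity) (measure_ne_top _ _),
      ENNReal.mul_ne_top ENNReal.ofReal_ne_top ENNReal.ofReal_ne_top⟩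
  refine ⟨ENNReal.ofReal c * A ^ p.toReal, ENNReal.mul_ne_top ENNReal.ofReal_ne_top
    (ENNReal.rpow_ne_top_of_nonneg (by positivity) hA), fun f v hfv hN => ?_⟩
  have hG : HasWeakGrad Ω v f.grad := f.hasWeakGrad.congr (locInt_Lp _) (locInt_Lp _)
    (show (f.fn : L0 Ω ℝ) =ᵐ[volume.restrict Ω] (v : L0 Ω ℝ) by rw [hfv]) (ae_eq_refl _)
  rw [M.Φ_eq hΩ.isOpen hG]
  have h1 : ∫⁻ x in Ω, ENNReal.ofReal (M.φ x (f.grad x)) ≤ ∫⁻ x in Ω,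
      ENNReal.ofReal c * ENNReal.ofReal (1 + 1 * |‖f.grad x‖|) ^ p.toReal := by
    refine lintegral_mono_ae ?_
    filter_upwards [hb] with x hx
    rw [ENNReal.ofReal_rpow_of_nonneg (by positivity) (by positivity), ← ENNReal.ofReal_mul hc.le,
      one_mul, abs_norm]
    exact ENNReal.ofReal_le_ofReal (hx _)
  refine h1.trans ?_
  rw [lintegral_const_mul' _ _ ENNReal.ofReal_ne_top]
  gcongr
  have h2 := lintegral_ofReal_one_add_rpow_le (μ := volume.restrict Ω)
    (Lp.aestronglyMeasurable f.grad).norm zero_le_one hp1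
  have h3 := ENNReal.rpow_le_rpow h2 (show 0 ≤ p.toReal by positivity)
  rw [← ENNReal.rpow_mul, one_div_mul_cancel (by positivity), ENNReal.rpow_one] at h3
  refine h3.trans (ENNReal.rpow_le_rpow
    (add_le_add le_rfl (mul_le_mul' le_rfl ?_)) (by positivity))
  rw [ENNReal.ofReal_toReal hp, eLpNorm_norm, ← Lp.enorm_def, ← ofReal_norm]
  exact ENNReal.ofReal_le_ofReal ((norm_snd_le f.1).trans hN)

/-- The difference quotients of the gradient energy converge to the flux. -/
theorem Model.tendsto_slope (h : HypPhi Ω p M.φ) : ∀ᵐ x ∂(volume.restrict Ω), ∀ z y : Rd d,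
    Tendsto (fun n : ℕ => ((n : ℝ) + 1) * (M.φ x (z + ((n : ℝ) + 1)⁻¹ • y) - M.φ x z)) atTop
      (𝓝 (inner ℝ (M.flux x z) y)) := by
  filter_upwards [h.smooth] with x hx z y
  have h1 : HasFDerivAt (M.φ x) (InnerProductSpace.toDual ℝ (Rd d) (M.flux x z)) z :=
    ((hx.differentiable one_ne_zero z).hasGradientAt).hasFDerivAt
  have hn : Tendsto (fun n : ℕ => ‖(n : ℝ) + 1‖) atTop atTop :=
    tendsto_norm_atTop_atTop.comp (tendsto_atTop_add_const_right _ _ tendsto_natCast_atTop_atTop)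
  exact h1.lim y hn

theorem HypPhi.integrable_comp [IsFiniteMeasure (volume.restrict Ω)] (h : HypPhi Ω p φ)
    [Fact (1 ≤ p)] (hp : p ≠ ⊤) {G : Rd d → Rd d} (hG : MemLp G p (volume.restrict Ω)) :
    Integrable (fun x => φ x (G x)) (volume.restrict Ω) := by
  have hp1 : 1 ≤ p.toReal := by
    have := ENNReal.toReal_mono hp (Fact.out : 1 ≤ p)
    simpa using this
  obtain ⟨c, hc, hb⟩ := h.exists_growth_bound hp1
  have h1 : MemLp (fun x => 1 + ‖G x‖) p (volume.restrict Ω) := MemLp.add (memLp_const _) hG.norm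
  refine ((h1.integrable_norm_rpow').const_mul c).mono'
    (h.aestronglyMeasurable_comp hG.aestronglyMeasurable) ?_
  filter_upwards [hb, h.nonneg] with x hx h0
  rw [Real.norm_of_nonneg (h0 _), Real.norm_of_nonneg (by positivity)]
  exact hx _

theorem Model.Φ_eq_integral [IsFiniteMeasure (volume.restrict Ω)] (h : HypPhi Ω p M.φ)
    [Fact (1 ≤ p)] (hΩ : IsOpen Ω) (hp : p ≠ ⊤) {v : LL Ω ℝ 2} {G : Rd d → Grad d ℝ}
    (hG : HasWeakGrad Ω v G) (hGp : MemLp G p (volume.restrict Ω)) :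
    (M.Φ Ω v : EReal) = ((∫ x in Ω, M.φ x (G x) : ℝ) : EReal) := by
  rw [M.Φ_eq hΩ hG, ← ofReal_integral_eq_lintegral_ofReal (h.integrable_comp hp hGp)
    (h.nonneg.mono fun x hx => hx _), EReal.coe_ennreal_ofReal, max_eq_left]
  exact integral_nonneg_of_ae (h.nonneg.mono fun x hx => hx _)

/-- A subgradient of the gradient energy is bounded above by the flux. -/
theorem Model.SubdiffΦ.inner_le_integral_flux (hΩ : IsC2Domain Ω) (h : HypPhi Ω p M.φ)
    [Fact (1 ≤ p)] (hp : p ≠ ⊤) {v η w : LL Ω ℝ 2} (hη : M.SubdiffΦ Ω v η)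
    {G H : Rd d → Grad d ℝ} (hG : HasWeakGrad Ω v G) (hH : HasWeakGrad Ω w H)
    (hGp : MemLp G p (volume.restrict Ω)) (hHp : MemLp H p (volume.restrict Ω)) :
    Integrable (fun x => inner ℝ (M.flux x (G x)) (H x)) (volume.restrict Ω) ∧
      inner ℝ η w ≤ ∫ x in Ω, inner ℝ (M.flux x (G x)) (H x) := by
  have := hΩ.isFiniteMeasure
  have hp1 : 1 ≤ p.toReal := by
    have := ENNReal.toReal_mono hp (Fact.out : 1 ≤ p)
    simpa using this
  obtain ⟨c, hc, hb⟩ := h.exists_lipschitz_bound hp1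
  -- The subgradient inequality at `v + τ n • w` is divided by `τ n`, and dominated convergence
  -- identifies the limit of the difference quotients as the flux integral.
  let τ : ℕ → ℝ := fun n => ((n : ℝ) + 1)⁻¹
  have hτ0 : ∀ n, 0 < τ n := fun n => by positivity
  have hτ1 : ∀ n, τ n ≤ 1 := fun n => inv_le_one_of_one_le₀ (by
    have : (0 : ℝ) ≤ n := n.cast_nonneg
    linarith)
  let Q : ℕ → Rd d → ℝ := fun n x =>
    ((n : ℝ) + 1) * (M.φ x (G x + ((n : ℝ) + 1)⁻¹ • H x) - M.φ x (G x))
  let b : Rd d → ℝ := fun x => c * ‖1 + ‖G x‖ + ‖H x‖‖ ^ p.toReal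
  have hbi : Integrable b (volume.restrict Ω) := by
    have h1 : MemLp (fun x => 1 + ‖G x‖ + ‖H x‖) p (volume.restrict Ω) :=
      MemLp.add (MemLp.add (memLp_const _) hGp.norm) hHp.norm
    exact h1.integrable_norm_rpow'.const_mul c
  have hGτ : ∀ n, MemLp (fun x => G x + τ n • H x) p (volume.restrict Ω) := fun n =>
    hGp.add (hHp.const_smul (τ n))
  have hQm : ∀ n, AEStronglyMeasurable (Q n) (volume.restrict Ω) := fun n =>
    ((h.aestronglyMeasurable_comp (hGτ n).aestronglyMeasurable).sub
      (h.aestronglyMeasurable_comp hGp.aestronglyMeasurable)).const_mul _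
  have hQb : ∀ n, ∀ᵐ x ∂(volume.restrict Ω), ‖Q n x‖ ≤ b x := by
    intro n
    filter_upwards [hb] with x hx
    have h1 := hx (G x) (τ n • H x)
    have h2 : ‖τ n • H x‖ = τ n * ‖H x‖ := by rw [norm_smul, Real.norm_of_nonneg (hτ0 n).le]
    have h3 : τ n * ‖H x‖ ≤ ‖H x‖ := mul_le_of_le_one_left (norm_nonneg _) (hτ1 n)
    have h4 : ((n : ℝ) + 1) * τ n = 1 := mul_inv_cancel₀ (by positivity)
    rw [h2] at h1
    calc ‖Q n x‖ = ((n : ℝ) + 1) * |M.φ x (G x + τ n • H x) - M.φ x (G x)| := by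
          rw [norm_mul, Real.norm_of_nonneg (by positivity)]
          rfl
      _ ≤ ((n : ℝ) + 1) * (c * (1 + ‖G x‖ + τ n * ‖H x‖) ^ (p.toReal - 1) * (τ n * ‖H x‖)) := by
          gcongr
      _ = c * ((1 + ‖G x‖ + τ n * ‖H x‖) ^ (p.toReal - 1) * ‖H x‖) := by
          linear_combination (c * (1 + ‖G x‖ + τ n * ‖H x‖) ^ (p.toReal - 1) * ‖H x‖) * h4
      _ ≤ c * ((1 + ‖G x‖ + ‖H x‖) ^ (p.toReal - 1) * ‖H x‖) := by
          have := hτ0 n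
          gcongr
      _ ≤ b x := by
          simp only [b]
          rw [Real.norm_of_nonneg (by positivity)]
          gcongr
          exact rpow_sub_one_mul_le (by linarith [norm_nonneg (G x), norm_nonneg (H x)])
            (by linarith [norm_nonneg (G x)])
  have hlim : ∀ᵐ x ∂(volume.restrict Ω),
      Tendsto (fun n => Q n x) atTop (𝓝 (inner ℝ (M.flux x (G x)) (H x))) := by
    filter_upwards [Model.tendsto_slope h] with x hx using hx (G x) (H x)
  have hm := aestronglyMeasurable_of_tendsto_ae atTop hQm hlim
  refine ⟨hbi.mono' hm ?_, ?_⟩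
  · filter_upwards [hlim, ae_all_iff.2 hQb] with x h1 h2
    exact le_of_tendsto h1.norm (Eventually.of_forall h2)
  · refine ge_of_tendsto (tendsto_integral_of_dominated_convergence b hQm hbi hQb hlim)
      (Eventually.of_forall fun n => ?_)
    have hw : HasWeakGrad Ω (v + τ n • w : LL Ω ℝ 2) (fun x => G x + τ n • H x) := by
      refine (hG.add (hH.smul (τ n))).congr (locInt_Lp _)
        (hG.locInt_grad.add (hH.locInt_grad.smul (τ n))) ?_ (ae_eq_refl _)
      filter_upwards [Lp.coeFn_add v (τ n • w), Lp.coeFn_smul (τ n) w] with x h1 h2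
      rw [h1, Pi.add_apply, Pi.add_apply, h2]
    have h1 := hη.2 (v + τ n • w)
    rw [Model.Φ_eq_integral h hΩ.isOpen hp hG hGp, Model.Φ_eq_integral h hΩ.isOpen hp hw (hGτ n),
      add_sub_cancel_left, inner_smul_right, ← EReal.coe_add, EReal.coe_le_coe_iff] at h1
    have h2 : ∫ x in Ω, Q n x = ((n : ℝ) + 1) * ((∫ x in Ω, M.φ x (G x + τ n • H x))
        - ∫ x in Ω, M.φ x (G x)) := by
      rw [← integral_sub (h.integrable_comp hp (hGτ n)) (h.integrable_comp hp hGp),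
        ← integral_const_mul]
    have h4 : ((n : ℝ) + 1) * τ n = 1 := mul_inv_cancel₀ (by positivity)
    rw [h2]
    have h5 : ((n : ℝ) + 1) * (τ n * inner ℝ η w) ≤ ((n : ℝ) + 1)
        * ((∫ x in Ω, M.φ x (G x + τ n • H x)) - ∫ x in Ω, M.φ x (G x)) := by
      gcongr
      linarith
    rwa [← mul_assoc, h4, one_mul] at h5

end GradientEnergy


/-! ## The pointwise inclusion -/

section Inclusion

variable {d : ℕ} {Ω : Set (Rd d)} {T : ℝ} {S : Triple Ω} {M : Model d} {p : ℝ≥0∞}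

/-- A square integrable function is nonnegative if its integrals against nonnegative smooth
functions are. -/
theorem ae_nonneg_of_forall_inner (hΩ : IsC2Domain Ω) {u : LL Ω ℝ 2}
    (h : ∀ ψ : Rd d → ℝ, ContDiff ℝ 1 ψ → (∀ x, 0 ≤ ψ x) → 0 ≤ ∫ x in Ω, ψ x * u x) :
    ∀ᵐ x ∂(volume.restrict Ω), 0 ≤ u x := by
  have := hΩ.isFiniteMeasure
  let φ : ContDiffBump (0 : Rd d) := ⟨1, 2, one_pos, one_lt_two⟩
  let k : Rd d → ℝ := φ.normed volume
  have hk : ContDiff ℝ ∞ k := φ.contDiff_normed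
  obtain ⟨C, hC⟩ := hk.continuous.bounded_above_of_compact_support φ.hasCompactSupport_normed
  have hu : LocallyIntegrable (Ω.indicator u) := by
    refine Integrable.locallyIntegrable ?_
    rw [integrable_indicator_iff hΩ.isOpen.measurableSet]
    exact (Lp.memLp u).integrable one_le_two
  have hlim := ae_tendsto_integral_scaledKernel (k := k) φ.integral_normed (e := 0) (ε := 2)
    two_pos (by rw [φ.support_normed_eq]; exact Metric.ball_subset_closedBall) hC hu
  rw [ae_restrict_iff' hΩ.isOpen.measurableSet]
  filter_upwards [hlim] with x hx hxΩ
  rw [indicator_of_mem hxΩ] at hx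
  -- The test functions are the mollifying kernels themselves, whose integrals against `u` converge
  -- to `u x` almost everywhere.
  refine ge_of_tendsto hx ?_
  filter_upwards [self_mem_nhdsWithin] with s hs
  have h1 : ∫ z, scaledKernel k x s z • Ω.indicator u z = ∫ z in Ω, scaledKernel k x s z * u z := by
    rw [← integral_indicator hΩ.isOpen.measurableSet]
    congr 1
    ext z
    by_cases hz : z ∈ Ω <;> simp [hz]
  rw [h1]
  refine h _ ((contDiff_scaledKernel hk x s).of_le (by simp)) fun z => ?_
  have : (0 : ℝ) < s := hs
  exact mul_nonneg (by positivity) (φ.nonneg_normed _)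

/-- The exceptional null set of times may depend on the test element. A countable dense subset of
`A` and continuity of the inner product give one null set for all of them. -/
theorem ae_forall_inner_nonneg {H : Type*} [NormedAddCommGroup H] [InnerProductSpace ℝ H]
    [SecondCountableTopology H] {ν : Measure ℝ} {ζ : ℝ → H} {A : Set H}
    (h : ∀ a ∈ A, ∀ᵐ t ∂ν, 0 ≤ inner ℝ (ζ t) a) : ∀ᵐ t ∂ν, ∀ a ∈ A, 0 ≤ inner ℝ (ζ t) a := by
  obtain ⟨D, hD, hdense⟩ := TopologicalSpace.exists_countable_dense A
  have h1 : ∀ᵐ t ∂ν, ∀ a ∈ D, 0 ≤ inner ℝ (ζ t) (a : H) :=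
    (ae_ball_iff hD).2 fun a _ => h a a.2
  filter_upwards [h1] with t ht a ha
  have hcl : IsClosed {a : A | 0 ≤ inner ℝ (ζ t) (a : H)} :=
    isClosed_le continuous_const (continuous_const.inner continuous_subtype_val)
  exact hcl.closure_subset_iff.2 ht (hdense ⟨a, ha⟩)

/-- The lower order terms of the equation for the phase parameter form a square integrable
curve. -/
theorem Triple.Regular.exists_residual [Fact (1 ≤ p)] (hd : d = 2 ∨ d = 3) (hΩ : IsC2Domain Ω)
    (hT : 0 < T) (hdp : (d : ℝ≥0∞) < p) (hp : p ≠ ⊤) (hM : M.Standing Ω p)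
    (h : S.Regular T p) :
    ∃ κ : ℝ → LL Ω ℝ 2, MemLp κ 2 (timeMeasure T) ∧ ∀ᵐ t ∂(timeMeasure T),
      κ t =ᵐ[volume.restrict Ω] fun x => deriv M.gammaHat (S.chi t x)
        + deriv M.b (S.chi t x) * S.elastEnergy M t x - M.Θ (S.w t x) := by
  have := hΩ.isFiniteMeasure
  have hd2 : 2 ≤ d := by omega
  obtain ⟨θ, hθ, hθe⟩ := h.regW.exists_temperature_curve hd2 hΩ hM.heat
  obtain ⟨Q, R, hQ, hQe, -⟩ := h.regU.exists_elast_curve hd hΩ hT M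
  obtain ⟨β, hβ, hβe⟩ := h.regChi.exists_deriv_mul hd2 hΩ hT hdp hp hM.b_smooth
    (hQ.memLp.const_smul (2⁻¹ : ℝ))
  -- The factor is the constant `1`, so the product is `γ(χ)` itself.
  obtain ⟨γ, hγ, hγe⟩ := h.regChi.exists_deriv_mul hd2 hΩ hT hdp hp hM.gammaHat_smooth
    (g := fun _ => Lp.const 2 (volume.restrict Ω) (1 : ℝ)) (memLp_const _)
  refine ⟨γ + β - θ, (hγ.add hβ).sub hθ, ?_⟩
  filter_upwards [hθe, hβe, hγe, ae_restrict_mem measurableSet_Ioc] with t h1 h2 h3 ht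
  filter_upwards [h1, h2, h3, hQe t (Ioc_subset_Icc_self ht), Lp.coeFn_sub (γ t + β t) (θ t),
    Lp.coeFn_add (γ t) (β t), Lp.coeFn_const (p := 2) (μ := volume.restrict Ω) (1 : ℝ),
    Lp.coeFn_smul (2⁻¹ : ℝ) (Q t)] with x e1 e2 e3 e4 e5 e6 e7 e8
  simp only [Pi.sub_apply, Pi.add_apply, Pi.smul_apply, smul_eq_mul, Function.const_apply]
    at e2 e5 e6 e7 e8 ⊢
  rw [e5, e6, e1, e2, e3, e7, e8, e4, Triple.elastEnergy]
  ring

/-- The one-sided variational inequality implies a sign. -/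
theorem Triple.OneSidedVI.ae_nonneg [Fact (1 ≤ p)] (hp2 : 2 ≤ p) (hΩ : IsC2Domain Ω)
    (hp : p ≠ ⊤) (hM : M.Standing Ω p) (hC : S.RegChi T p) {η ξ κ : ℝ → LL Ω ℝ 2}
    (hη : ∀ᵐ t ∂(timeMeasure T), M.SubdiffΦ Ω (S.chi t) (η t))
    (hκ : ∀ᵐ t ∂(timeMeasure T),
      κ t =ᵐ[volume.restrict Ω] fun x => deriv M.gammaHat (S.chi t x)
        + deriv M.b (S.chi t x) * S.elastEnergy M t x - M.Θ (S.w t x))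
    (h : S.OneSidedVI M T p (fun t => (ξ t : L0 Ω ℝ))) :
    ∀ᵐ t ∂(timeMeasure T), ∀ᵐ x ∂(volume.restrict Ω),
      0 ≤ (-(S.chit t + η t + ξ t + κ t) : LL Ω ℝ 2) x := by
  have := hΩ.isFiniteMeasure
  let I := LpIncl ℝ (volume.restrict Ω) (p := 2) (q := p) hp2
  obtain ⟨g, -, hg⟩ := hC.sobolev
  let A : Set (LL Ω ℝ 2) := {w | ∃ f : W1 Ω ℝ p, (∀ᵐ x ∂(volume.restrict Ω), 0 ≤ f.fn x) ∧
    I f.fn = w}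
  have hA : ∀ w ∈ A, ∀ᵐ t ∂(timeMeasure T),
      0 ≤ inner ℝ (-(S.chit t + η t + ξ t + κ t)) w := by
    rintro w ⟨f, hf0, rfl⟩
    have hfn : (-f).fn =ᵐ[volume.restrict Ω] fun x => -(f.fn x) := Lp.coeFn_neg f.fn
    have hgr : (-f).grad =ᵐ[volume.restrict Ω] fun x => -(f.grad x) := Lp.coeFn_neg f.grad
    have hI := coeFn_LpIncl (p := 2) (q := p) hp2 f.fn
    have hw : HasWeakGrad Ω (I f.fn) f.grad :=
      f.hasWeakGrad.congr (locInt_Lp _) (locInt_Lp _) hI.symm (ae_eq_refl _)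
    -- Testing with `-f ≤ 0` gives `⟨χ_t + ξ + κ, f⟩ + ∫ d(x,∇χ)·∇f ≤ 0`. The flux integral
    -- dominates `⟨η, f⟩`, so it may be replaced by that pairing.
    filter_upwards [h (-f) (by filter_upwards [hfn, hf0] with x h1 h2; rw [h1]; linarith),
      hη, hκ, hg] with t h1 h2 h3 h4
    have hv : HasWeakGrad Ω (S.chi t) (g t).grad :=
      (g t).hasWeakGrad.congr (locInt_Lp _) (locInt_Lp _)
        (show ((g t).fn : L0 Ω ℝ) =ᵐ[volume.restrict Ω] (S.chi t : L0 Ω ℝ) by rw [h4])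
        (ae_eq_refl _)
    obtain ⟨hi, hle⟩ := h2.inner_le_integral_flux hΩ hM.φ_hyp hp hv hw (Lp.memLp _) (Lp.memLp _)
    have hkk : (S.chit t + ξ t + κ t : LL Ω ℝ 2) =ᵐ[volume.restrict Ω]
        fun x => S.chit t x + ξ t x + κ t x := by
      filter_upwards [Lp.coeFn_add (S.chit t + ξ t) (κ t), Lp.coeFn_add (S.chit t) (ξ t)]
        with x e1 e2
      rw [e1, Pi.add_apply, e2, Pi.add_apply]
    have e : ∫ x in Ω, (S.chit t x * (-f).fn x
        + inner ℝ (M.flux x (weakGrad Ω (S.chi t) x)) ((-f).grad x)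
        + ξ t x * (-f).fn x
        + deriv M.gammaHat (S.chi t x) * (-f).fn x
        + deriv M.b (S.chi t x) * S.elastEnergy M t x * (-f).fn x
        - M.Θ (S.w t x) * (-f).fn x)
        = -inner ℝ (S.chit t + ξ t + κ t) (I f.fn)
          - ∫ x in Ω, inner ℝ (M.flux x ((g t).grad x)) (f.grad x) := by
      rw [inner_eq_integral hkk hI, ← neg_add',
        ← integral_add (integrable_mul_of_ae_eq hkk hI) hi, ← integral_neg]
      refine integral_congr_ae ?_
      filter_upwards [hfn, hgr, h3, (g t).weakGrad_ae_eq hΩ.isOpen h4] with x a1 a2 a3 a4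
      rw [a1, a2, a3, a4, inner_neg_right]
      ring
    rw [e] at h1
    rw [inner_neg_left, inner_add_left, inner_add_left, inner_add_left]
    rw [inner_add_left, inner_add_left] at h1
    linarith
  have h2top : Fact ((2 : ℝ≥0∞) ≠ ⊤) := ⟨by simp⟩
  filter_upwards [ae_forall_inner_nonneg hA] with t ht
  refine ae_nonneg_of_forall_inner hΩ fun ψ hψ hψ0 => ?_
  obtain ⟨f, hf, -⟩ := exists_W1_of_contDiff hΩ hψ p
  have h1 := ht (I f.fn) ⟨f, by filter_upwards [hf] with x hx; rw [hx]; exact hψ0 x, rfl⟩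
  rw [real_inner_comm] at h1
  rwa [inner_eq_integral ((coeFn_LpIncl (p := 2) (q := p) hp2 f.fn).trans hf) (ae_eq_refl _)] at h1

end Inclusion


/-! ### Chain inequality for the phase energy, complementarity and the inclusion. -/

section Complementarity

variable {d : ℕ} {Ω : Set (Rd d)} {T : ℝ} {S : Triple Ω} {M : Model d} {p : ℝ≥0∞}

/-- At times of finite gradient energy and nonnegative `χ` the indicator contributes nothing, so the
extended-valued energy inequality becomes an inequality between real numbers. -/
theorem Model.energy_eq {χ : LL Ω ℝ 2} (hΦ : M.Φ Ω χ ≠ ⊤)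
    (hχ : ∀ᵐ x ∂(volume.restrict Ω), 0 ≤ χ x) :
    M.energy Ω χ = (((M.Φ Ω χ).toReal + ∫ x in Ω, M.gammaHat (χ x) : ℝ) : EReal) := by
  have h1 : ∫⁻ x in Ω, indic (Ici 0) (χ x) = 0 := by
    rw [← lintegral_zero (μ := volume.restrict Ω)]
    refine lintegral_congr_ae ?_
    filter_upwards [hχ] with x hx
    exact if_pos hx
  rw [Model.energy, h1, EReal.coe_ennreal_zero, add_zero, EReal.coe_add,
    EReal.coe_ennreal_toReal hΦ]

/-- Chain rule for the convex part of the energy. -/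
theorem Triple.RegChi.exists_convex_chain [Fact (1 ≤ p)] (hΩ : IsC2Domain Ω) (hp : p ≠ ⊤)
    (hM : M.Standing Ω p) (h : S.RegChi T p) {η ξ : ℝ → LL Ω ℝ 2}
    (hη2 : MemLp η 2 (timeMeasure T))
    (hη : ∀ᵐ t ∂(timeMeasure T), M.SubdiffΦ Ω (S.chi t) (η t))
    (hξ2 : MemLp ξ 2 (timeMeasure T))
    (hξ : ∀ᵐ t ∂(timeMeasure T), ∀ᵐ x ∂(volume.restrict Ω),
      SubdiffIndic (Ici 0) (S.chi t x) (ξ t x)) :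
    ∃ N : Set ℝ, (∀ᵐ t ∂(timeMeasure T), t ∈ N) ∧ ∀ s ∈ N, ∀ t ∈ N, s ≤ t →
      ∫ r in s..t, inner ℝ (η r + ξ r) (S.chit r)
        ≤ (M.Φ Ω (S.chi t)).toReal - (M.Φ Ω (S.chi s)).toReal := by
  have := hΩ.isFiniteMeasure
  have h2top : Fact ((2 : ℝ≥0∞) ≠ ⊤) := ⟨by simp⟩
  obtain ⟨g, hg, hge⟩ := h.sobolev
  let N : ℝ := (eLpNorm g ⊤ (timeMeasure T)).toReal
  have hN : ∀ᵐ t ∂(timeMeasure T), ‖g t‖ ≤ N := by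
    filter_upwards [ae_le_eLpNormEssSup (f := g) (μ := timeMeasure T)] with t ht
    have := ENNReal.toReal_mono (by simpa using hg.2.ne) ht
    simpa [N] using this
  obtain ⟨C, hC, hΦ⟩ := M.exists_Φ_le hΩ hM.φ_hyp hp N
  -- The functional is `Φ` alone: the indicator of nonnegativity vanishes at the good times. The
  -- bound on `Φ` there comes from `χ ∈ L^∞(0,T; W^{1,p})`.
  refine exists_integral_inner_le_sub h.deriv h.chit_L2 (hη2.add hξ2)
    (ψ := fun t => (M.Φ Ω (S.chi t)).toReal) (C := C.toReal)
    (G := {t | M.SubdiffΦ Ω (S.chi t) (η t) ∧ (∀ᵐ x ∂(volume.restrict Ω),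
      SubdiffIndic (Ici 0) (S.chi t x) (ξ t x)) ∧ ‖g t‖ ≤ N ∧
      ((g t).fn : L0 Ω ℝ) = S.chi t}) ?_ ?_ ?_
  · filter_upwards [hη, hξ, hN, hge] with t h1 h2 h3 h4 using ⟨h1, h2, h3, h4⟩
  · rintro t ⟨-, -, h3, h4⟩
    rw [abs_of_nonneg ENNReal.toReal_nonneg]
    exact ENNReal.toReal_mono hC (hΦ (g t) (S.chi t) h4 h3)
  · rintro s ⟨h1, h2, -, -⟩ t ⟨h1', h2', -, -⟩
    have e1 := h1.2 (S.chi t)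
    rw [← EReal.coe_ennreal_toReal h1.1, ← EReal.coe_ennreal_toReal h1'.1, ← EReal.coe_add,
      EReal.coe_le_coe_iff] at e1
    -- As `χ(t) ≥ 0` competes in the inclusion for `ξ(s)`, adding `ξ` preserves the subgradient
    -- inequality.
    have e2 : inner ℝ (ξ s) (S.chi t - S.chi s) ≤ 0 := by
      rw [inner_eq_integral (ae_eq_refl _) (Lp.coeFn_sub (S.chi t) (S.chi s))]
      refine integral_nonpos_of_ae ?_
      filter_upwards [h2, h2'] with x a1 a2
      exact a1.2 _ a2.1
    rw [Pi.add_apply, inner_add_left]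
    linarith

/-- The energy inequality bounds the power of the residual from below. -/
theorem Triple.integral_inner_nonneg [Fact (1 ≤ p)] (hd : d = 2 ∨ d = 3) (hΩ : IsC2Domain Ω)
    (hT : 0 < T) (hdp : (d : ℝ≥0∞) < p) (hp : p ≠ ⊤) (hM : M.Standing Ω p)
    (h : S.RegChi T p) {η ξ κ : ℝ → LL Ω ℝ 2} (hη2 : MemLp η 2 (timeMeasure T))
    (hη : ∀ᵐ t ∂(timeMeasure T), M.SubdiffΦ Ω (S.chi t) (η t))
    (hξ2 : MemLp ξ 2 (timeMeasure T))
    (hξ : ∀ᵐ t ∂(timeMeasure T), ∀ᵐ x ∂(volume.restrict Ω),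
      SubdiffIndic (Ici 0) (S.chi t x) (ξ t x))
    (hκ2 : MemLp κ 2 (timeMeasure T))
    (hκ : ∀ᵐ t ∂(timeMeasure T),
      κ t =ᵐ[volume.restrict Ω] fun x => deriv M.gammaHat (S.chi t x)
        + deriv M.b (S.chi t x) * S.elastEnergy M t x - M.Θ (S.w t x))
    (hE : ForTimes T (S.EnergyIneqAt M)) :
    0 ≤ ∫ r in (0 : ℝ)..T, inner ℝ (-(S.chit r + η r + ξ r + κ r)) (S.chit r) := by
  have := hΩ.isFiniteMeasure
  obtain ⟨N, hN, hchain⟩ := h.exists_convex_chain hΩ hp hM hη2 hη hξ2 hξ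
  obtain ⟨B, E, hB, hBe, hEe⟩ := h.exists_comp_curve (by omega) hΩ hT hdp hp hM.gammaHat_smooth
  let u : LL Ω ℝ 2 := Lp.const 2 (volume.restrict Ω) (1 : ℝ)
  have hu : u =ᵐ[volume.restrict Ω] fun _ => (1 : ℝ) := Lp.coeFn_const _ _ _
  have hΓ : HasTimeDeriv T (fun t => inner ℝ u (B t)) (fun t => inner ℝ u (E t)) :=
    hB.clm_comp (innerSL ℝ u)
  have hΓe : ∀ t ∈ Icc 0 T, ∫ x in Ω, M.gammaHat (S.chi t x) = inner ℝ u (B t) := by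
    intro t ht
    rw [inner_eq_integral hu (hBe t ht)]
    simp only [one_mul]
  have hY : ∀ᵐ r ∂(timeMeasure T), ∫ x in Ω, S.chit r x *
          (-(deriv M.b (S.chi r x) * S.elastEnergy M r x) + M.Θ (S.w r x))
      = inner ℝ u (E r) - inner ℝ (κ r) (S.chit r) := by
    filter_upwards [hEe, hκ] with r h1 h2
    rw [inner_eq_integral hu h1, inner_eq_integral h2 (ae_eq_refl _),
      ← integral_sub (integrable_mul_of_ae_eq hu h1) (integrable_mul_of_ae_eq h2 (ae_eq_refl _))]
    refine integral_congr_ae (Eventually.of_forall fun x => ?_)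
    ring
  have i1 : IntegrableOn (fun r => inner ℝ (S.chit r) (S.chit r)) (Ioc 0 T) :=
    integrable_inner_of_memLp h.chit_L2 h.chit_L2
  have i2 : IntegrableOn (fun r => inner ℝ (η r + ξ r) (S.chit r)) (Ioc 0 T) :=
    integrable_inner_of_memLp (hη2.add hξ2) h.chit_L2
  have i3 : IntegrableOn (fun r => inner ℝ (κ r) (S.chit r)) (Ioc 0 T) :=
    integrable_inner_of_memLp hκ2 h.chit_L2
  let φ : ℝ → ℝ := fun r => inner ℝ (-(S.chit r + η r + ξ r + κ r)) (S.chit r)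
  have hφ : φ = fun r => -(inner ℝ (S.chit r) (S.chit r) + inner ℝ (η r + ξ r) (S.chit r)
      + inner ℝ (κ r) (S.chit r)) := by
    ext r
    simp only [φ, inner_neg_left, inner_add_left]
    ring
  have hφi : IntegrableOn φ (Ioc 0 T) := by
    rw [hφ]
    exact ((i1.add i2).add i3).neg
  let P : ℝ → ℝ := fun t => ∫ r in (0 : ℝ)..t, φ r
  have hP : HasTimeDeriv T P φ := ⟨hφi, fun t _ => by simp [P]⟩
  let G : Set ℝ := {t | t ∈ Ioc 0 T ∧ t ∈ N ∧ M.Φ Ω (S.chi t) ≠ ⊤ ∧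
    ∀ᵐ x ∂(volume.restrict Ω), 0 ≤ S.chi t x}
  have hG : ∀ᵐ t ∂(timeMeasure T), t ∈ G := by
    filter_upwards [ae_restrict_mem measurableSet_Ioc, hN, hη, hξ] with t h1 h2 h3 h4
    exact ⟨h1, h2, h3.1, h4.mono fun x hx => hx.1⟩
  -- The smooth potential integrates exactly, so the energy inequality leaves `∫|χ_t|² + Φ(χ(t)) -
  -- Φ(χ(s)) + ∫⟨κ, χ_t⟩ ≤ 0`. The chain inequality bounds the increment of `Φ` below by `∫⟨η + ξ,
  -- χ_t⟩`.
  have key : ∀ s ∈ G, ∀ t ∈ G, s ≤ t → S.EnergyIneqAt M s t → P s ≤ P t := by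
    rintro s ⟨hs, hsN, hsΦ, hsχ⟩ t ⟨ht, htN, htΦ, htχ⟩ hst hEst
    have hs' := Ioc_subset_Icc_self hs
    have ht' := Ioc_subset_Icc_self ht
    have hii : ∀ {φ : ℝ → ℝ}, IntegrableOn φ (Ioc 0 T) → IntervalIntegrable φ volume s t :=
      fun hφ => intervalIntegrable_of_integrableOn_Ioc hφ hs' ht'
    have h1 := hchain s hsN t htN hst
    rw [Triple.EnergyIneqAt, Model.energy_eq hsΦ hsχ, Model.energy_eq htΦ htχ,
      intervalIntegral_congr_ae_timeMeasure hY hs' ht', ← EReal.coe_add, ← EReal.coe_add,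
      EReal.coe_le_coe_iff, hΓe s hs', hΓe t ht',
      intervalIntegral.integral_sub (hii hΓ.1) (hii i3), ← hΓ.sub_eq hs' ht'] at hEst
    have h2 : ∫ r in s..t, ∫ x in Ω, S.chit r x ^ 2
        = ∫ r in s..t, inner ℝ (S.chit r) (S.chit r) := by
      congr 1
      ext r
      rw [inner_eq_integral (ae_eq_refl _) (ae_eq_refl _)]
      simp only [sq]
    have h3 := hP.sub_eq hs' ht'
    rw [hφ, intervalIntegral.integral_neg,
      intervalIntegral.integral_add ((hii i1).add (hii i2)) (hii i3),
      intervalIntegral.integral_add (hii i1) (hii i2)] at h3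
    rw [h2] at hEst
    linarith
  have hP0 : P 0 = 0 := intervalIntegral.integral_same
  have hpos : ∀ t ∈ G, 0 ≤ P t := by
    intro t ht
    -- Time `0` need not be a good time for the chain inequality, so it is reached as a limit of
    -- good times using continuity of `P`; the final time `T` is treated in the same way.
    have h1 : ∀ᵐ s ∂(timeMeasure t), P s ∈ Iic (P t) := by
      have h2 : ∀ᵐ s ∂(timeMeasure t), s ∈ G :=
        ae_mono (Measure.restrict_mono (Ioc_subset_Ioc_right ht.1.2) le_rfl) hG
      filter_upwards [(hE t ht.1).2, h2, ae_restrict_mem measurableSet_Ioc] with s a1 a2 a3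
      exact key s a2 t ht a3.2 a1
    have h3 := mem_of_ae_mem_of_continuousOn ht.1.1
      (hP.continuousOn.mono (Icc_subset_Icc_right ht.1.2)) isClosed_Iic h1
      (t := 0) ⟨le_rfl, ht.1.1.le⟩
    rwa [hP0] at h3
  exact mem_of_ae_mem_of_continuousOn hT hP.continuousOn isClosed_Ici
    (hG.mono fun t ht => hpos t ht) (t := T) ⟨hT.le, le_rfl⟩

theorem ae_eq_zero_of_integral_nonneg {f : ℝ → ℝ} (hT : 0 ≤ T) (hf : IntegrableOn f (Ioc 0 T))
    (hf0 : ∀ᵐ t ∂(timeMeasure T), f t ≤ 0) (h : 0 ≤ ∫ r in (0 : ℝ)..T, f r) :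
    ∀ᵐ t ∂(timeMeasure T), f t = 0 := by
  rw [intervalIntegral.integral_of_le hT] at h
  have h1 : ∫ r in Ioc 0 T, -f r = 0 := by
    rw [integral_neg]
    linarith [integral_nonpos_of_ae hf0]
  have h2 := (integral_eq_zero_iff_of_nonneg_ae
    (hf0.mono fun t ht => by simpa using ht) hf.neg).1 h1
  filter_upwards [h2] with t ht
  simpa using ht

/-- The pointwise inclusion satisfied by the phase parameter. -/
theorem Triple.Regular.exists_multiplier [Fact (1 ≤ p)] (hd : d = 2 ∨ d = 3) (hΩ : IsC2Domain Ω)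
    (hT : 0 < T) (hdp : (d : ℝ≥0∞) < p) (hp : p ≠ ⊤) (hM : M.Standing Ω p)
    (h : S.Regular T p) {η ξ : ℝ → LL Ω ℝ 2} (hη2 : MemLp η 2 (timeMeasure T))
    (hη : ∀ᵐ t ∂(timeMeasure T), M.SubdiffΦ Ω (S.chi t) (η t))
    (hξ2 : MemLp ξ 2 (timeMeasure T))
    (hξ : ∀ᵐ t ∂(timeMeasure T), ∀ᵐ x ∂(volume.restrict Ω),
      SubdiffIndic (Ici 0) (S.chi t x) (ξ t x))
    (hirr : S.Irreversible T) (hVI : S.OneSidedVI M T p (fun t => (ξ t : L0 Ω ℝ)))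
    (hE : ForTimes T (S.EnergyIneqAt M)) :
    ∃ ζ : ℝ → LL Ω ℝ 2, MemLp ζ 2 (timeMeasure T) ∧
      (∀ᵐ t ∂(timeMeasure T), ∀ᵐ x ∂(volume.restrict Ω),
        SubdiffIndic (Iic 0) (S.chit t x) (ζ t x)) ∧
      ∀ᵐ t ∂(timeMeasure T), ∀ᵐ x ∂(volume.restrict Ω),
        S.chit t x + ζ t x + η t x + ξ t x + deriv M.gammaHat (S.chi t x)
          = -(deriv M.b (S.chi t x) * S.elastEnergy M t x) + M.Θ (S.w t x) := by
  have hp2 : 2 ≤ p := by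
    refine le_trans ?_ hdp.le
    have : 2 ≤ d := by omega
    exact_mod_cast this
  obtain ⟨κ, hκ2, hκ⟩ := h.exists_residual hd hΩ hT hdp hp hM
  let ζ : ℝ → LL Ω ℝ 2 := fun t => -(S.chit t + η t + ξ t + κ t)
  have hζ2 : MemLp ζ 2 (timeMeasure T) := (((h.regChi.chit_L2.add hη2).add hξ2).add hκ2).neg
  have hζ0 := hVI.ae_nonneg hp2 hΩ hp hM h.regChi hη hκ
  have hpow := Triple.integral_inner_nonneg hd hΩ hT hdp hp hM h.regChi hη2 hη hξ2 hξ hκ2 hκ hE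
  have hle : ∀ᵐ t ∂(timeMeasure T), inner ℝ (ζ t) (S.chit t) ≤ 0 := by
    filter_upwards [hζ0, hirr] with t h1 h2
    rw [inner_eq_integral (ae_eq_refl _) (ae_eq_refl _)]
    refine integral_nonpos_of_ae ?_
    filter_upwards [h1, h2] with x a1 a2 using mul_nonpos_of_nonneg_of_nonpos a1 a2
  -- The power is nonpositive at almost every time by the signs of `ζ` and `χ_t`, yet its time
  -- integral is nonnegative; hence it vanishes.
  have hzero := ae_eq_zero_of_integral_nonneg hT.le
    (integrable_inner_of_memLp hζ2 h.regChi.chit_L2) hle hpow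
  refine ⟨ζ, hζ2, ?_, ?_⟩
  · filter_upwards [hζ0, hirr, hzero] with t h1 h2 h3
    rw [inner_eq_integral (ae_eq_refl _) (ae_eq_refl _)] at h3
    have h4 : ∫ x in Ω, -(ζ t x * S.chit t x) = 0 := by rw [integral_neg, h3, neg_zero]
    have h5 := (integral_eq_zero_iff_of_nonneg_ae (by
      filter_upwards [h1, h2] with x a1 a2
      exact neg_nonneg.2 (mul_nonpos_of_nonneg_of_nonpos a1 a2))
      (integrable_mul_of_ae_eq (ae_eq_refl _) (ae_eq_refl _)).neg).1 h4
    filter_upwards [h1, h2, h5] with x a1 a2 a3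
    -- With `ζ χ_t = 0` the subgradient inequality reduces to `ζ y ≤ 0` for `y ≤ 0`, which is the
    -- sign of `ζ`.
    refine ⟨a2, fun y hy => ?_⟩
    have a4 : ζ t x * S.chit t x = 0 := neg_eq_zero.1 a3
    rw [mul_sub, a4, sub_zero]
    exact mul_nonpos_of_nonneg_of_nonpos a1 hy
  · filter_upwards [hκ] with t h1
    filter_upwards [h1, Lp.coeFn_neg (S.chit t + η t + ξ t + κ t),
      Lp.coeFn_add (S.chit t + η t + ξ t) (κ t), Lp.coeFn_add (S.chit t + η t) (ξ t),
      Lp.coeFn_add (S.chit t) (η t)] with x a1 a2 a3 a4 a5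
    have a6 : ζ t x = -(S.chit t x + η t x + ξ t x + κ t x) := by
      simp only [Pi.neg_apply, Pi.add_apply] at a2 a3 a4 a5
      rw [a2, a3, a4, a5]
    rw [a6, a1]
    ring

end Complementarity

end DamagePDE

/-! ### The proposition. -/

theorem mainTheorem4 {d : ℕ} (hd : d = 2 ∨ d = 3) (Ω : Set (DamagePDE.Rd d))
    (hΩ : DamagePDE.IsC2Domain Ω) (T : ℝ) (hT : 0 < T)
    (p : ℝ≥0∞) [Fact (1 ≤ p)] (hdp : (d : ℝ≥0∞) < p) (hp : p ≠ ⊤)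
    (M : DamagePDE.Model d) (hM : M.Standing Ω p) :
    (∀ (D : DamagePDE.Data Ω), D.Admissible T → ∀ S : DamagePDE.Triple Ω,
      DamagePDE.IsWeakSolution Ω T p M D S →
        DamagePDE.ForTimes T (S.TotalEnergyIneqAt M D)) ∧
    (∀ (S : DamagePDE.Triple Ω) (η ξ : ℝ → DamagePDE.LL Ω ℝ 2), S.Regular T p →
      MemLp η 2 (DamagePDE.timeMeasure T) →
      (∀ᵐ t ∂(DamagePDE.timeMeasure T), M.SubdiffΦ Ω (S.chi t) (η t)) →
      MemLp ξ 2 (DamagePDE.timeMeasure T) →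
      (∀ᵐ t ∂(DamagePDE.timeMeasure T), ∀ᵐ x ∂(volume.restrict Ω),
        DamagePDE.SubdiffIndic (Ici 0) (S.chi t x) (ξ t x)) →
      S.Irreversible T →
      S.OneSidedVI M T p (fun t => (ξ t : DamagePDE.L0 Ω ℝ)) →
      S.WeakSelection T p (fun t => (ξ t : DamagePDE.L0 Ω ℝ)) →
      DamagePDE.ForTimes T (S.EnergyIneqAt M) →
      ∃ ζ : ℝ → DamagePDE.LL Ω ℝ 2, MemLp ζ 2 (DamagePDE.timeMeasure T) ∧
        (∀ᵐ t ∂(DamagePDE.timeMeasure T), ∀ᵐ x ∂(volume.restrict Ω),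
          DamagePDE.SubdiffIndic (Iic 0) (S.chit t x) (ζ t x)) ∧
        ∀ᵐ t ∂(DamagePDE.timeMeasure T), ∀ᵐ x ∂(volume.restrict Ω),
          S.chit t x + ζ t x + η t x + ξ t x + deriv M.gammaHat (S.chi t x)
            = -(deriv M.b (S.chi t x) * S.elastEnergy M t x) + M.Θ (S.w t x)) := by
  refine ⟨fun D hD S hS t ht => ?_, fun S η ξ hS hη2 hη hξ2 hξ hirr hVI _ hE =>
    hS.exists_multiplier hd hΩ hT hdp hp hM hη2 hη hξ2 hξ hirr hVI hE⟩
  have ht' := Ioc_subset_Icc_self ht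
  refine ⟨hS.totalEnergyIneqAt hd hΩ hT hdp hp hM hD ⟨le_rfl, hT.le⟩ ht' (hS.energy t ht).1, ?_⟩
  filter_upwards [(hS.energy t ht).2, ae_restrict_mem measurableSet_Ioc] with s h1 hs
  exact hS.totalEnergyIneqAt hd hΩ hT hdp hp hM hD ⟨hs.1.le, hs.2.trans ht.2⟩ ht' h1
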